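/- **Setting.** A centroaffine hypersurface is a smooth immersion $\psi:M^n\to\mathbb R^{n+1}$ of a smooth $n$-manifold such that for every $p\in M$ the position vector $\psi(p)$ is transversal to $d\psi(T_pM)$. For $\varepsilon\in\{1,-1\}$, the induced connection $\nabla$ and the centroaffine metric $h$ induced by $-\varepsilon\psi$ are defined by $$D_X\psi_*(Y)=\psi_*(\nabla_XY)+h(X,Y)(-\varepsilon\psi),$$ where $D$ is the flat connection of $\mathbb R^{n+1}$. The hypersurface is locally strongly convex if $h$ is positive definite for a suitable choice of $\varepsilon$. In that case, for this $\varepsilon$, let $\hat\nabla$ be the Levi-Civita connection of $h$ and $K(X,Y)=\nabla_XY-\hat\nabla_XY$. The Calabi product, with constant parameter $\lambda\neq0,-1$, of two centroaffine hypersurfaces $\psi_i:M_i\to\mathbb R^{n_i+1}$ ($i=1,2$) is the map $$\mathbb R\times M_1\times M_2\to\mathbb R^{n_1+n_2+2},\qquad (u,p,q)\mapsto(e^u\psi_1(p),\,e^{-\lambda u}\psi_2(q)).$$ **Theorem 3.1.** Let $\psi:M^n\to\mathbb R^{n+1}$ be a centroaffine hypersurface and $\varepsilon\in\{1,-1\}$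 such that the centroaffine metric $h$ induced by $-\varepsilon\psi$ is positive definite. Let $T$ be a smooth vector field with $h(T,T)=1$, let $\mathcal D_1$ be the distribution spanned by $T$, and let $\mathcal D_2,\mathcal D_3$ be smooth distributions of dimensions $n_1,n_2$ with $1+n_1+n_2=n$, such that $\mathcal D_1,\mathcal D_2,\mathcal D_3$ are mutually $h$-orthogonal. Suppose that there are real constants $\lambda_1,\lambda_2,\lambda_3$ with $$\lambda_1=\lambda_2+\lambda_3,\qquad \lambda_2\lambda_3=\varepsilon,\qquad \lambda_2\ne\lambda_3,$$ such that for all $V\in\mathcal D_2$ and $W\in\mathcal D_3$ $$K(T,T)=\lambda_1T,\quad K(T,V)=\lambda_2V,\quad K(T,W)=\lambda_3W,\quad K(V,W)=0.$$ Then $\psi$ is locally the Calabi product of two locally strongly convex centroaffine hypersurfaces of dimensions $n_1$ and $n_2$. That is, for every $p\in M$ there are a constant $\lambda\ne0,-1$, locally strongly convex centroaffine hypersurfaces $\psi_1:M_1^{n_1}\to\mathbb R^{n_1+1}$ and $\psi_2:M_2^{n_2}\to\mathbb R^{n_2+1}$, a diffeomorphism $\Phi$ from an open neighbourhood $U$ of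 $p$ onto an open subset of $\mathbb R\times M_1\times M_2$, and a linear isomorphism $A:\mathbb R^{n_1+1}\times\mathbb R^{n_2+1}\to\mathbb R^{n+1}$, such that for every $x\in U$, writing $\Phi(x)=(u,p_1,p_2)$, $$\psi(x)=A\big(e^{u}\psi_1(p_1),\,e^{-\lambda u}\psi_2(p_2)\big).$$ -/

import Mathlib

open scoped Manifold ContDiff Topology

noncomputable section

namespace Centroaffine

/-- The space `ℝ^k`. -/
abbrev Euc (k : ℕ) : Type := EuclideanSpace ℝ (Fin k)

/-- A (not necessarily continuous) tangent vector field on an `n`-manifold. -/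
abbrev VField (n : ℕ) (M : Type*) [TopologicalSpace M] [ChartedSpace (Euc n) M] : Type _ :=
  Π p : M, TangentSpace (𝓡 n) p

/-- The vector field `Y`, viewed as a map from `M` into its tangent bundle. -/
def VField.toBundle {n : ℕ} {M : Type*} [TopologicalSpace M] [ChartedSpace (Euc n) M]
    (Y : VField n M) (p : M) : TangentBundle (𝓡 n) M := ⟨p, Y p⟩

section Hypersurface

variable {n : ℕ} {M : Type*} [TopologicalSpace M] [ChartedSpace (Euc n) M]

/-- `Y` is differentiable at `p`. -/
def VField.DiffAt [IsManifold (𝓡 n) ∞ M] (Y : VField n M) (p : M) : Prop :=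
  MDifferentiableAt (𝓡 n) (𝓡 n).tangent Y.toBundle p

/-- `Y` is smooth on the set `U`. -/
def VField.SmoothOn [IsManifold (𝓡 n) ∞ M] (Y : VField n M) (U : Set M) : Prop :=
  ContMDiffOn (𝓡 n) (𝓡 n).tangent ∞ Y.toBundle U

/-- A centroaffine hypersurface `ψ : M^n → ℝ^(n+1)`: a smooth immersion such that at each point
the position vector `ψ p` is transversal to the tangent hyperplane `dψ_p (T_p M)`. -/
structure IsCentroaffine (ψ : M → Euc (n + 1)) : Prop where
  smooth : ContMDiff (𝓡 n) 𝓘(ℝ, Euc (n + 1)) ∞ ψ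
  immersion : ∀ p, Function.Injective (mvfderiv (𝓡 n) ψ p)
  transversal : ∀ p, ψ p ∉ Set.range (mvfderiv (𝓡 n) ψ p)

/-- The linear map `T_p M × ℝ → ℝ^(n+1)`, `(v, c) ↦ dψ_p v + c ψ(p)`. It is bijective for a
centroaffine hypersurface. -/
def splitting (ψ : M → Euc (n + 1)) (p : M) :
    (TangentSpace (𝓡 n) p × ℝ) →L[ℝ] Euc (n + 1) :=
  (mvfderiv (𝓡 n) ψ p).coprod (ContinuousLinearMap.toSpanSingleton ℝ (ψ p))

/-- The flat derivative `D_v ψ_*(Y)` at `p`, as a linear map in `v ∈ T_p M`. -/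
def flatDeriv (ψ : M → Euc (n + 1)) (Y : VField n M) (p : M) :
    TangentSpace (𝓡 n) p →L[ℝ] Euc (n + 1) :=
  mvfderiv (𝓡 n) (fun q ↦ mvfderiv (𝓡 n) ψ q (Y q)) p

/-- The centroaffine metric `h` induced by `-ε ψ`: `h(v, w)` is the coefficient of `-ε ψ` in
`D_v ψ_*(W)`, where `W` is any extension of `w` (see `gauss_formula`). -/
def metric (ε : ℝ) (ψ : M → Euc (n + 1)) [IsManifold (𝓡 n) ∞ M] (p : M)
    (v w : TangentSpace (𝓡 n) p) : ℝ :=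
  -ε * ((splitting ψ p).inverse (flatDeriv ψ (FiberBundle.extend (Euc n) w) p v)).2

/-- Positive definiteness of the centroaffine metric induced by `-ε ψ`. -/
def MetricPosDef (ε : ℝ) (ψ : M → Euc (n + 1)) [IsManifold (𝓡 n) ∞ M] : Prop :=
  ∀ (p : M) (v : TangentSpace (𝓡 n) p), v ≠ 0 → 0 < metric ε ψ p v v

/-- A locally strongly convex centroaffine hypersurface: for a suitable sign `ε`, the centroaffine
metric induced by `-ε ψ` is positive definite. -/
structure IsLocallyStronglyConvex (ψ : M → Euc (n + 1)) [IsManifold (𝓡 n) ∞ M] : Prop where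
  centroaffine : IsCentroaffine ψ
  definite : ∃ ε : ℝ, (ε = 1 ∨ ε = -1) ∧ MetricPosDef ε ψ

lemma IsCentroaffine.splitting_isInvertible {ψ : M → Euc (n + 1)} (hψ : IsCentroaffine ψ) (p : M) :
    (splitting ψ p).IsInvertible := by
  have hinj : Function.Injective (splitting ψ p) := by
    rw [injective_iff_map_eq_zero]
    rintro ⟨v, c⟩ hvc
    simp only [splitting, ContinuousLinearMap.coprod_apply,
      ContinuousLinearMap.toSpanSingleton_apply] at hvc
    have hc : c = 0 := by
      by_contra hc
      apply hψ.transversal p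
      refine ⟨-(c⁻¹ • v), ?_⟩
      rw [map_neg, map_smul, eq_neg_of_add_eq_zero_left hvc, smul_neg, neg_neg, smul_smul,
        inv_mul_cancel₀ hc, one_smul]
    subst hc
    have hv : v = 0 := by
      apply hψ.immersion p
      simpa using hvc
    simp [hv]
  have : FiniteDimensional ℝ (TangentSpace (𝓡 n) p) := inferInstanceAs (FiniteDimensional ℝ (Euc n))
  have : T2Space (TangentSpace (𝓡 n) p) := inferInstanceAs (T2Space (Euc n))
  have hdim : Module.finrank ℝ (TangentSpace (𝓡 n) p × ℝ) = Module.finrank ℝ (Euc (n + 1)) := by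
    have : Module.finrank ℝ (TangentSpace (𝓡 n) p) = n :=
      (finrank_euclideanSpace_fin (𝕜 := ℝ) (n := n))
    rw [Module.finrank_prod, this]
    simp
  exact ⟨(LinearEquiv.ofInjectiveOfFinrankEq (splitting ψ p).toLinearMap hinj
    hdim).toContinuousLinearEquiv, by ext x <;> rfl⟩

lemma IsCentroaffine.inverse_push {ψ : M → Euc (n + 1)} (hψ : IsCentroaffine ψ) {p : M}
    (v : TangentSpace (𝓡 n) p) :
    (splitting ψ p).inverse (mvfderiv (𝓡 n) ψ p v) = (v, 0) := by
  have h : splitting ψ p (v, 0) = mvfderiv (𝓡 n) ψ p v := by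
    simp [splitting]
  rw [← h, (hψ.splitting_isInvertible p).inverse_apply_self]

variable [IsManifold (𝓡 n) ∞ M]

lemma IsCentroaffine.mdifferentiableAt_push {ψ : M → Euc (n + 1)} (hψ : IsCentroaffine ψ)
    {Y : VField n M} {p : M} (hY : Y.DiffAt p) :
    MDifferentiableAt (𝓡 n) 𝓘(ℝ, Euc (n + 1)) (fun q ↦ mvfderiv (𝓡 n) ψ q (Y q)) p := by
  have h1 : MDifferentiableAt (𝓡 n).tangent 𝓘(ℝ, Euc (n + 1)).tangent
      (tangentMap (𝓡 n) 𝓘(ℝ, Euc (n + 1)) ψ) (Y.toBundle p) :=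
    (hψ.smooth.contMDiff_tangentMap (m := 1) (by norm_cast)).contMDiffAt.mdifferentiableAt
      one_ne_zero
  have h2 := (contMDiff_snd_tangentBundle_modelSpace (n := 1) (Euc (n + 1))
    𝓘(ℝ, Euc (n + 1))).contMDiffAt.mdifferentiableAt one_ne_zero
    (x := tangentMap (𝓡 n) 𝓘(ℝ, Euc (n + 1)) ψ (Y.toBundle p))
  exact h2.comp p (h1.comp p hY)

lemma IsCentroaffine.flatDeriv_add {ψ : M → Euc (n + 1)} (hψ : IsCentroaffine ψ)
    {Y Z : VField n M} {p : M} (hY : Y.DiffAt p) (hZ : Z.DiffAt p) :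
    flatDeriv ψ (Y + Z) p = flatDeriv ψ Y p + flatDeriv ψ Z p := by
  have h := mvfderiv_fun_add (hψ.mdifferentiableAt_push hY) (hψ.mdifferentiableAt_push hZ)
  simpa only [flatDeriv, Pi.add_apply, map_add] using h

lemma IsCentroaffine.flatDeriv_smul {ψ : M → Euc (n + 1)} (hψ : IsCentroaffine ψ)
    {f : M → ℝ} {Y : VField n M} {p : M} (hf : MDifferentiableAt (𝓡 n) 𝓘(ℝ, ℝ) f p)
    (hY : Y.DiffAt p) :
    flatDeriv ψ (f • Y) p = f p • flatDeriv ψ Y p +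
      (mvfderiv (𝓡 n) f p).smulRight (mvfderiv (𝓡 n) ψ p (Y p)) := by
  have h := mvfderiv_fun_smul hf (hψ.mdifferentiableAt_push hY)
  simpa only [flatDeriv, Pi.smul_apply', map_smul] using h

/-- The connection `∇` induced by the centroaffine normalization: `∇_X Y` is the tangential
component of `D_X ψ_*(Y)`. -/
def inducedConnection {ψ : M → Euc (n + 1)} (hψ : IsCentroaffine ψ) :
    CovariantDerivative (𝓡 n) (Euc n) (TangentSpace (𝓡 n) : M → Type _) where
  toFun Y p := ContinuousLinearMap.fst ℝ (TangentSpace (𝓡 n) p) ℝ ∘L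
    (splitting ψ p).inverse ∘L flatDeriv ψ Y p
  isCovariantDerivativeOnUniv :=
    { add := fun {Y Z p} hY hZ _ ↦ by
        ext v : 1
        simp [hψ.flatDeriv_add hY hZ]
      leibniz := fun {Y f p} hY hf _ ↦ by
        ext v : 1
        simp [hψ.flatDeriv_smul hf hY, hψ.inverse_push] }

/-- The formula of Gauss `D_X ψ_*(Y) = ψ_*(∇_X Y) + h(X, Y) (-ε ψ)`. -/
theorem gauss_formula {ψ : M → Euc (n + 1)} (hψ : IsCentroaffine ψ) {ε : ℝ}
    (hε : ε = 1 ∨ ε = -1) {Y : VField n M} {p : M} (hY : Y.DiffAt p)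
    (v : TangentSpace (𝓡 n) p) :
    flatDeriv ψ Y p v =
      mvfderiv (𝓡 n) ψ p (inducedConnection hψ Y p v) + metric ε ψ p v (Y p) • (-ε • ψ p) := by
  have htens : TensorialAt (𝓡 n) (Euc n)
      (fun Z : VField n M ↦ ((splitting ψ p).inverse (flatDeriv ψ Z p v)).2) p :=
    { smul := fun {f Z} hf hZ ↦ by
        simp [hψ.flatDeriv_smul hf hZ, hψ.inverse_push]
      add := fun {Z W} hZ hW ↦ by
        simp [hψ.flatDeriv_add hZ hW] }
  have hpt := htens.pointwise (FiberBundle.mdifferentiableAt_extend (𝓡 n) (Euc n) (Y p)) hY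
    (FiberBundle.extend_apply_self (Euc n) (Y p))
  have hεε : ε * ε = 1 := by rcases hε with rfl | rfl <;> norm_num
  have hself : flatDeriv ψ Y p v
      = splitting ψ p ((splitting ψ p).inverse (flatDeriv ψ Y p v)) :=
    ((hψ.splitting_isInvertible p).self_apply_inverse _).symm
  have hcoef : metric ε ψ p v (Y p) • (-ε • ψ p)
      = ((splitting ψ p).inverse (flatDeriv ψ Y p v)).2 • ψ p := by
    rw [← hpt, metric, smul_smul]
    congr 1
    linear_combination ((splitting ψ p).inverse
      (flatDeriv ψ (FiberBundle.extend (Euc n) (Y p)) p v)).2 * hεε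
  rw [hcoef]
  refine hself.trans ?_
  rw [splitting, ContinuousLinearMap.coprod_apply, ContinuousLinearMap.toSpanSingleton_apply]
  rfl

/-- `cov` is the Levi-Civita connection of `g`: it is torsion free and `g` is parallel. -/
structure IsLeviCivita (g : Π p : M, TangentSpace (𝓡 n) p → TangentSpace (𝓡 n) p → ℝ)
    (cov : CovariantDerivative (𝓡 n) (Euc n) (TangentSpace (𝓡 n) : M → Type _)) : Prop where
  torsion_free : ∀ (p : M) (X Y : VField n M), X.DiffAt p → Y.DiffAt p →
    cov Y p (X p) - cov X p (Y p) = VectorField.mlieBracket (𝓡 n) X Y p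
  compatible : ∀ (p : M) (Y Z : VField n M), Y.DiffAt p → Z.DiffAt p →
    ∀ v : TangentSpace (𝓡 n) p,
      mvfderiv (𝓡 n) (fun q ↦ g q (Y q) (Z q)) p v = g p (cov Y p v) (Z p) + g p (Y p) (cov Z p v)

/-- The difference tensor `K(v, w) = ∇_v w - ∇'_v w` of the induced connection `∇` and a second
connection `∇'` (see `differenceTensor_apply`). -/
def differenceTensor {ψ : M → Euc (n + 1)} (hψ : IsCentroaffine ψ)
    (cov' : CovariantDerivative (𝓡 n) (Euc n) (TangentSpace (𝓡 n) : M → Type _))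
    (p : M) (v w : TangentSpace (𝓡 n) p) : TangentSpace (𝓡 n) p :=
  (inducedConnection hψ).difference cov' p w v

theorem differenceTensor_apply {ψ : M → Euc (n + 1)} (hψ : IsCentroaffine ψ)
    (cov' : CovariantDerivative (𝓡 n) (Euc n) (TangentSpace (𝓡 n) : M → Type _))
    (X Y : VField n M) {p : M} (hY : Y.DiffAt p) :
    differenceTensor hψ cov' p (X p) (Y p) = inducedConnection hψ Y p (X p) - cov' Y p (X p) := by
  have h := IsCovariantDerivativeOn.difference_apply
    (inducedConnection hψ).isCovariantDerivativeOnUniv cov'.isCovariantDerivativeOnUniv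
    (Set.mem_univ p) hY
  exact congrArg (fun A : TangentSpace (𝓡 n) p →L[ℝ] TangentSpace (𝓡 n) p ↦ A (X p)) h

/-- A smooth distribution of dimension `k`: subspaces `D p ⊆ T_p M` of dimension `k`, locally
spanned by smooth vector fields. -/
structure IsDistribution (k : ℕ) (D : Π p : M, Submodule ℝ (TangentSpace (𝓡 n) p)) : Prop where
  finrank_eq : ∀ p, Module.finrank ℝ (D p) = k
  locally_spanned : ∀ p, ∃ U : Set M, IsOpen U ∧ p ∈ U ∧ ∃ X : Fin k → VField n M,
    (∀ i, (X i).SmoothOn U) ∧ ∀ q ∈ U, D q = Submodule.span ℝ (Set.range fun i ↦ X i q)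

end Hypersurface

/-- The (generalized) Calabi product `(u, p, q) ↦ (e^u ψ₁(p), e^(-l u) ψ₂(q))` with parameter `l`.
-/
def calabiProduct {n₁ n₂ : ℕ} {M₁ M₂ : Type*} (l : ℝ) (ψ₁ : M₁ → Euc (n₁ + 1))
    (ψ₂ : M₂ → Euc (n₂ + 1)) (x : ℝ × M₁ × M₂) : Euc (n₁ + 1) × Euc (n₂ + 1) :=
  (Real.exp x.1 • ψ₁ x.2.1, Real.exp (-l * x.1) • ψ₂ x.2.2)

/-- `ψ : M^n → ℝ^(n+1)` is locally the Calabi product of two locally strongly convex centroaffine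
hypersurfaces of dimensions `n₁` and `n₂`: near every point of `M` there are a constant
`l ≠ 0, -1`, two such hypersurfaces `ψ₁`, `ψ₂`, a diffeomorphism `Φ` onto an open subset of
`ℝ × M₁ × M₂`, and a linear isomorphism `A : ℝ^(n₁+1) × ℝ^(n₂+1) → ℝ^(n+1)` (that is, a
centroaffine transformation) which carries the Calabi product to `ψ`. -/
def IsLocallyCalabiProduct (n₁ n₂ : ℕ) {n : ℕ} {M : Type*} [TopologicalSpace M]
    [ChartedSpace (Euc n) M] (ψ : M → Euc (n + 1)) : Prop :=
  ∀ p : M, ∃ (l : ℝ) (_ : l ≠ 0) (_ : l ≠ -1)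
    (M₁ : Type) (_ : TopologicalSpace M₁) (_ : T2Space M₁) (_ : SecondCountableTopology M₁)
    (_ : ChartedSpace (Euc n₁) M₁) (_ : IsManifold (𝓡 n₁) ∞ M₁)
    (M₂ : Type) (_ : TopologicalSpace M₂) (_ : T2Space M₂) (_ : SecondCountableTopology M₂)
    (_ : ChartedSpace (Euc n₂) M₂) (_ : IsManifold (𝓡 n₂) ∞ M₂)
    (ψ₁ : M₁ → Euc (n₁ + 1)) (ψ₂ : M₂ → Euc (n₂ + 1))
    (Φ : PartialDiffeomorph (𝓡 n) (𝓘(ℝ, ℝ).prod ((𝓡 n₁).prod (𝓡 n₂))) M (ℝ × M₁ × M₂) ∞)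
    (A : (Euc (n₁ + 1) × Euc (n₂ + 1)) ≃L[ℝ] Euc (n + 1)),
    IsLocallyStronglyConvex ψ₁ ∧ IsLocallyStronglyConvex ψ₂ ∧ p ∈ Φ.source ∧
      ∀ x ∈ Φ.source, ψ x = A (calabiProduct l ψ₁ ψ₂ (Φ x))

end Centroaffine

end

open scoped Manifold ContDiff Topology

noncomputable section

set_option maxSynthPendingDepth 3

namespace Centroaffine

/-! ### Derivatives of contractions of operator-valued maps. -/

section Calculus

variable {X A B C : Type*} [NormedAddCommGroup X] [NormedSpace ℝ X] [NormedAddCommGroup A]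
  [NormedSpace ℝ A] [NormedAddCommGroup B] [NormedSpace ℝ B] [NormedAddCommGroup C]
  [NormedSpace ℝ C]

/-! Write `a`, `b` for the eigenvalues `λ₂`, `λ₃`, so that `ab = ε`, and `K_T` for `K(T, ·)`. The
heart of the matter is that `T` is parallel for the Levi-Civita connection and that `K_T` is then
parallel too. In a chart `f` of the hypersurface, symmetry of the third derivative gives one
identity that separates into a Gauss equation (the part skew for `h`) and a Codazzi equation (the
self-adjoint part); hence `∇̂K` is totally symmetric. On the orthogonal complement of `T` one has
`(K_T - a)(K_T - b) = 0`, so `J = (a + b) - 2 K_T` satisfies `J² = (a - b)²` there and is injective.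
Differentiating these algebraic relations and using total symmetry shows first `∇̂_T T = 0`, then
that `T` is a Killing field (`covField_skew`). The Gauss equation gives `R(u, T) T = 0`, which
forces the Killing field `T` to be parallel (`covField_eq_zero`). Consequently `R(u, T) = 0`, the
commutator `[K_u, K_T]` is explicit (`diff_commutator`), and `∇̂K(u, T, v) = 0` (`covDiff_field`).

These facts say exactly that the endomorphism `B` of the ambient space with `f ↦ df(T)` and `df(v) ↦
df(K_T v) - ε h(T, v) f` does not depend on the point (`exists_endomorphism`). It has the
eigenvalues `a` and `b` with eigenspaces of dimensions `n₁ + 1` and `n₂ + 1`, and `f` splits into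
components `f₂`, `f₃` with `T f₂ = a f₂` and `T f₃ = b f₃`. The form `h(T, ·)` is parallel, hence
closed, with a local primitive `t`; the rescaled maps `e^(-a t) f₂` and `e^(-b t) f₃` each depend on
one group of coordinates only (`SplitImmersion.exists_calabi_ball`). With `u = a t` this is a Calabi
product of parameter `-b / a`, which is not `-1` because `a ≠ b`.

Finally the factors inherit transversality and convexity from the product
(`isLocallyStronglyConvex_factors`), and a chart carries the manifold data to this flat setting
(`isEigenField_chart`). -/

lemma fderiv_apply_one {c : X → A →L[ℝ] B} {a : X → A} {x : X} (hc : DifferentiableAt ℝ c x)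
    (ha : DifferentiableAt ℝ a x) (u : X) :
    fderiv ℝ (fun y ↦ c y (a y)) x u = fderiv ℝ c x u (a x) + c x (fderiv ℝ a x u) := by
  rw [(hc.hasFDerivAt.clm_apply ha.hasFDerivAt).fderiv]
  simp [add_comm]

lemma fderiv_apply_two {c : X → A →L[ℝ] B →L[ℝ] C} {a : X → A} {b : X → B} {x : X}
    (hc : DifferentiableAt ℝ c x) (ha : DifferentiableAt ℝ a x) (hb : DifferentiableAt ℝ b x)
    (u : X) :
    fderiv ℝ (fun y ↦ c y (a y) (b y)) x u =
      fderiv ℝ c x u (a x) (b x) + c x (fderiv ℝ a x u) (b x) + c x (a x) (fderiv ℝ b x u) := by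
  rw [fderiv_apply_one (hc.clm_apply ha) hb, fderiv_apply_one hc ha]
  simp

lemma fderiv_apply_const {c : X → A →L[ℝ] B} {x : X} (hc : DifferentiableAt ℝ c x) (a : A) (u : X) :
    fderiv ℝ (fun y ↦ c y a) x u = fderiv ℝ c x u a := by
  simp [fderiv_apply_one hc (differentiableAt_const a)]

lemma fderiv_apply_const_const {c : X → A →L[ℝ] B →L[ℝ] C} {x : X} (hc : DifferentiableAt ℝ c x)
    (a : A) (b : B) (u : X) : fderiv ℝ (fun y ↦ c y a b) x u = fderiv ℝ c x u a b := by
  simp [fderiv_apply_two hc (differentiableAt_const a) (differentiableAt_const b)]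

end Calculus

/-! ### Integrability conditions of the Gauss formula. -/

section Integrability

variable {E F : Type*} [NormedAddCommGroup E] [NormedSpace ℝ E] [NormedAddCommGroup F]
  [NormedSpace ℝ F]

/-- The integrability conditions of the equation `D²f = df ∘ G - ε h f`. -/
lemma integrability {ε : ℝ} (hε : ε ≠ 0) {f : E → F} {G : E → E →L[ℝ] E →L[ℝ] E}
    {h : E → E →L[ℝ] E →L[ℝ] ℝ} {x : E} (hf : ContDiffAt ℝ ∞ f x) (dG : DifferentiableAt ℝ G x)
    (dh : DifferentiableAt ℝ h x)
    (ht : ∀ v, ∀ c : ℝ, fderiv ℝ f x v + c • f x = 0 → v = 0 ∧ c = 0)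
    (hg : ∀ᶠ y in 𝓝 x, ∀ u v, fderiv ℝ (fderiv ℝ f) y u v =
      fderiv ℝ f y (G y u v) - (ε * h y u v) • f y) (u v w : E) :
    fderiv ℝ G x u v w + G x u (G x v w) - (ε * h x v w) • u =
      fderiv ℝ G x v u w + G x v (G x u w) - (ε * h x u w) • v ∧
    h x u (G x v w) + fderiv ℝ h x u v w = h x v (G x u w) + fderiv ℝ h x v u w := by
  have hf1 : ContDiffAt ℝ ∞ (fderiv ℝ f) x := hf.fderiv_right (by norm_cast)
  have hf2 : ContDiffAt ℝ ∞ (fderiv ℝ (fderiv ℝ f)) x := hf1.fderiv_right (by norm_cast)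
  have df : DifferentiableAt ℝ f x := hf.differentiableAt (by simp)
  have df2 : DifferentiableAt ℝ (fderiv ℝ f) x := hf1.differentiableAt (by simp)
  -- Differentiate the equation once more and substitute it for the second derivatives that appear,
  -- so that only `df` and `f` remain.
  have key : ∀ u v : E, fderiv ℝ (fderiv ℝ (fderiv ℝ f)) x u v w =
      fderiv ℝ f x (fderiv ℝ G x u v w + G x u (G x v w) - (ε * h x v w) • u)
      - (ε * (h x u (G x v w) + fderiv ℝ h x u v w)) • f x := by
    intro u v
    rw [← fderiv_apply_const_const (hf2.differentiableAt (by simp))]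
    have hev : (fun y ↦ fderiv ℝ (fderiv ℝ f) y v w) =ᶠ[𝓝 x] fun y ↦
        fderiv ℝ f y (G y v w) - (ε * h y v w) • f y := by
      filter_upwards [hg] with y hy using hy v w
    have d1 : DifferentiableAt ℝ (fun y ↦ G y v w) x := by fun_prop
    have d3 : DifferentiableAt ℝ (fun y ↦ h y v w) x := by fun_prop
    have d4 : DifferentiableAt ℝ (fun y ↦ ε * h y v w) x := by fun_prop
    have d5 : DifferentiableAt ℝ (fun y ↦ fderiv ℝ f y (G y v w)) x := by fun_prop
    rw [hev.fderiv_eq, fderiv_fun_sub d5 (d4.fun_smul df), sub_apply,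
      fderiv_apply_one df2 d1, fderiv_fun_smul d4 df, fderiv_const_mul d3]
    simp only [add_apply, smul_apply, ContinuousLinearMap.smulRight_apply,
      fderiv_apply_const_const dG, fderiv_apply_const_const dh]
    rw [hg.self_of_nhds]
    simp only [map_add, map_sub, map_smul, smul_eq_mul]
    module
  have hsymm : fderiv ℝ (fderiv ℝ (fderiv ℝ f)) x u v w =
      fderiv ℝ (fderiv ℝ (fderiv ℝ f)) x v u w :=
    DFunLike.congr_fun (hf1.isSymmSndFDerivAt
      (by simp; exact WithTop.coe_le_coe.2 (le_top : (2 : ℕ∞) ≤ ⊤)) u v) w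
  rw [key u v, key v u] at hsymm
  -- Transversality separates the tangential part from the multiple of `f`; these are the two
  -- asserted identities.
  have h0 := ht (fderiv ℝ G x u v w + G x u (G x v w) - (ε * h x v w) • u -
      (fderiv ℝ G x v u w + G x v (G x u w) - (ε * h x u w) • v))
    (ε * (h x v (G x u w) + fderiv ℝ h x v u w) - ε * (h x u (G x v w) + fderiv ℝ h x u v w)) (by
      rw [map_sub]
      linear_combination (norm := module) hsymm)
  refine ⟨sub_eq_zero.1 h0.1, ?_⟩
  have h1 := h0.2
  rw [← mul_sub, mul_eq_zero, sub_eq_zero] at h1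
  exact (h1.resolve_left hε).symm

end Integrability

/-! ### Structure equations: the Gauss and Codazzi equations. -/

/-- The structure equations of a centroaffine immersion `f` of an open set `O`, in terms of the
Levi-Civita connection `Γ` of its metric `h` and of the difference tensor `K`. -/
structure StructureEquations {E F : Type*} [NormedAddCommGroup E] [NormedSpace ℝ E]
    [NormedAddCommGroup F] [NormedSpace ℝ F] (ε : ℝ) (O : Set E) (f : E → F)
    (Γ K : E → E →L[ℝ] E →L[ℝ] E) (h : E → E →L[ℝ] E →L[ℝ] ℝ) : Prop where
  isOpen : IsOpen O
  ne_zero : ε ≠ 0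
  smooth : ContDiffOn ℝ ∞ f O
  smooth_conn : ContDiffOn ℝ ∞ Γ O
  smooth_diff : ContDiffOn ℝ ∞ K O
  smooth_metric : ContDiffOn ℝ ∞ h O
  transversal : ∀ x ∈ O, ∀ v, ∀ c : ℝ, fderiv ℝ f x v + c • f x = 0 → v = 0 ∧ c = 0
  gauss : ∀ x ∈ O, ∀ u v, fderiv ℝ (fderiv ℝ f) x u v =
    fderiv ℝ f x (Γ x u v + K x u v) - (ε * h x u v) • f x
  conn_symm : ∀ x ∈ O, ∀ u v, Γ x u v = Γ x v u
  diff_symm : ∀ x ∈ O, ∀ u v, K x u v = K x v u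
  cubic_symm : ∀ x ∈ O, ∀ u v w, h x (K x u v) w = h x v (K x u w)
  metric_symm : ∀ x ∈ O, ∀ u v, h x u v = h x v u
  metric_pos : ∀ x ∈ O, ∀ v, v ≠ 0 → 0 < h x v v
  compatible : ∀ x ∈ O, ∀ u v w, fderiv ℝ h x u v w = h x (Γ x u v) w + h x v (Γ x u w)

namespace StructureEquations

variable {E F : Type*} [NormedAddCommGroup E] [NormedSpace ℝ E]
    [NormedAddCommGroup F] [NormedSpace ℝ F] {ε : ℝ} {O : Set E} {f : E → F}
    {Γ K : E → E →L[ℝ] E →L[ℝ] E} {h : E → E →L[ℝ] E →L[ℝ] ℝ}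

/-- The curvature of the connection `Γ`. -/
def curv (Γ : E → E →L[ℝ] E →L[ℝ] E) (x u v w : E) : E :=
  fderiv ℝ Γ x u v w + Γ x u (Γ x v w) - fderiv ℝ Γ x v u w - Γ x v (Γ x u w)

/-- The covariant derivative of the tensor `K`. -/
def covDiff (Γ K : E → E →L[ℝ] E →L[ℝ] E) (x u v w : E) : E :=
  fderiv ℝ K x u v w + Γ x u (K x v w) - K x (Γ x u v) w - K x v (Γ x u w)

section

variable (H : StructureEquations ε O f Γ K h) {x : E} (hx : x ∈ O)
include H hx

lemma contDiffAt : ContDiffAt ℝ ∞ f x := H.smooth.contDiffAt (H.isOpen.mem_nhds hx)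

lemma contDiffAt_fderiv : ContDiffAt ℝ ∞ (fderiv ℝ f) x :=
  (H.contDiffAt hx).fderiv_right (by norm_cast)

lemma contDiffAt_conn : ContDiffAt ℝ ∞ Γ x := H.smooth_conn.contDiffAt (H.isOpen.mem_nhds hx)

lemma contDiffAt_diff : ContDiffAt ℝ ∞ K x := H.smooth_diff.contDiffAt (H.isOpen.mem_nhds hx)

lemma contDiffAt_metric : ContDiffAt ℝ ∞ h x := H.smooth_metric.contDiffAt (H.isOpen.mem_nhds hx)

lemma contDiffAt_fderiv_metric : ContDiffAt ℝ ∞ (fderiv ℝ h) x :=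
  (H.contDiffAt_metric hx).fderiv_right (by norm_cast)

lemma differentiableAt : DifferentiableAt ℝ f x := (H.contDiffAt hx).differentiableAt (by simp)

lemma differentiableAt_fderiv : DifferentiableAt ℝ (fderiv ℝ f) x :=
  (H.contDiffAt_fderiv hx).differentiableAt (by simp)

lemma differentiableAt_conn : DifferentiableAt ℝ Γ x :=
  (H.contDiffAt_conn hx).differentiableAt (by simp)

lemma differentiableAt_diff : DifferentiableAt ℝ K x :=
  (H.contDiffAt_diff hx).differentiableAt (by simp)

lemma differentiableAt_metric : DifferentiableAt ℝ h x :=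
  (H.contDiffAt_metric hx).differentiableAt (by simp)

lemma differentiableAt_fderiv_metric : DifferentiableAt ℝ (fderiv ℝ h) x :=
  (H.contDiffAt_fderiv_metric hx).differentiableAt (by simp)

lemma eventually_mem : ∀ᶠ y in 𝓝 x, y ∈ O := H.isOpen.mem_nhds hx

lemma metric_ext {v w : E} (hvw : ∀ z, h x v z = h x w z) : v = w := by
  by_contra hne
  have h1 := H.metric_pos x hx (v - w) (sub_ne_zero.2 hne)
  have h2 : h x (v - w) (v - w) = 0 := by
    rw [map_sub (h x) v w, sub_apply, hvw, sub_self]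
  exact h1.ne' h2

/-- The integrability conditions of the Gauss formula. -/
lemma gauss_codazzi (u v w : E) :
    curv Γ x u v w + K x u (K x v w) - K x v (K x u w) - ε • (h x v w • u - h x u w • v) +
      covDiff Γ K x u v w - covDiff Γ K x v u w = 0 := by
  have dΓ := H.differentiableAt_conn hx
  have dK := H.differentiableAt_diff hx
  have h1 := (integrability (G := fun y ↦ Γ y + K y) H.ne_zero (H.contDiffAt hx) (dΓ.add dK)
    (H.differentiableAt_metric hx) (H.transversal x hx)
    ((H.eventually_mem hx).mono fun y hy ↦ H.gauss y hy) u v w).1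
  rw [fderiv_fun_add dΓ dK] at h1
  simp only [curv, covDiff, H.conn_symm x hx v u, add_apply, map_add] at h1 ⊢
  linear_combination (norm := module) h1

/-- Ricci identity for the parallel tensor `h`: express the second derivative of `h` through `Γ` and
antisymmetrize in the two directions of differentiation. -/
lemma curv_skew (u v w z : E) : h x (curv Γ x u v w) z = -h x w (curv Γ x u v z) := by
  have key : ∀ u v : E, fderiv ℝ (fderiv ℝ h) x u v w z =
      h x (fderiv ℝ Γ x u v w + Γ x u (Γ x v w)) z + h x (Γ x v w) (Γ x u z) +
      (h x (Γ x u w) (Γ x v z) + h x w (fderiv ℝ Γ x u v z + Γ x u (Γ x v z))) := by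
    intro u v
    have dΓ := H.differentiableAt_conn hx
    have dh := H.differentiableAt_metric hx
    have dh2 := H.differentiableAt_fderiv_metric hx
    have hev : (fun y ↦ fderiv ℝ h y v w z) =ᶠ[𝓝 x] fun y ↦
        h y (Γ y v w) z + h y w (Γ y v z) := by
      filter_upwards [H.eventually_mem hx] with y hy using H.compatible y hy v w z
    have d0 : DifferentiableAt ℝ (fun y ↦ fderiv ℝ h y v) x := by fun_prop
    have d1 : DifferentiableAt ℝ (fun y ↦ Γ y v w) x := by fun_prop
    have d2 : DifferentiableAt ℝ (fun y ↦ Γ y v z) x := by fun_prop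
    have d3 : DifferentiableAt ℝ (fun y ↦ h y (Γ y v w) z) x := by fun_prop
    have d4 : DifferentiableAt ℝ (fun y ↦ h y w (Γ y v z)) x := by fun_prop
    have h1 := fderiv_apply_const_const d0 w z u
    rw [fderiv_apply_const dh2] at h1
    rw [← h1, hev.fderiv_eq, fderiv_fun_add d3 d4, add_apply,
      fderiv_apply_two dh d1 (differentiableAt_const z),
      fderiv_apply_two dh (differentiableAt_const w) d2]
    simp only [fderiv_apply_const_const dΓ, H.compatible x hx, fderiv_fun_const, map_add, add_apply]
    simp
    ring
  have hsymm : fderiv ℝ (fderiv ℝ h) x u v w z = fderiv ℝ (fderiv ℝ h) x v u w z :=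
    congrArg (fun A : E →L[ℝ] E →L[ℝ] ℝ ↦ A w z) ((H.contDiffAt_metric hx).isSymmSndFDerivAt
      (by simp; exact WithTop.coe_le_coe.2 (le_top : (2 : ℕ∞) ≤ ⊤)) u v)
  rw [key u v, key v u] at hsymm
  simp only [curv, map_add, map_sub, add_apply, sub_apply] at hsymm ⊢
  linarith

/-- Differentiate the self-adjointness of `K_v`; since `h` is parallel, the property passes to the
covariant derivative. -/
lemma covDiff_adjoint (u v w z : E) : h x (covDiff Γ K x u v w) z = h x w (covDiff Γ K x u v z) := by
  have dK := H.differentiableAt_diff hx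
  have dh := H.differentiableAt_metric hx
  have hev : (fun y ↦ h y (K y v w) z) =ᶠ[𝓝 x] fun y ↦ h y w (K y v z) := by
    filter_upwards [H.eventually_mem hx] with y hy using H.cubic_symm y hy v w z
  have d1 : DifferentiableAt ℝ (fun y ↦ K y v w) x := by fun_prop
  have d2 : DifferentiableAt ℝ (fun y ↦ K y v z) x := by fun_prop
  have h1 := congrArg (fun A : E →L[ℝ] ℝ ↦ A u) hev.fderiv_eq
  simp only [fderiv_apply_two dh d1 (differentiableAt_const z),
      fderiv_apply_two dh (differentiableAt_const w) d2, fderiv_apply_const_const dK,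
      H.compatible x hx, fderiv_fun_const] at h1
  have hadj : ∀ v w z, h x (K x v w) z = h x w (K x v z) := H.cubic_symm x hx
  simp only [covDiff, map_add, map_sub, add_apply, sub_apply]
  simp only [Pi.zero_apply, zero_apply, map_zero] at h1
  have e1 := hadj v (Γ x u w) z
  have e2 := hadj v w (Γ x u z)
  have e3 := hadj (Γ x u v) w z
  linarith

lemma fderiv_conn_symm (u v w : E) : fderiv ℝ Γ x u v w = fderiv ℝ Γ x u w v := by
  have hev : (fun y ↦ Γ y v w) =ᶠ[𝓝 x] fun y ↦ Γ y w v := by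
    filter_upwards [H.eventually_mem hx] with y hy using H.conn_symm y hy v w
  have h1 := congrArg (fun A : E →L[ℝ] E ↦ A u) hev.fderiv_eq
  simpa only [fderiv_apply_const_const (H.differentiableAt_conn hx)] using h1

lemma covDiff_symm (u v w : E) : covDiff Γ K x u v w = covDiff Γ K x u w v := by
  have hev : (fun y ↦ K y v w) =ᶠ[𝓝 x] fun y ↦ K y w v := by
    filter_upwards [H.eventually_mem hx] with y hy using H.diff_symm y hy v w
  have h1 := congrArg (fun A : E →L[ℝ] E ↦ A u) hev.fderiv_eq
  simp only [fderiv_apply_const_const (H.differentiableAt_diff hx)] at h1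
  unfold covDiff
  rw [h1, H.diff_symm x hx v w, H.diff_symm x hx v (Γ x u w), H.diff_symm x hx _ w]
  abel

lemma bianchi (u v w : E) : curv Γ x u v w + curv Γ x v w u + curv Γ x w u v = 0 := by
  unfold curv
  rw [H.conn_symm x hx v u, H.conn_symm x hx w u, H.conn_symm x hx w v,
    H.fderiv_conn_symm hx u w v, H.fderiv_conn_symm hx v w u, H.fderiv_conn_symm hx w v u]
  abel

/-- The Gauss and the Codazzi equation. -/
lemma gauss_and_codazzi (u v w : E) :
    curv Γ x u v w + K x u (K x v w) - K x v (K x u w) = ε • (h x v w • u - h x u w • v) ∧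
      covDiff Γ K x u v w = covDiff Γ K x v u w := by
  have hadj : ∀ v w z, h x (K x v w) z = h x w (K x v z) := H.cubic_symm x hx
  have hsum := H.gauss_codazzi hx u v
  -- Pair the identity at `w` with `z`, and the identity at `z` with `w`, and add. Curvature, the
  -- commutator of `K_u` and `K_v`, and the `ε` term are skew and cancel; the Codazzi part is
  -- self-adjoint and doubles.
  have hb : ∀ w, covDiff Γ K x u v w - covDiff Γ K x v u w = 0 := by
    intro w
    refine H.metric_ext hx fun z ↦ ?_
    have e1 := congrArg (fun q ↦ h x q z) (hsum w)
    have e2 := congrArg (fun q ↦ h x w q) (hsum z)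
    simp only [map_add, map_sub, map_smul, add_apply, sub_apply, smul_apply, smul_eq_mul,
      hadj, map_zero, zero_apply, H.curv_skew hx u v w z, H.covDiff_adjoint hx] at e1 e2 ⊢
    rw [H.metric_symm x hx w u, H.metric_symm x hx w v] at e2
    linarith
  refine ⟨?_, sub_eq_zero.1 (hb w)⟩
  have := hsum w
  rw [add_sub_assoc, hb, add_zero] at this
  exact sub_eq_zero.1 this

end
end StructureEquations

/-! ### The field `T` and the endomorphism `K_T` are parallel. -/

/-- A unit vector field `T` such that `K_T` has the eigenvalue `a + b` at `T` and the eigenvalues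
`a` and `b` on the orthogonal complement of `T`. -/
structure IsEigenField {E F : Type*} [NormedAddCommGroup E] [NormedSpace ℝ E]
    [NormedAddCommGroup F] [NormedSpace ℝ F] (ε : ℝ) (O : Set E) (f : E → F)
    (Γ K : E → E →L[ℝ] E →L[ℝ] E) (h : E → E →L[ℝ] E →L[ℝ] ℝ) (a b : ℝ) (T : E → E) : Prop
    extends StructureEquations ε O f Γ K h where
  smooth_field : ContDiffOn ℝ ∞ T O
  unit : ∀ x ∈ O, h x (T x) (T x) = 1
  eigen : ∀ x ∈ O, K x (T x) (T x) = (a + b) • T x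
  -- On the orthogonal complement of `T` this is `(K_T - a)(K_T - b) = 0`; the last term makes it
  -- hold at `T` as well. In this form it is smooth and mentions no eigendistribution.
  quadratic : ∀ x ∈ O, ∀ v, K x (T x) (K x (T x) v) =
    (a + b) • K x (T x) v - ε • v + (ε * h x (T x) v) • T x
  mul_eq : a * b = ε
  ne : a ≠ b

namespace IsEigenField

open StructureEquations

variable {E F : Type*} [NormedAddCommGroup E] [NormedSpace ℝ E]
    [NormedAddCommGroup F] [NormedSpace ℝ F] {ε : ℝ} {O : Set E} {f : E → F}
    {Γ K : E → E →L[ℝ] E →L[ℝ] E} {h : E → E →L[ℝ] E →L[ℝ] ℝ} {a b : ℝ} {T : E → E}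

/-- The covariant derivative of the vector field `T` in the direction `u`. -/
def covField (Γ : E → E →L[ℝ] E →L[ℝ] E) (T : E → E) (x u : E) : E :=
  fderiv ℝ T x u + Γ x u (T x)

/-- The second covariant derivative of the vector field `T`. -/
def covField₂ (Γ : E → E →L[ℝ] E →L[ℝ] E) (T : E → E) (x u v : E) : E :=
  fderiv ℝ (fderiv ℝ T) x u v + fderiv ℝ Γ x u v (T x) + Γ x v (fderiv ℝ T x u) +
    Γ x u (covField Γ T x v) - covField Γ T x (Γ x u v)

section

variable (H : IsEigenField ε O f Γ K h a b T) {x : E} (hx : x ∈ O)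
include H hx

lemma contDiffAt_field : ContDiffAt ℝ ∞ T x := H.smooth_field.contDiffAt (H.isOpen.mem_nhds hx)

lemma differentiableAt_field : DifferentiableAt ℝ T x :=
  (H.contDiffAt_field hx).differentiableAt (by simp)

lemma differentiableAt_fderiv_field : DifferentiableAt ℝ (fderiv ℝ T) x :=
  ((H.contDiffAt_field hx).fderiv_right (m := ∞) (by norm_cast)).differentiableAt (by simp)

lemma metric_covField (u : E) : h x (covField Γ T x u) (T x) = 0 := by
  have dT := H.differentiableAt_field hx
  have hev : (fun y ↦ h y (T y) (T y)) =ᶠ[𝓝 x] fun _ ↦ 1 := by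
    filter_upwards [H.eventually_mem hx] with y hy using H.unit y hy
  have h1 := congrArg (fun A : E →L[ℝ] ℝ ↦ A u) hev.fderiv_eq
  simp only [fderiv_apply_two (H.differentiableAt_metric hx) dT dT, H.compatible x hx,
    fderiv_fun_const, Pi.zero_apply, zero_apply] at h1
  rw [H.metric_symm x hx (T x) (fderiv ℝ T x u), H.metric_symm x hx (T x) (Γ x u (T x))] at h1
  simp only [covField, map_add, add_apply]
  linarith

/-- Differentiate `K(T, T) = (a + b) T`. The right side is `J (∇̂_u T)` with `J = (a + b) - 2 K_T`,
the operator on which the following arguments turn. -/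
lemma covDiff_field_field (u : E) : covDiff Γ K x u (T x) (T x) =
    (a + b) • covField Γ T x u - (2 : ℝ) • K x (T x) (covField Γ T x u) := by
  have dT := H.differentiableAt_field hx
  have hev : (fun y ↦ K y (T y) (T y)) =ᶠ[𝓝 x] fun y ↦ (a + b) • T y := by
    filter_upwards [H.eventually_mem hx] with y hy using H.eigen y hy
  have h1 := congrArg (fun A : E →L[ℝ] E ↦ A u) hev.fderiv_eq
  simp only [fderiv_apply_two (H.differentiableAt_diff hx) dT dT, fderiv_fun_const_smul dT,
    smul_apply] at h1
  rw [H.diff_symm x hx _ (T x)] at h1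
  simp only [covField, covDiff, map_add, H.eigen x hx, map_smul]
  rw [H.diff_symm x hx _ (T x)]
  linear_combination (norm := module) h1

lemma deriv_quadratic (u v : E) :
    covDiff Γ K x u (T x) (K x (T x) v) + K x (covField Γ T x u) (K x (T x) v) +
      K x (T x) (covDiff Γ K x u (T x) v + K x (covField Γ T x u) v) =
    (a + b) • (covDiff Γ K x u (T x) v + K x (covField Γ T x u) v) +
      (ε * h x (covField Γ T x u) v) • T x + (ε * h x (T x) v) • covField Γ T x u := by
  have dT := H.differentiableAt_field hx
  have dK := H.differentiableAt_diff hx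
  have dh := H.differentiableAt_metric hx
  have hev : (fun y ↦ K y (T y) (K y (T y) v)) =ᶠ[𝓝 x]
      fun y ↦ (a + b) • K y (T y) v - ε • v + (ε * h y (T y) v) • T y := by
    filter_upwards [H.eventually_mem hx] with y hy using H.quadratic y hy v
  have d1 : DifferentiableAt ℝ (fun y ↦ K y (T y) v) x := by fun_prop
  have d2 : DifferentiableAt ℝ (fun y ↦ h y (T y) v) x := by fun_prop
  have d3 : DifferentiableAt ℝ (fun y ↦ ε * h y (T y) v) x := by fun_prop
  have d4 : DifferentiableAt ℝ (fun y ↦ (a + b) • K y (T y) v) x := by fun_prop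
  have h1 := congrArg (fun A : E →L[ℝ] E ↦ A u) hev.fderiv_eq
  simp only [fderiv_apply_two dK dT d1, fderiv_apply_two dK dT (differentiableAt_const v),
    fderiv_fun_add (d4.fun_sub (differentiableAt_const (ε • v))) (d3.fun_smul dT), 
    fderiv_fun_sub d4 (differentiableAt_const (ε • v)), fderiv_fun_smul d3 dT,
    fderiv_fun_const_smul d1, fderiv_const_mul d2, add_apply, sub_apply, smul_apply,
    fderiv_fun_const, Pi.zero_apply, zero_apply, ContinuousLinearMap.smulRight_apply, 
    fderiv_apply_two dh dT (differentiableAt_const v), H.compatible x hx, map_zero, map_add] at h1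
  -- The argument `v` is constant rather than parallel; these two instances of the quadratic
  -- relation absorb the resulting `Γ` terms.
  have q1 := congrArg (Γ x u) (H.quadratic x hx v)
  have q2 := H.quadratic x hx (Γ x u v)
  simp only [covField, covDiff, map_add, map_sub, map_smul, add_apply, smul_eq_mul]
    at h1 q1 q2 ⊢
  linear_combination (norm := module) h1 + q1 - q2

/-- The mean `(a + b) / 2` is not a root of `(X - a)(X - b)`, as `a ≠ b`; so `J` is injective on the
orthogonal complement of `T`. -/
lemma eq_zero_of_eigen_mean {s : E} (hs : h x (T x) s = 0)
    (hJ : (a + b) • s - (2 : ℝ) • K x (T x) s = 0) : s = 0 := by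
  have hP : K x (T x) s = ((a + b) / 2) • s := by
    linear_combination (norm := module) (-1 / 2 : ℝ) • hJ
  have hq := H.quadratic x hx s
  rw [hs, hP, map_smul, hP, ← H.mul_eq] at hq
  have h2 : ((a - b) ^ 2) • s = 0 := by
    linear_combination (norm := module) (-4 : ℝ) • hq
  exact (smul_eq_zero.1 h2).resolve_left (pow_ne_zero 2 (sub_ne_zero.2 H.ne))

lemma covDiff_swap (u v w : E) : covDiff Γ K x u v w = covDiff Γ K x v u w :=
  (H.gauss_and_codazzi hx u v w).2

/-- An instance of the total symmetry of `∇̂K`: Codazzi, symmetry of `K` and self-adjointness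
permute all four slots. -/
lemma covDiff_field_field_symm (u z : E) :
    h x (covDiff Γ K x u (T x) (T x)) z = h x u (covDiff Γ K x z (T x) (T x)) := by
  rw [H.covDiff_swap hx u, H.covDiff_symm hx _ u, H.covDiff_adjoint hx,
    H.covDiff_symm hx _ (T x) z, H.covDiff_swap hx _ z]

/-- By total symmetry, `h(J ∇̂_T T, z) = h(T, J ∇̂_z T)`. This vanishes because `T` is an
eigenvector of the self-adjoint `J` and `∇̂_z T` is orthogonal to `T`. Injectivity of `J` finishes.
-/
lemma covField_self : covField Γ T x (T x) = 0 := by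
  have hT : ∀ u, h x (T x) (covField Γ T x u) = 0 := fun u ↦ by
    rw [H.metric_symm x hx, H.metric_covField hx]
  have hP : ∀ s, h x (K x (T x) s) (T x) = (a + b) * h x s (T x) := fun s ↦ by
    rw [H.cubic_symm x hx, H.eigen x hx, map_smul, smul_eq_mul]
  refine H.eq_zero_of_eigen_mean hx (hT _) (H.metric_ext hx fun z ↦ ?_)
  rw [← H.covDiff_field_field hx, H.covDiff_field_field_symm hx, H.covDiff_field_field hx,
    H.metric_symm x hx (T x)]
  simp [hP, H.metric_covField hx]

/-- `K_T - (a + b) / 2` squares to `((a - b) / 2)²` on the orthogonal complement of `T`. -/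
lemma eigen_mean_sq {s : E} (hs : h x (T x) s = 0) :
    (a + b) • ((a + b) • s - (2 : ℝ) • K x (T x) s) -
      (2 : ℝ) • K x (T x) ((a + b) • s - (2 : ℝ) • K x (T x) s) = ((a - b) ^ 2) • s := by
  have hq := H.quadratic x hx s
  rw [hs, ← H.mul_eq] at hq
  simp only [map_sub, map_smul]
  linear_combination (norm := module) (4 : ℝ) • hq

/-- `T` is a Killing field. The operator `N = ∇̂K(T, T, ·)` is self-adjoint, equals `J ∇̂T` by
Codazzi and anticommutes with `J`. Computing `h(N J u, w)` in two ways and using `J² = (a - b)²` on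
the image of `∇̂T` gives skewness up to the factor `(a - b)²`. -/
lemma covField_skew (u w : E) :
    h x (covField Γ T x u) w + h x u (covField Γ T x w) = 0 := by
  have hT : ∀ u, h x (T x) (covField Γ T x u) = 0 := fun u ↦ by
    rw [H.metric_symm x hx, H.metric_covField hx]
  set J : E →L[ℝ] E := (a + b) • ContinuousLinearMap.id ℝ E - (2 : ℝ) • K x (T x) with hJ
  have hJa : ∀ s, J s = (a + b) • s - (2 : ℝ) • K x (T x) s := fun s ↦ by simp [hJ]
  have hJJ : ∀ s, h x (T x) s = 0 → J (J s) = ((a - b) ^ 2) • s := fun s hs ↦ by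
    rw [hJa, hJa]; exact H.eigen_mean_sq hx hs
  have hJadj : ∀ s z, h x (J s) z = h x s (J z) := fun s z ↦ by
    simp [hJa, H.cubic_symm x hx]
  have hN : ∀ u, covDiff Γ K x (T x) (T x) u = J (covField Γ T x u) := fun u ↦ by
    rw [hJa, ← H.covDiff_field_field hx, H.covDiff_swap hx u, H.covDiff_symm hx _ u]
  -- In the direction `T` the derivative of the quadratic relation loses all terms with `∇̂_T T`,
  -- and what is left is anticommutation.
  have hNJ : ∀ u, covDiff Γ K x (T x) (T x) (J u) = -J (covDiff Γ K x (T x) (T x) u) := by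
    intro u
    have hq := H.deriv_quadratic hx (T x) u
    rw [H.covField_self hx] at hq
    simp only [map_zero, zero_apply, add_zero, mul_zero, zero_smul, smul_zero] at hq
    have hlin : covDiff Γ K x (T x) (T x) (J u) = (a + b) • covDiff Γ K x (T x) (T x) u -
        (2 : ℝ) • covDiff Γ K x (T x) (T x) (K x (T x) u) := by
      simp only [hJa, covDiff, map_sub, map_smul]
      module
    rw [hlin, hJa]
    linear_combination (norm := module) (-2 : ℝ) • hq
  have e1 := congrArg (fun q ↦ h x q w) (hNJ u)
  simp only [map_neg, neg_apply] at e1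
  rw [H.covDiff_adjoint hx, hN, hN, hJJ _ (hT _), hJadj, hJJ _ (hT _)] at e1
  simp only [map_smul, smul_apply, smul_eq_mul] at e1
  have h0 : ((a - b) ^ 2) * (h x (covField Γ T x u) w + h x u (covField Γ T x w)) = 0 := by
    linear_combination e1
  exact (mul_eq_zero.1 h0).resolve_left (pow_ne_zero 2 (sub_ne_zero.2 H.ne))

lemma curv_field (u v : E) : curv Γ x u v (T x) = covField₂ Γ T x u v - covField₂ Γ T x v u := by
  have hsymm : fderiv ℝ (fderiv ℝ T) x u v = fderiv ℝ (fderiv ℝ T) x v u :=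
    (H.contDiffAt_field hx).isSymmSndFDerivAt
      (by simp; exact WithTop.coe_le_coe.2 (le_top : (2 : ℕ∞) ≤ ⊤)) u v
  simp only [curv, covField₂, covField, map_add, hsymm, H.conn_symm x hx v u]
  abel

lemma hasFDerivAt_covField {w : E → E} (dw : DifferentiableAt ℝ w x) (u : E) :
    DifferentiableAt ℝ (fun y ↦ covField Γ T y (w y)) x ∧
    fderiv ℝ (fun y ↦ covField Γ T y (w y)) x u =
      covField₂ Γ T x u (w x) - Γ x u (covField Γ T x (w x)) +
        covField Γ T x (fderiv ℝ w x u + Γ x u (w x)) := by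
  have dT := H.differentiableAt_field hx
  have dT2 := H.differentiableAt_fderiv_field hx
  have dΓ := H.differentiableAt_conn hx
  have d1 : DifferentiableAt ℝ (fun y ↦ fderiv ℝ T y (w y)) x := by fun_prop
  have d2 : DifferentiableAt ℝ (fun y ↦ Γ y (w y) (T y)) x := by fun_prop
  refine ⟨d1.fun_add d2, ?_⟩
  unfold covField
  rw [fderiv_fun_add d1 d2, add_apply, fderiv_apply_one dT2 dw, fderiv_apply_two dΓ dw dT]
  simp only [covField₂, covField, map_add, add_apply]
  abel

/-- Differentiate `∇̂_T T = 0`. -/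
lemma covField₂_field_right (u : E) :
    covField₂ Γ T x u (T x) = -covField Γ T x (covField Γ T x u) := by
  have hev : (fun y ↦ covField Γ T y (T y)) =ᶠ[𝓝 x] fun _ ↦ 0 := by
    filter_upwards [H.eventually_mem hx] with y hy using H.covField_self hy
  have h1 := congrArg (fun A : E →L[ℝ] E ↦ A u) hev.fderiv_eq
  simp only [(H.hasFDerivAt_covField hx (H.differentiableAt_field hx) u).2, H.covField_self hx,
    map_zero, sub_zero, fderiv_fun_const, Pi.zero_apply, zero_apply] at h1
  exact eq_neg_of_add_eq_zero_left h1

lemma covField₂_skew (u v w : E) :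
    h x (covField₂ Γ T x u v) w + h x v (covField₂ Γ T x u w) = 0 := by
  have dh := H.differentiableAt_metric hx
  have dv := H.hasFDerivAt_covField hx (differentiableAt_const v) u
  have dw := H.hasFDerivAt_covField hx (differentiableAt_const w) u
  have hev : (fun y ↦ h y (covField Γ T y v) w + h y v (covField Γ T y w)) =ᶠ[𝓝 x] fun _ ↦ 0 := by
    filter_upwards [H.eventually_mem hx] with y hy using H.covField_skew hy v w
  have h1 := congrArg (fun A : E →L[ℝ] ℝ ↦ A u) hev.fderiv_eq
  have d3 : DifferentiableAt ℝ (fun y ↦ h y (covField Γ T y v) w) x := by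
    have := dv.1
    fun_prop
  have d4 : DifferentiableAt ℝ (fun y ↦ h y v (covField Γ T y w)) x := by
    have := dw.1
    fun_prop
  simp only [fderiv_fun_add d3 d4, add_apply, fderiv_apply_two dh dv.1 (differentiableAt_const w),
    fderiv_apply_two dh (differentiableAt_const v) dw.1, dv.2, dw.2, H.compatible x hx,
    fderiv_fun_const, Pi.zero_apply, zero_apply, map_zero, zero_add, map_add, map_sub, sub_apply,
    add_apply] at h1
  have s1 := H.covField_skew hx (Γ x u v) w
  have s2 := H.covField_skew hx v (Γ x u w)
  linarith

/-- The vector field `T` is parallel. -/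
lemma covField_eq_zero (u : E) : covField Γ T x u = 0 := by
  have hT : ∀ u, h x (T x) (covField Γ T x u) = 0 := fun u ↦ by
    rw [H.metric_symm x hx, H.metric_covField hx]
  -- The Gauss equation at `(u, T, T)`: the quadratic relation for `K_T` is precisely the vanishing
  -- of its right side.
  have hcurv : curv Γ x u (T x) (T x) = 0 := by
    have hg := (H.gauss_and_codazzi hx u (T x) (T x)).1
    have hq := H.quadratic x hx u
    rw [H.eigen x hx, H.unit x hx, map_smul, H.diff_symm x hx u, H.metric_symm x hx u] at hg
    linear_combination (norm := module) (1 : ℝ) • hg + (1 : ℝ) • hq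
  rw [H.curv_field hx, H.covField₂_field_right hx] at hcurv
  -- Both orders of the second derivative of `T` now equal `-∇̂_{∇̂_u T} T`. Its inner product with
  -- `u` vanishes because `∇̂²_T T` is skew, and equals `h(∇̂_u T, ∇̂_u T)` because `∇̂T` is skew.
  have h1 : covField₂ Γ T x (T x) u = -covField Γ T x (covField Γ T x u) :=
    (sub_eq_zero.1 hcurv).symm
  have h2 := H.covField₂_skew hx (T x) u u
  rw [h1, H.metric_symm x hx u] at h2
  have h3 := H.covField_skew hx (covField Γ T x u) u
  simp only [map_neg, neg_apply] at h2
  by_contra hne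
  have := H.metric_pos x hx _ hne
  linarith

lemma curv_field_eq_zero (u v : E) : curv Γ x u v (T x) = 0 := by
  have h2 : ∀ u v, covField₂ Γ T x u v = 0 := by
    intro u v
    have hev : (fun y ↦ covField Γ T y v) =ᶠ[𝓝 x] fun _ ↦ 0 := by
      filter_upwards [H.eventually_mem hx] with y hy using H.covField_eq_zero hy v
    have h1 := congrArg (fun A : E →L[ℝ] E ↦ A u) hev.fderiv_eq
    simpa [(H.hasFDerivAt_covField hx (differentiableAt_const v) u).2, H.covField_eq_zero hx]
      using h1
  rw [H.curv_field hx, h2, h2, sub_zero]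

/-- By Bianchi and `R(u, v) T = 0`, the form `h(R(u, T) v, z)` is symmetric in `u, v`; it is skew in
`v, z`. A trilinear form with both symmetries is zero. -/
lemma curv_field_mid_eq_zero (u v : E) : curv Γ x u (T x) v = 0 := by
  have hsymm : ∀ u v, curv Γ x u (T x) v = curv Γ x v (T x) u := by
    intro u v
    have hb := H.bianchi hx u (T x) v
    have hanti : curv Γ x (T x) v u = -curv Γ x v (T x) u := by
      simp only [curv]
      abel
    rw [H.curv_field_eq_zero hx, add_zero, hanti] at hb
    exact add_neg_eq_zero.1 hb
  refine H.metric_ext hx fun z ↦ ?_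
  have e : ∀ u v z, h x (curv Γ x u (T x) v) z = -h x (curv Γ x u (T x) z) v := fun u v z ↦ by
    rw [H.curv_skew hx, H.metric_symm x hx v]
  have h1 := e u v z
  rw [hsymm u z, e z u v, hsymm z v, e v z u, hsymm v u] at h1
  simp only [map_zero, zero_apply]
  linarith

/-- The commutator `[K_u, K_T]`. -/
lemma diff_commutator (u v : E) : K x u (K x (T x) v) - K x (T x) (K x u v) =
    ε • (h x (T x) v • u - h x u v • T x) := by
  have hg := (H.gauss_and_codazzi hx u (T x) v).1
  rwa [H.curv_field_mid_eq_zero hx, zero_add] at hg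

/-- The endomorphism `K_T` is parallel. -/
lemma covDiff_field (u v : E) : covDiff Γ K x u (T x) v = 0 := by
  set J : E →L[ℝ] E := (a + b) • ContinuousLinearMap.id ℝ E - (2 : ℝ) • K x (T x) with hJ
  have hJa : ∀ s, J s = (a + b) • s - (2 : ℝ) • K x (T x) s := fun s ↦ by simp [hJ]
  have hJadj : ∀ s z, h x (J s) z = h x s (J z) := fun s z ↦ by
    simp [hJa, H.cubic_symm x hx]
  have hNJ : ∀ u v, covDiff Γ K x u (T x) (J v) = -J (covDiff Γ K x u (T x) v) := by
    intro u v
    have hq := H.deriv_quadratic hx u v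
    rw [H.covField_eq_zero hx] at hq
    simp only [map_zero, zero_apply, add_zero, mul_zero, zero_smul, smul_zero] at hq
    have hlin : covDiff Γ K x u (T x) (J v) = (a + b) • covDiff Γ K x u (T x) v -
        (2 : ℝ) • covDiff Γ K x u (T x) (K x (T x) v) := by
      simp only [hJa, covDiff, map_sub, map_smul]
      module
    rw [hlin, hJa]
    linear_combination (norm := module) (-2 : ℝ) • hq
  have hperm : ∀ u v, covDiff Γ K x u (T x) v = covDiff Γ K x v (T x) u := fun u v ↦ by
    rw [H.covDiff_symm hx, H.covDiff_swap hx, H.covDiff_symm hx]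
  have hflip : ∀ u v z, h x (covDiff Γ K x u (T x) v) z = h x (covDiff Γ K x u (T x) z) v :=
    fun u v z ↦ by rw [H.covDiff_adjoint hx, H.metric_symm x hx]
  have hneg : ∀ u v z, h x (covDiff Γ K x u (T x) (J v)) z =
      -h x (covDiff Γ K x u (T x) v) (J z) := fun u v z ↦ by
    rw [hNJ, map_neg, neg_apply, hJadj]
  -- The form `h(∇̂K(u, T, v), z)` is symmetric in `u, v, z`, and moving `J` from one slot to
  -- another changes its sign. Going from the first slot to the last directly, or through the middle
  -- slot, gives opposite signs.
  have hzero : ∀ u v z, h x (covDiff Γ K x u (T x) v) (J z) = 0 := by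
    intro u v z
    have e1 : h x (covDiff Γ K x (J u) (T x) v) z = -h x (covDiff Γ K x u (T x) v) (J z) := by
      rw [hperm, hneg, hperm]
    have e2 : h x (covDiff Γ K x (J u) (T x) v) z = h x (covDiff Γ K x u (T x) v) (J z) := by
      rw [hflip, hperm, hneg, hperm, hflip, hneg, neg_neg]
    linarith
  refine H.eq_zero_of_eigen_mean hx ?_ (H.metric_ext hx fun z ↦ ?_)
  · rw [H.metric_symm x hx, hflip, H.covDiff_field_field hx, H.covField_eq_zero hx]
    simp
  · rw [← hJa, hJadj, hzero, map_zero, zero_apply]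

end
end IsEigenField

/-! ### The frame of the ambient space given by `df` and `f`. -/

section Splitting

variable {E F : Type*} [NormedAddCommGroup E] [NormedSpace ℝ E]
    [NormedAddCommGroup F] [NormedSpace ℝ F]

/-- The linear map `(v, c) ↦ df_x v + c f(x)`. -/
def flatSplitting (f : E → F) (x : E) : (E × ℝ) →L[ℝ] F :=
  (fderiv ℝ f x).coprod (ContinuousLinearMap.toSpanSingleton ℝ (f x))

lemma flatSplitting_apply (f : E → F) (x v : E) (c : ℝ) :
    flatSplitting f x (v, c) = fderiv ℝ f x v + c • f x := by
  simp [flatSplitting]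

/-- The position vector of `f` at `x` is transversal to the immersion `f`. -/
def TransversalAt (f : E → F) (x : E) : Prop :=
  ∀ v, ∀ c : ℝ, fderiv ℝ f x v + c • f x = 0 → v = 0 ∧ c = 0

lemma contDiffAt_flatSplitting {f : E → F} {x : E} (hf : ContDiffAt ℝ ∞ f x) :
    ContDiffAt ℝ ∞ (flatSplitting f) x := by
  have h1 : ContDiffAt ℝ ∞ (fderiv ℝ f) x := hf.fderiv_right (by norm_cast)
  have h2 : ContDiffAt ℝ ∞ (fun y ↦ ContinuousLinearMap.toSpanSingleton ℝ (f y)) x :=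
    ((ContinuousLinearMap.toSpanSingletonCLE (𝕜 := ℝ) (E := F)).contDiff.contDiffAt).comp x hf
  have h3 : flatSplitting f = fun y ↦ fderiv ℝ f y ∘L ContinuousLinearMap.fst ℝ E ℝ +
      ContinuousLinearMap.toSpanSingleton ℝ (f y) ∘L ContinuousLinearMap.snd ℝ E ℝ := by
    ext y p <;> simp [flatSplitting]
  rw [h3]
  exact (h1.clm_comp contDiffAt_const).add (h2.clm_comp contDiffAt_const)

variable [FiniteDimensional ℝ E] [FiniteDimensional ℝ F]

lemma TransversalAt.isInvertible (hdim : Module.finrank ℝ F = Module.finrank ℝ E + 1)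
    {f : E → F} {x : E} (hf : TransversalAt f x) : (flatSplitting f x).IsInvertible := by
  have hinj : Function.Injective (flatSplitting f x) := by
    rw [injective_iff_map_eq_zero]
    rintro ⟨v, c⟩ hvc
    rw [flatSplitting_apply] at hvc
    obtain ⟨rfl, rfl⟩ := hf v c hvc
    rfl
  have hdim' : Module.finrank ℝ (E × ℝ) = Module.finrank ℝ F := by
    simp [hdim]
  exact ⟨(LinearEquiv.ofInjectiveOfFinrankEq (flatSplitting f x).toLinearMap hinj
    hdim').toContinuousLinearEquiv, by ext x <;> rfl⟩

lemma contDiffAt_flatSplitting_inverse (hdim : Module.finrank ℝ F = Module.finrank ℝ E + 1)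
    {f : E → F} {x : E} (hf : ContDiffAt ℝ ∞ f x) (hx : TransversalAt f x) :
    ContDiffAt ℝ ∞ (fun y ↦ (flatSplitting f y).inverse) x := by
  have : CompleteSpace E := FiniteDimensional.complete ℝ E
  obtain ⟨e, he⟩ := hx.isInvertible hdim
  have h1 := contDiffAt_map_inverse (n := ∞) e
  rw [he] at h1
  exact h1.comp x (contDiffAt_flatSplitting hf)

end Splitting

/-! ### The constant endomorphism of the ambient space. -/

namespace IsEigenField

open StructureEquations

variable {E F : Type*} [NormedAddCommGroup E] [NormedSpace ℝ E]
    [NormedAddCommGroup F] [NormedSpace ℝ F] {ε : ℝ} {O : Set E} {f : E → F}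
    {Γ K : E → E →L[ℝ] E →L[ℝ] E} {h : E → E →L[ℝ] E →L[ℝ] ℝ} {a b : ℝ} {T : E → E}

lemma fderiv_field (H : IsEigenField ε O f Γ K h a b T) {x : E} (hx : x ∈ O) (u : E) :
    fderiv ℝ T x u = -Γ x u (T x) :=
  eq_neg_of_add_eq_zero_left (H.covField_eq_zero hx u)

lemma fderiv_push_field (H : IsEigenField ε O f Γ K h a b T) {x : E} (hx : x ∈ O) (u : E) :
    fderiv ℝ (fun y ↦ fderiv ℝ f y (T y)) x u =
      fderiv ℝ f x (K x (T x) u) - (ε * h x (T x) u) • f x := by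
  rw [fderiv_apply_one (H.differentiableAt_fderiv hx) (H.differentiableAt_field hx),
    H.gauss x hx, H.fderiv_field hx, H.diff_symm x hx u, H.metric_symm x hx u]
  simp only [map_add, map_neg]
  abel

/-- The form `h(T, ·)` is parallel. Symmetry of `Γ` then makes it closed, which supplies the
function `t`. -/
lemma fderiv_dual_field (H : IsEigenField ε O f Γ K h a b T) {x : E} (hx : x ∈ O) (u v : E) :
    fderiv ℝ (fun y ↦ h y (T y) v) x u = h x (T x) (Γ x u v) := by
  rw [fderiv_apply_two (H.differentiableAt_metric hx) (H.differentiableAt_field hx)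
    (differentiableAt_const v), H.compatible x hx, H.fderiv_field hx]
  simp

/-- It suffices that the derivative of `B` kills `f` and all `df(v)`. For `f` this is the formula
for the derivative of `df(T)`; for `df(v)` the tangential terms cancel by `covDiff_field` and
`diff_commutator`. -/
lemma fderiv_eq_zero_of_apply (H : IsEigenField ε O f Γ K h a b T) {B : E → F →L[ℝ] F}
    (hB : ∀ x ∈ O, DifferentiableAt ℝ B x)
    (hBf : ∀ x ∈ O, B x (f x) = fderiv ℝ f x (T x))
    (hBd : ∀ x ∈ O, ∀ v, B x (fderiv ℝ f x v) =
      fderiv ℝ f x (K x (T x) v) - (ε * h x (T x) v) • f x)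
    (hspan : ∀ x ∈ O, ∀ w, ∃ v, ∃ c : ℝ, fderiv ℝ f x v + c • f x = w)
    {x : E} (hx : x ∈ O) : fderiv ℝ B x = 0 := by
  have dT := H.differentiableAt_field hx
  have dK := H.differentiableAt_diff hx
  have dh := H.differentiableAt_metric hx
  have df := H.differentiableAt hx
  have df2 := H.differentiableAt_fderiv hx
  have dB := hB x hx
  ext u w
  obtain ⟨v, c, rfl⟩ := hspan x hx w
  have h1 : fderiv ℝ B x u (f x) = 0 := by
    have hev : (fun y ↦ B y (f y)) =ᶠ[𝓝 x] fun y ↦ fderiv ℝ f y (T y) := by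
      filter_upwards [H.eventually_mem hx] with y hy using hBf y hy
    have h1 := congrArg (fun A : E →L[ℝ] F ↦ A u) hev.fderiv_eq
    simp only [fderiv_apply_one dB df, H.fderiv_push_field hx, hBd x hx] at h1
    simpa using h1
  have h2 : fderiv ℝ B x u (fderiv ℝ f x v) = 0 := by
    have hev : (fun y ↦ B y (fderiv ℝ f y v)) =ᶠ[𝓝 x]
        fun y ↦ fderiv ℝ f y (K y (T y) v) - (ε * h y (T y) v) • f y := by
      filter_upwards [H.eventually_mem hx] with y hy using hBd y hy v
    have h1 := congrArg (fun A : E →L[ℝ] F ↦ A u) hev.fderiv_eq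
    have d1 : DifferentiableAt ℝ (fun y ↦ fderiv ℝ f y v) x := by fun_prop
    have d2 : DifferentiableAt ℝ (fun y ↦ K y (T y) v) x := by fun_prop
    have d3 : DifferentiableAt ℝ (fun y ↦ h y (T y) v) x := by fun_prop
    have d4 : DifferentiableAt ℝ (fun y ↦ ε * h y (T y) v) x := by fun_prop
    have d5 : DifferentiableAt ℝ (fun y ↦ fderiv ℝ f y (K y (T y) v)) x := by fun_prop
    simp only [fderiv_apply_one dB d1, fderiv_apply_const df2, fderiv_fun_sub d5 (d4.fun_smul df),
      sub_apply, fderiv_apply_one df2 d2, fderiv_fun_smul d4 df, add_apply, smul_apply,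
      ContinuousLinearMap.smulRight_apply, fderiv_const_mul d3, H.fderiv_dual_field hx,
      fderiv_apply_two dK dT (differentiableAt_const v), H.fderiv_field hx, H.gauss x hx,
      map_sub, map_add, map_smul, hBf x hx, hBd x hx, fderiv_fun_const, Pi.zero_apply, zero_apply,
      map_zero, smul_eq_mul] at h1
    have e1 := congrArg (fderiv ℝ f x) (H.covDiff_field hx u v)
    have e2 := congrArg (fderiv ℝ f x) (H.diff_commutator hx u v)
    have e3 : h x u (K x (T x) v) = h x (T x) (K x u v) := by
      rw [← H.cubic_symm x hx, ← H.cubic_symm x hx, H.diff_symm x hx]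
    simp only [covDiff, map_add, map_sub, map_smul, map_zero, map_neg, neg_apply] at e1 e2 h1
    rw [e3] at h1
    linear_combination (norm := module) h1 + e1 + e2
  simp [h1, h2]

variable [FiniteDimensional ℝ E] [FiniteDimensional ℝ F]

/-- There is a constant endomorphism `B` of the ambient space which maps the position vector `f`
to `f_* T`. -/
lemma exists_endomorphism (H : IsEigenField ε O f Γ K h a b T) (hO : IsPreconnected O)
    (hdim : Module.finrank ℝ F = Module.finrank ℝ E + 1) {x₀ : E} (hx₀ : x₀ ∈ O) :
    ∃ B : F →L[ℝ] F, (∀ x ∈ O, B (f x) = fderiv ℝ f x (T x)) ∧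
      ∀ x ∈ O, ∀ v, B (fderiv ℝ f x v) =
        fderiv ℝ f x (K x (T x) v) - (ε * h x (T x) v) • f x := by
  set ξ : E → F := fun y ↦ fderiv ℝ f y (T y) with hξ
  -- The unique endomorphism with `f ↦ ξ` and `df(v) ↦ dξ(v)`.
  set B : E → F →L[ℝ] F := fun y ↦ flatSplitting ξ y ∘L (flatSplitting f y).inverse with hB
  have hinv : ∀ x ∈ O, (flatSplitting f x).IsInvertible := fun x hx ↦
    TransversalAt.isInvertible hdim (H.transversal x hx)
  have hBs : ∀ x ∈ O, ∀ p, B x (flatSplitting f x p) = flatSplitting ξ x p := fun x hx p ↦ by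
    simp [hB, (hinv x hx).inverse_apply_self]
  have hξd : ∀ x ∈ O, ∀ v, fderiv ℝ ξ x v =
      fderiv ℝ f x (K x (T x) v) - (ε * h x (T x) v) • f x := fun x hx v ↦ H.fderiv_push_field hx v
  have hBf : ∀ x ∈ O, B x (f x) = fderiv ℝ f x (T x) := fun x hx ↦ by
    simpa [flatSplitting_apply] using hBs x hx (0, 1)
  have hBd : ∀ x ∈ O, ∀ v, B x (fderiv ℝ f x v) =
      fderiv ℝ f x (K x (T x) v) - (ε * h x (T x) v) • f x := fun x hx v ↦ by
    simpa [flatSplitting_apply, hξd x hx] using hBs x hx (v, 0)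
  have hspan : ∀ x ∈ O, ∀ w, ∃ v, ∃ c : ℝ, fderiv ℝ f x v + c • f x = w := fun x hx w ↦ by
    refine ⟨((flatSplitting f x).inverse w).1, ((flatSplitting f x).inverse w).2, ?_⟩
    rw [← flatSplitting_apply]
    exact (hinv x hx).self_apply_inverse w
  have hBdiff : ∀ x ∈ O, DifferentiableAt ℝ B x := fun x hx ↦ by
    have h1 : ContDiffAt ℝ ∞ ξ x := (H.contDiffAt_fderiv hx).clm_apply (H.contDiffAt_field hx)
    have h2 := contDiffAt_flatSplitting h1
    have h3 := contDiffAt_flatSplitting_inverse hdim (H.contDiffAt hx) (H.transversal x hx)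
    exact (h2.clm_comp h3).differentiableAt (by simp)
  have hconst : ∀ x ∈ O, B x = B x₀ := fun x hx ↦
    H.isOpen.is_const_of_fderiv_eq_zero hO (fun y hy ↦ (hBdiff y hy).differentiableWithinAt)
      (fun y hy ↦ H.fderiv_eq_zero_of_apply hBdiff hBf hBd hspan hy) hx hx₀
  refine ⟨B x₀, fun x hx ↦ ?_, fun x hx v ↦ ?_⟩
  · rw [← hconst x hx, hBf x hx]
  · rw [← hconst x hx, hBd x hx]

end IsEigenField

/-! ### Linear algebra: projections and diagonalization. -/

/-- A linear map with one-dimensional kernel spanned by a given nonzero vector. -/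
lemma exists_clm_ker_span {k : ℕ} {y : Euc (k + 1)} (hy : y ≠ 0) :
    ∃ L : Euc (k + 1) →L[ℝ] Euc k, ∀ v, L v = 0 → ∃ c : ℝ, v = c • y := by
  have h1 : Module.finrank ℝ (Euc (k + 1) ⧸ Submodule.span ℝ {y}) = Module.finrank ℝ (Euc k) := by
    have h2 := Submodule.finrank_quotient_add_finrank (Submodule.span ℝ {y})
    rw [finrank_span_singleton hy] at h2
    simp at h2 ⊢
    omega
  let e := LinearEquiv.ofFinrankEq _ _ h1
  refine ⟨LinearMap.toContinuousLinearMap (e.toLinearMap ∘ₗ (Submodule.span ℝ {y}).mkQ),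
    fun v hv ↦ ?_⟩
  have h3 : (Submodule.span ℝ {y}).mkQ v = 0 := e.injective (by simpa using hv)
  rw [Submodule.mkQ_apply, Submodule.Quotient.mk_eq_zero, Submodule.mem_span_singleton] at h3
  obtain ⟨c, rfl⟩ := h3
  exact ⟨c, rfl⟩

/-- An endomorphism with the eigenvalues `a ≠ b` and large enough eigenspaces is diagonal in a
suitable splitting of the space. -/
lemma exists_diagonalization {F : Type*} [NormedAddCommGroup F] [NormedSpace ℝ F]
    [FiniteDimensional ℝ F] {n₁ n₂ : ℕ} {a b : ℝ} (hab : a ≠ b) {B : F →L[ℝ] F}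
    (hdim : Module.finrank ℝ F = (n₁ + 1) + (n₂ + 1))
    {V W : Type*} [AddCommGroup V] [Module ℝ V] [AddCommGroup W] [Module ℝ W]
    [FiniteDimensional ℝ V] [FiniteDimensional ℝ W]
    (hV : Module.finrank ℝ V = n₁ + 1) (hW : Module.finrank ℝ W = n₂ + 1)
    (i : V →ₗ[ℝ] F) (j : W →ₗ[ℝ] F) (hi : Function.Injective i) (hj : Function.Injective j)
    (hia : ∀ v, B (i v) = a • i v) (hjb : ∀ w, B (j w) = b • j w) :
    ∃ A : (Euc (n₁ + 1) × Euc (n₂ + 1)) ≃L[ℝ] F, ∀ y, B (A y) = A (a • y.1, b • y.2) := by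
  have e₁ : Euc (n₁ + 1) ≃ₗ[ℝ] V := LinearEquiv.ofFinrankEq _ _ (by simp [hV])
  have e₂ : Euc (n₂ + 1) ≃ₗ[ℝ] W := LinearEquiv.ofFinrankEq _ _ (by simp [hW])
  let A₀ : (Euc (n₁ + 1) × Euc (n₂ + 1)) →ₗ[ℝ] F :=
    (i ∘ₗ e₁.toLinearMap).coprod (j ∘ₗ e₂.toLinearMap)
  have hA₀ : ∀ y, A₀ y = i (e₁ y.1) + j (e₂ y.2) := fun y ↦ by simp [A₀]
  have hinj : Function.Injective A₀ := by
    rw [injective_iff_map_eq_zero]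
    intro y hy
    rw [hA₀] at hy
    have h1 := congrArg B hy
    rw [map_add, hia, hjb, map_zero] at h1
    -- Subtracting `b` times the relation from its image under `B` isolates the component in the
    -- first eigenspace.
    have h2 : (a - b) • i (e₁ y.1) = 0 := by
      linear_combination (norm := module) (1 : ℝ) • h1 - b • hy
    have h3 : i (e₁ y.1) = 0 := (smul_eq_zero.1 h2).resolve_left (sub_ne_zero.2 hab)
    rw [h3, zero_add] at hy
    have h4 : y.1 = 0 := e₁.injective (hi (by simpa using h3))
    have h5 : y.2 = 0 := e₂.injective (hj (by simpa using hy))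
    exact Prod.ext h4 h5
  refine ⟨(LinearEquiv.ofInjectiveOfFinrankEq A₀ hinj (by simp [hdim])).toContinuousLinearEquiv,
    fun y ↦ ?_⟩
  change B (A₀ y) = A₀ (a • y.1, b • y.2)
  simp [hA₀, hia, hjb]

/-! ### From a split immersion to a Calabi product. -/

section Slice

variable {X Y C : Type*} [NormedAddCommGroup X] [NormedSpace ℝ X] [NormedAddCommGroup Y]
  [NormedSpace ℝ Y] [NormedAddCommGroup C] [NormedSpace ℝ C]

lemma eq_on_slice {G : X → C} {S : Set X} {s : Set Y} (hs : IsOpen s) (hsc : Convex ℝ s)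
    {j : Y → X} {j' : Y →L[ℝ] X} (hj : ∀ y, HasFDerivAt j j' y) (hmem : ∀ y ∈ s, j y ∈ S)
    (hG : ∀ x ∈ S, DifferentiableAt ℝ G x) (h0 : ∀ x ∈ S, ∀ v, fderiv ℝ G x (j' v) = 0)
    {y y' : Y} (hy : y ∈ s) (hy' : y' ∈ s) : G (j y) = G (j y') := by
  have hd : ∀ y ∈ s, HasFDerivAt (fun z ↦ G (j z)) (fderiv ℝ G (j y) ∘L j') y := fun y hy ↦
    (hG _ (hmem y hy)).hasFDerivAt.comp y (hj y)
  refine hs.is_const_of_fderiv_eq_zero hsc.isPreconnected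
    (fun y hy ↦ (hd y hy).differentiableAt.differentiableWithinAt) (fun y hy ↦ ?_) hy hy'
  rw [(hd y hy).fderiv]
  ext v
  simpa using h0 _ (hmem y hy) v

end Slice

/-- The two components of an immersion which splits into the eigenspaces of an endomorphism with
the eigenvalues `a` and `b`, in the sense that `T` is the direction of the position vectors
`a f₂` and `b f₃`, and that `P` induces the multiplication by `a` and `b` on the differentials. -/
structure SplitImmersion {E F₂ F₃ : Type*} [NormedAddCommGroup E] [NormedSpace ℝ E]
    [NormedAddCommGroup F₂] [NormedSpace ℝ F₂] [NormedAddCommGroup F₃] [NormedSpace ℝ F₃]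
    (O : Set E) (a b : ℝ) (f₂ : E → F₂) (f₃ : E → F₃) (P : E → E → E) (T : E → E)
    (θ : E → E →L[ℝ] ℝ) : Prop where
  isOpen : IsOpen O
  convex : Convex ℝ O
  smooth₂ : ContDiffOn ℝ ∞ f₂ O
  smooth₃ : ContDiffOn ℝ ∞ f₃ O
  smooth_form : ContDiffOn ℝ ∞ θ O
  closed : ∀ x ∈ O, ∀ u v, fderiv ℝ θ x u v = fderiv ℝ θ x v u
  unit : ∀ x ∈ O, θ x (T x) = 1
  form_endo : ∀ x ∈ O, ∀ v, θ x (P x v) = (a + b) * θ x v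
  field₂ : ∀ x ∈ O, fderiv ℝ f₂ x (T x) = a • f₂ x
  field₃ : ∀ x ∈ O, fderiv ℝ f₃ x (T x) = b • f₃ x
  push₂ : ∀ x ∈ O, ∀ v, fderiv ℝ f₂ x (P x v) = a • fderiv ℝ f₂ x v + (a * b * θ x v) • f₂ x
  push₃ : ∀ x ∈ O, ∀ v, fderiv ℝ f₃ x (P x v) = b • fderiv ℝ f₃ x v + (a * b * θ x v) • f₃ x
  transversal : ∀ x ∈ O, ∀ v, ∀ c : ℝ, fderiv ℝ f₂ x v + c • f₂ x = 0 →
    fderiv ℝ f₃ x v + c • f₃ x = 0 → v = 0 ∧ c = 0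
  ne : a ≠ b
  ne_zero₂ : a ≠ 0
  ne_zero₃ : b ≠ 0

namespace SplitImmersion

section

variable {E F₂ F₃ : Type*} [NormedAddCommGroup E] [NormedSpace ℝ E]
    [NormedAddCommGroup F₂] [NormedSpace ℝ F₂] [NormedAddCommGroup F₃] [NormedSpace ℝ F₃]
    {O : Set E} {a b : ℝ} {f₂ : E → F₂} {f₃ : E → F₃} {P : E → E → E} {T : E → E}
    {θ : E → E →L[ℝ] ℝ}

lemma symm (H : SplitImmersion O a b f₂ f₃ P T θ) : SplitImmersion O b a f₃ f₂ P T θ where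
  isOpen := H.isOpen
  convex := H.convex
  smooth₂ := H.smooth₃
  smooth₃ := H.smooth₂
  smooth_form := H.smooth_form
  closed := H.closed
  unit := H.unit
  form_endo x hx v := by rw [add_comm]; exact H.form_endo x hx v
  field₂ := H.field₃
  field₃ := H.field₂
  push₂ x hx v := by rw [mul_comm b]; exact H.push₃ x hx v
  push₃ x hx v := by rw [mul_comm b]; exact H.push₂ x hx v
  transversal x hx v c h2 h3 := H.transversal x hx v c h3 h2
  ne := H.ne.symm
  ne_zero₂ := H.ne_zero₃
  ne_zero₃ := H.ne_zero₂

lemma exists_primitive (H : SplitImmersion O a b f₂ f₃ P T θ) :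
    ∃ t : E → ℝ, (∀ x ∈ O, HasFDerivAt t (θ x) x) ∧ ContDiffOn ℝ ∞ t O := by
  obtain ⟨t, ht⟩ := H.convex.exists_forall_hasFDerivAt_of_fderiv_symmetric H.isOpen
    (H.smooth_form.differentiableOn (by simp)) H.closed
  refine ⟨t, ht, (contDiffOn_infty_iff_fderiv_of_isOpen H.isOpen).2
    ⟨fun x hx ↦ (ht x hx).differentiableAt.differentiableWithinAt, ?_⟩⟩
  exact H.smooth_form.congr fun x hx ↦ (ht x hx).fderiv

lemma hasFDerivAt₂ (H : SplitImmersion O a b f₂ f₃ P T θ) {x : E} (hx : x ∈ O) :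
    HasFDerivAt f₂ (fderiv ℝ f₂ x) x :=
  ((H.smooth₂.contDiffAt (H.isOpen.mem_nhds hx)).differentiableAt (by simp)).hasFDerivAt

/-- The derivative of `e^(-a t) f₂`. -/
lemma hasFDerivAt_reduced (H : SplitImmersion O a b f₂ f₃ P T θ) {t : E → ℝ}
    (ht : ∀ x ∈ O, HasFDerivAt t (θ x) x) {x : E} (hx : x ∈ O) :
    HasFDerivAt (fun y ↦ Real.exp (-a * t y) • f₂ y)
      (Real.exp (-a * t x) • (fderiv ℝ f₂ x - (a • θ x).smulRight (f₂ x))) x := by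
  have h1 := (((ht x hx).const_mul (-a)).exp).smul (H.hasFDerivAt₂ hx)
  refine h1.congr_fderiv ?_
  ext v
  simp
  module

/-- If `f₂` vanished at `x`, then `df(T) - b f` would be zero in both components, against
transversality because `b ≠ 0`. -/
lemma ne_zero_at₂ (H : SplitImmersion O a b f₂ f₃ P T θ) {x : E} (hx : x ∈ O) : f₂ x ≠ 0 := by
  intro h0
  have h1 := (H.transversal x hx (T x) (-b) (by simp [H.field₂ x hx, h0])
    (by simp [H.field₃ x hx])).2
  exact H.ne_zero₃ (neg_eq_zero.1 h1)

/-- `T` scales the components by the different factors `a` and `b`, so adding a multiple `r T`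
equalizes the two radial factors and transversality applies. Evaluating `θ` shows `r = 0`. This
gives the injectivity needed for the inverse function theorem. -/
lemma eq_zero_of_radial (H : SplitImmersion O a b f₂ f₃ P T θ) {x : E} (hx : x ∈ O) {w : E}
    (hw : θ x w = 0) {c d : ℝ} (h2 : fderiv ℝ f₂ x w = c • f₂ x)
    (h3 : fderiv ℝ f₃ x w = d • f₃ x) : w = 0 := by
  have hab : a - b ≠ 0 := sub_ne_zero.2 H.ne
  set r : ℝ := (d - c) / (a - b) with hr
  have hr' : r * (a - b) = d - c := by rw [hr]; field_simp
  have h := H.transversal x hx (w + r • T x) (-c - r * a)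
    (by rw [map_add, map_smul, h2, H.field₂ x hx]; module)
    (by
      rw [map_add, map_smul, h3, H.field₃ x hx]
      have : d + r * b + (-c - r * a) = 0 := by linear_combination -hr'
      rw [smul_smul, ← add_smul, ← add_smul, this, zero_smul])
  have h4 := congrArg (θ x) h.1
  simp only [map_add, map_smul, hw, H.unit x hx, map_zero] at h4
  have h5 : r = 0 := by simpa using h4
  simpa [h5] using h.1

/-- The component of a tangent vector in the first eigenspace of `P`. -/
lemma exists_component (H : SplitImmersion O a b f₂ f₃ P T θ) {x : E} (hx : x ∈ O) (w : E) :
    ∃ w', θ x w' = 0 ∧ fderiv ℝ f₂ x w' = fderiv ℝ f₂ x w - (a * θ x w) • f₂ x ∧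
      fderiv ℝ f₃ x w' = 0 := by
  have hab : a - b ≠ 0 := sub_ne_zero.2 H.ne
  -- `(P - b) / (a - b)` projects to the `a`-part; the multiple of `T` is the one that makes `θ`
  -- vanish, since `(a + b) - b - a = 0`.
  refine ⟨(a - b)⁻¹ • (P x w - b • w - (a * θ x w) • T x), ?_, ?_, ?_⟩ <;>
    rw [map_smul, inv_smul_eq_iff₀ hab]
  · simp only [map_smul, map_sub, H.form_endo x hx, H.unit x hx, smul_eq_mul]
    ring
  · simp only [map_smul, map_sub, H.push₂ x hx, H.field₂ x hx]
    module
  · simp only [map_smul, map_sub, H.push₃ x hx, H.field₃ x hx]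
    module

end

end SplitImmersion

/-- The inverse function theorem for a smooth map on an open set, with a ball as target. -/
lemma exists_openPartialHomeomorph_ball {E Y : Type*} [NormedAddCommGroup E] [NormedSpace ℝ E]
    [CompleteSpace E] [NormedAddCommGroup Y] [NormedSpace ℝ Y]
    {O : Set E} (hO : IsOpen O) {Ψ : E → Y} (hΨ : ContDiffOn ℝ ∞ Ψ O) {x₀ : E} (hx₀ : x₀ ∈ O)
    (hinv : ∃ e : E ≃L[ℝ] Y, (e : E →L[ℝ] Y) = fderiv ℝ Ψ x₀) :
    ∃ (Φ : OpenPartialHomeomorph E Y) (r : ℝ), 0 < r ∧ x₀ ∈ Φ.source ∧ Φ.source ⊆ O ∧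
      Φ.target = Metric.ball (Ψ x₀) r ∧ (∀ x, Φ x = Ψ x) ∧ ContDiffOn ℝ ∞ Φ.symm Φ.target ∧
      ∀ x ∈ Φ.source, ∃ e : E ≃L[ℝ] Y, (e : E →L[ℝ] Y) = fderiv ℝ Ψ x := by
  have hd : ∀ x ∈ O, ContDiffAt ℝ ∞ Ψ x := fun x hx ↦ hΨ.contDiffAt (hO.mem_nhds hx)
  obtain ⟨e, he⟩ := hinv
  have hd0 : HasFDerivAt Ψ (e : E →L[ℝ] Y) x₀ := by
    rw [he]; exact ((hd x₀ hx₀).differentiableAt (by simp)).hasFDerivAt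
  set Φ₀ := (hd x₀ hx₀).toOpenPartialHomeomorph Ψ hd0 (by simp) with hΦ₀
  -- Restricting to the open set where the derivative is invertible makes the inverse smooth on the
  -- whole target, not only at the image of `x₀`.
  set W : Set E := O ∩ fderiv ℝ Ψ ⁻¹' Set.range ((↑) : (E ≃L[ℝ] Y) → E →L[ℝ] Y) with hW
  have hWo : IsOpen W :=
    (hΨ.continuousOn_fderiv_of_isOpen hO (by simp)).isOpen_inter_preimage hO
      (ContinuousLinearEquiv.isOpen)
  have hx₀W : x₀ ∈ W := ⟨hx₀, e, he⟩
  set Φ₁ := Φ₀.restrOpen W hWo with hΦ₁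
  have hx₁ : x₀ ∈ Φ₁.source := by
    rw [hΦ₁, OpenPartialHomeomorph.restrOpen_source]
    exact ⟨(hd x₀ hx₀).mem_toOpenPartialHomeomorph_source hd0 (by simp), hx₀W⟩
  have hΦ₁c : ∀ x, Φ₁ x = Ψ x := fun x ↦ rfl
  obtain ⟨r, hr, hball⟩ := Metric.isOpen_iff.1 Φ₁.open_target (Ψ x₀) (Φ₁.map_source hx₁)
  set Φ := (Φ₁.symm.restrOpen (Metric.ball (Ψ x₀) r) Metric.isOpen_ball).symm with hΦ
  have hΦc : ∀ x, Φ x = Ψ x := fun x ↦ rfl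
  have hsrc : Φ.source ⊆ Φ₁.source := fun x hx ↦ by
    have : x ∈ Φ₁.source ∩ _ := hx
    exact this.1
  have htgt : Φ.target = Metric.ball (Ψ x₀) r := Set.inter_eq_right.2 hball
  have hsrcW : Φ.source ⊆ W := fun x hx ↦ (hsrc hx).2
  refine ⟨Φ, r, hr, ?_, fun x hx ↦ (hsrcW hx).1, htgt, hΦc, ?_, fun x hx ↦ (hsrcW hx).2⟩
  · have h1 : Ψ x₀ ∈ Φ.target := by rw [htgt]; exact Metric.mem_ball_self hr
    have h2 := Φ.map_target h1
    have h3 : Φ.symm (Ψ x₀) = x₀ := Φ₁.left_inv hx₁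
    rwa [h3] at h2
  · intro y hy
    have hx := hsrcW (Φ.map_target hy)
    obtain ⟨e', he'⟩ := hx.2
    refine (Φ.contDiffAt_symm hy (f₀' := e') ?_ (hd _ hx.1)).contDiffWithinAt
    rw [he']
    exact ((hd _ hx.1).differentiableAt (by simp)).hasFDerivAt

namespace SplitImmersion

variable {E : Type*} [NormedAddCommGroup E] [NormedSpace ℝ E] [FiniteDimensional ℝ E] {n₁ n₂ : ℕ}
    {O : Set E} {a b : ℝ} {f₂ : E → Euc (n₁ + 1)} {f₃ : E → Euc (n₂ + 1)} {P : E → E → E}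
    {T : E → E} {θ : E → E →L[ℝ] ℝ}

/-- The components of a split immersion form a Calabi product, in coordinates which identify a
neighbourhood with a product of balls. -/
theorem exists_calabi_ball (H : SplitImmersion O a b f₂ f₃ P T θ)
    (hdim : Module.finrank ℝ E = 1 + n₁ + n₂) {x₀ : E} (hx₀ : x₀ ∈ O) :
    ∃ (G₂ : Euc n₁ → Euc (n₁ + 1)) (G₃ : Euc n₂ → Euc (n₂ + 1))
      (Φ : OpenPartialHomeomorph E (ℝ × Euc n₁ × Euc n₂)) (u₀ : ℝ) (y₀ : Euc n₁) (z₀ : Euc n₂)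
      (r : ℝ), 0 < r ∧
      Φ.target = Metric.ball u₀ r ×ˢ Metric.ball y₀ r ×ˢ Metric.ball z₀ r ∧
      ContDiffOn ℝ ∞ G₂ (Metric.ball y₀ r) ∧ ContDiffOn ℝ ∞ G₃ (Metric.ball z₀ r) ∧
      x₀ ∈ Φ.source ∧ Φ.source ⊆ O ∧
      ContDiffOn ℝ ∞ Φ Φ.source ∧ ContDiffOn ℝ ∞ Φ.symm Φ.target ∧
      ∀ x ∈ Φ.source, (f₂ x, f₃ x) = calabiProduct (-b / a) G₂ G₃ (Φ x) := by
  obtain ⟨t, ht, hts⟩ := H.exists_primitive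
  obtain ⟨L₂, hL₂⟩ := exists_clm_ker_span (H.ne_zero_at₂ hx₀)
  obtain ⟨L₃, hL₃⟩ := exists_clm_ker_span (H.symm.ne_zero_at₂ hx₀)
  set g₂ : E → Euc (n₁ + 1) := fun y ↦ Real.exp (-a * t y) • f₂ y with hg₂
  set g₃ : E → Euc (n₂ + 1) := fun y ↦ Real.exp (-b * t y) • f₃ y with hg₃
  have hg₂s : ContDiffOn ℝ ∞ g₂ O := ((contDiffOn_const.mul hts).exp).smul H.smooth₂
  have hg₃s : ContDiffOn ℝ ∞ g₃ O := ((contDiffOn_const.mul hts).exp).smul H.smooth₃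
  have hd₂ : ∀ x ∈ O, HasFDerivAt g₂ _ x := fun x hx ↦ H.hasFDerivAt_reduced ht hx
  have hd₃ : ∀ x ∈ O, HasFDerivAt g₃ _ x := fun x hx ↦ H.symm.hasFDerivAt_reduced ht hx
  -- The first coordinate is `a t` since the Calabi product scales its first factor by `e^u`. The
  -- maps `L₂`, `L₃` forget the radial directions of `f₂`, `f₃` at `x₀`.
  set Ψ : E → ℝ × Euc n₁ × Euc n₂ := fun x ↦ (a * t x, L₂ (g₂ x), L₃ (g₃ x)) with hΨ
  have hΨs : ContDiffOn ℝ ∞ Ψ O := (contDiffOn_const.mul hts).prodMk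
    ((L₂.contDiff.comp_contDiffOn hg₂s).prodMk (L₃.contDiff.comp_contDiffOn hg₃s))
  have hdΨ : ∀ x ∈ O, ∀ v, fderiv ℝ Ψ x v = (a * θ x v,
      Real.exp (-a * t x) • L₂ (fderiv ℝ f₂ x v - (a * θ x v) • f₂ x),
      Real.exp (-b * t x) • L₃ (fderiv ℝ f₃ x v - (b * θ x v) • f₃ x)) := by
    intro x hx v
    have h1 : HasFDerivAt Ψ _ x := ((ht x hx).const_mul a).prodMk
      ((L₂.hasFDerivAt.comp x (hd₂ x hx)).prodMk (L₃.hasFDerivAt.comp x (hd₃ x hx)))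
    rw [h1.fderiv]
    simp
  have hinv : ∃ e : E ≃L[ℝ] ℝ × Euc n₁ × Euc n₂, (e : E →L[ℝ] _) = fderiv ℝ Ψ x₀ := by
    have hinj : Function.Injective (fderiv ℝ Ψ x₀) := by
      rw [injective_iff_map_eq_zero]
      intro v hv
      rw [hdΨ x₀ hx₀, Prod.mk_eq_zero, Prod.mk_eq_zero] at hv
      obtain ⟨h1, h2, h3⟩ := hv
      have hθ : θ x₀ v = 0 := (mul_eq_zero.1 h1).resolve_left H.ne_zero₂
      rw [hθ, mul_zero, zero_smul, sub_zero] at h2 h3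
      obtain ⟨c, hc⟩ := hL₂ _ ((smul_eq_zero.1 h2).resolve_left (Real.exp_pos _).ne')
      obtain ⟨d, hd⟩ := hL₃ _ ((smul_eq_zero.1 h3).resolve_left (Real.exp_pos _).ne')
      exact H.eq_zero_of_radial hx₀ hθ hc hd
    exact ⟨(LinearEquiv.ofInjectiveOfFinrankEq (fderiv ℝ Ψ x₀).toLinearMap hinj
      (by simp [hdim]; ring)).toContinuousLinearEquiv, by ext1 v; rfl⟩
  obtain ⟨Φ, r, hr, hxs, hsO, htgt, hΦc, hsymm, hequiv⟩ :=
    exists_openPartialHomeomorph_ball H.isOpen hΨs hx₀ hinv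
  have hΦΨ : ⇑Φ = Ψ := funext hΦc
  have hdΦ : ∀ y ∈ Φ.target, ∃ e : E ≃L[ℝ] ℝ × Euc n₁ × Euc n₂,
      (e : E →L[ℝ] _) = fderiv ℝ Ψ (Φ.symm y) ∧
      HasFDerivAt Φ.symm (e.symm : _ →L[ℝ] E) y := by
    intro y hy
    have hx := Φ.map_target hy
    obtain ⟨e, he⟩ := hequiv _ hx
    refine ⟨e, he, Φ.hasFDerivAt_symm hy ?_⟩
    rw [he, hΦΨ]
    exact ((hΨs.contDiffAt (H.isOpen.mem_nhds (hsO hx))).differentiableAt (by simp)).hasFDerivAt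
  have hG₂ : ∀ y ∈ Φ.target, DifferentiableAt ℝ (g₂ ∘ Φ.symm) y ∧
      ∀ v, v.2.1 = 0 → fderiv ℝ (g₂ ∘ Φ.symm) y v = 0 := by
    intro y hy
    have hx := hsO (Φ.map_target hy)
    obtain ⟨e, he, hd⟩ := hdΦ y hy
    have hcomp := (hd₂ _ hx).comp y hd
    refine ⟨hcomp.differentiableAt, fun v hv ↦ ?_⟩
    rw [hcomp.fderiv]
    -- The first component `w` of the direction has the same derivative of `g₂`, and all three
    -- coordinates of `dΨ(w)` vanish: the middle one by `hv`, the others by the choice of `w`. Hence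
    -- `w = 0`.
    obtain ⟨w, hw1, hw2, hw3⟩ := H.exists_component hx (e.symm v)
    have hev : fderiv ℝ Ψ (Φ.symm y) (e.symm v) = v := by
      rw [← he]; exact e.apply_symm_apply v
    rw [← hev, hdΨ _ hx] at hv
    have hw : e w = 0 := by
      change (e : E →L[ℝ] ℝ × Euc n₁ × Euc n₂) w = 0
      rw [he, hdΨ _ hx, hw1, hw2, hw3]
      simpa using hv
    have hw0 : w = 0 := by simpa using hw
    rw [hw0, map_zero] at hw2
    simp [← hw2]
  have hG₃ : ∀ y ∈ Φ.target, DifferentiableAt ℝ (g₃ ∘ Φ.symm) y ∧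
      ∀ v, v.2.2 = 0 → fderiv ℝ (g₃ ∘ Φ.symm) y v = 0 := by
    intro y hy
    have hx := hsO (Φ.map_target hy)
    obtain ⟨e, he, hd⟩ := hdΦ y hy
    have hcomp := (hd₃ _ hx).comp y hd
    refine ⟨hcomp.differentiableAt, fun v hv ↦ ?_⟩
    rw [hcomp.fderiv]
    obtain ⟨w, hw1, hw2, hw3⟩ := H.symm.exists_component hx (e.symm v)
    have hev : fderiv ℝ Ψ (Φ.symm y) (e.symm v) = v := by
      rw [← he]; exact e.apply_symm_apply v
    rw [← hev, hdΨ _ hx] at hv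
    have hw : e w = 0 := by
      change (e : E →L[ℝ] ℝ × Euc n₁ × Euc n₂) w = 0
      rw [he, hdΨ _ hx, hw1, hw2, hw3]
      simpa using hv
    have hw0 : w = 0 := by simpa using hw
    rw [hw0, map_zero] at hw2
    simp [← hw2]
  obtain ⟨⟨u₀, y₀, z₀⟩, hc⟩ : ∃ c, c = Ψ x₀ := ⟨_, rfl⟩
  -- The norm of a product is a maximum, so the ball is a box whose slices are convex.
  rw [← hc, ← ball_prod_same, ← ball_prod_same] at htgt
  have hmem : ∀ u y z, (u, y, z) ∈ Φ.target ↔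
      u ∈ Metric.ball u₀ r ∧ y ∈ Metric.ball y₀ r ∧ z ∈ Metric.ball z₀ r := by
    intro u y z
    rw [htgt]
    rfl
  have hu₀ := Metric.mem_ball_self (x := u₀) hr
  have hy₀ := Metric.mem_ball_self (x := y₀) hr
  have hz₀ := Metric.mem_ball_self (x := z₀) hr
  have hc₂ : ∀ u y z, (u, y, z) ∈ Φ.target → g₂ (Φ.symm (u, y, z)) = g₂ (Φ.symm (u₀, y, z₀)) := by
    intro u y z huyz
    obtain ⟨hu, hy, hz⟩ := (hmem u y z).1 huyz
    let j' : ℝ × Euc n₂ →L[ℝ] ℝ × Euc n₁ × Euc n₂ :=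
      (ContinuousLinearMap.fst ℝ ℝ (Euc n₂)).prod
        ((0 : ℝ × Euc n₂ →L[ℝ] Euc n₁).prod (ContinuousLinearMap.snd ℝ ℝ (Euc n₂)))
    exact eq_on_slice (G := g₂ ∘ Φ.symm) (S := Φ.target)
      (s := Metric.ball u₀ r ×ˢ Metric.ball z₀ r) (j := fun p ↦ (p.1, y, p.2)) (j' := j')
      (Metric.isOpen_ball.prod Metric.isOpen_ball)
      ((convex_ball _ _).prod (convex_ball _ _))
      (fun p ↦ hasFDerivAt_fst.prodMk ((hasFDerivAt_const y p).prodMk hasFDerivAt_snd))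
      (fun p hp ↦ (hmem _ _ _).2 ⟨hp.1, hy, hp.2⟩) (fun p hp ↦ (hG₂ p hp).1)
      (fun p hp v ↦ (hG₂ p hp).2 (j' v) (by simp [j'])) (y := (u, z)) (y' := (u₀, z₀)) ⟨hu, hz⟩ ⟨hu₀, hz₀⟩
  have hc₃ : ∀ u y z, (u, y, z) ∈ Φ.target → g₃ (Φ.symm (u, y, z)) = g₃ (Φ.symm (u₀, y₀, z)) := by
    intro u y z huyz
    obtain ⟨hu, hy, hz⟩ := (hmem u y z).1 huyz
    let j' : ℝ × Euc n₁ →L[ℝ] ℝ × Euc n₁ × Euc n₂ :=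
      (ContinuousLinearMap.fst ℝ ℝ (Euc n₁)).prod
        ((ContinuousLinearMap.snd ℝ ℝ (Euc n₁)).prod (0 : ℝ × Euc n₁ →L[ℝ] Euc n₂))
    exact eq_on_slice (G := g₃ ∘ Φ.symm) (S := Φ.target)
      (s := Metric.ball u₀ r ×ˢ Metric.ball y₀ r) (j := fun p ↦ (p.1, p.2, z)) (j' := j')
      (Metric.isOpen_ball.prod Metric.isOpen_ball)
      ((convex_ball _ _).prod (convex_ball _ _))
      (fun p ↦ hasFDerivAt_fst.prodMk (hasFDerivAt_snd.prodMk (hasFDerivAt_const z p)))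
      (fun p hp ↦ (hmem _ _ _).2 ⟨hp.1, hp.2, hz⟩) (fun p hp ↦ (hG₃ p hp).1)
      (fun p hp v ↦ (hG₃ p hp).2 (j' v) (by simp [j'])) (y := (u, y)) (y' := (u₀, y₀)) ⟨hu, hy⟩ ⟨hu₀, hy₀⟩
  refine ⟨fun y ↦ g₂ (Φ.symm (u₀, y, z₀)), fun z ↦ g₃ (Φ.symm (u₀, y₀, z)), Φ, u₀, y₀, z₀, r, hr,
    htgt, ?_, ?_, hxs, hsO, (hΨs.mono hsO).congr fun x _ ↦ hΦc x, hsymm, fun x hx ↦ ?_⟩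
  · refine hg₂s.comp (hsymm.comp (t := Φ.target)
      (contDiff_const.prodMk (contDiff_id.prodMk contDiff_const)).contDiffOn ?_) ?_
    · exact fun y hy ↦ (hmem _ _ _).2 ⟨hu₀, hy, hz₀⟩
    · exact fun y hy ↦ hsO (Φ.map_target ((hmem _ _ _).2 ⟨hu₀, hy, hz₀⟩))
  · refine hg₃s.comp (hsymm.comp (t := Φ.target)
      (contDiff_const.prodMk (contDiff_const.prodMk contDiff_id)).contDiffOn ?_) ?_
    · exact fun z hz ↦ (hmem _ _ _).2 ⟨hu₀, hy₀, hz⟩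
    · exact fun z hz ↦ hsO (Φ.map_target ((hmem _ _ _).2 ⟨hu₀, hy₀, hz⟩))
  · have hp := Φ.map_source hx
    have hpe : Φ x = (a * t x, L₂ (g₂ x), L₃ (g₃ x)) := hΦc x
    have e₂ := hc₂ _ _ _ (hpe ▸ hp)
    have e₃ := hc₃ _ _ _ (hpe ▸ hp)
    rw [← hpe, Φ.left_inv hx] at e₂ e₃
    have ha := H.ne_zero₂
    -- With `u = a t` and parameter `-b / a`, the second exponential is `e^(b t)`.
    have hl : -(-b / a) * (a * t x) = b * t x := by field_simp
    have k₂ : Real.exp (a * t x) • g₂ x = f₂ x := by simp [hg₂, smul_smul, ← Real.exp_add]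
    have k₃ : Real.exp (b * t x) • g₃ x = f₃ x := by simp [hg₃, smul_smul, ← Real.exp_add]
    simp only [calabiProduct, hpe, hl]
    rw [← e₂, ← e₃, k₂, k₃]

end SplitImmersion

/-- The factors of a Calabi product over balls can be parametrized by Euclidean spaces. -/
lemma exists_calabi_univ {E : Type*} [NormedAddCommGroup E] [NormedSpace ℝ E] {n₁ n₂ : ℕ}
    {l : ℝ} {f : E → Euc (n₁ + 1) × Euc (n₂ + 1)} {G₂ : Euc n₁ → Euc (n₁ + 1)}
    {G₃ : Euc n₂ → Euc (n₂ + 1)} (Φ : OpenPartialHomeomorph E (ℝ × Euc n₁ × Euc n₂)) {u₀ : ℝ}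
    {y₀ : Euc n₁} {z₀ : Euc n₂} {r : ℝ} (hr : 0 < r)
    (htgt : Φ.target = Metric.ball u₀ r ×ˢ Metric.ball y₀ r ×ˢ Metric.ball z₀ r)
    (hG₂ : ContDiffOn ℝ ∞ G₂ (Metric.ball y₀ r)) (hG₃ : ContDiffOn ℝ ∞ G₃ (Metric.ball z₀ r))
    (hΦd : ContDiffOn ℝ ∞ Φ Φ.source) (hsymm : ContDiffOn ℝ ∞ Φ.symm Φ.target)
    (hf : ∀ x ∈ Φ.source, f x = calabiProduct l G₂ G₃ (Φ x)) :
    ∃ (ψ₁ : Euc n₁ → Euc (n₁ + 1)) (ψ₂ : Euc n₂ → Euc (n₂ + 1))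
      (Φ' : OpenPartialHomeomorph E (ℝ × Euc n₁ × Euc n₂)),
      ContDiff ℝ ∞ ψ₁ ∧ ContDiff ℝ ∞ ψ₂ ∧ Φ'.source = Φ.source ∧
      ContDiffOn ℝ ∞ Φ' Φ'.source ∧ ContDiffOn ℝ ∞ Φ'.symm Φ'.target ∧
      (∀ y z, ∃ u, (u, y, z) ∈ Φ'.target) ∧
      ∀ x ∈ Φ'.source, f x = calabiProduct l ψ₁ ψ₂ (Φ' x) := by
  have hmem : ∀ u y z, (u, y, z) ∈ Φ.target ↔
      u ∈ Metric.ball u₀ r ∧ y ∈ Metric.ball y₀ r ∧ z ∈ Metric.ball z₀ r := by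
    intro u y z
    rw [htgt]
    rfl
  -- Diffeomorphisms of the whole Euclidean spaces onto the balls turn the factors into
  -- hypersurfaces defined on `Euc n₁` and `Euc n₂`.
  let κ₁ := OpenPartialHomeomorph.univBall y₀ r
  let κ₂ := OpenPartialHomeomorph.univBall z₀ r
  have hκ₁s : κ₁.source = Set.univ := OpenPartialHomeomorph.univBall_source y₀ r
  have hκ₂s : κ₂.source = Set.univ := OpenPartialHomeomorph.univBall_source z₀ r
  have hκ₁t : κ₁.target = Metric.ball y₀ r := OpenPartialHomeomorph.univBall_target y₀ hr
  have hκ₂t : κ₂.target = Metric.ball z₀ r := OpenPartialHomeomorph.univBall_target z₀ hr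
  have hκ₁ : ∀ y, κ₁ y ∈ Metric.ball y₀ r := fun y ↦ by
    rw [← hκ₁t]; exact κ₁.map_source (by simp [hκ₁s])
  have hκ₂ : ∀ z, κ₂ z ∈ Metric.ball z₀ r := fun z ↦ by
    rw [← hκ₂t]; exact κ₂.map_source (by simp [hκ₂s])
  have hκ₁d : ContDiff ℝ ∞ κ₁ := OpenPartialHomeomorph.contDiff_univBall
  have hκ₂d : ContDiff ℝ ∞ κ₂ := OpenPartialHomeomorph.contDiff_univBall
  have hκ₁d' : ContDiffOn ℝ ∞ κ₁.symm (Metric.ball y₀ r) :=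
    OpenPartialHomeomorph.contDiffOn_univBall_symm
  have hκ₂d' : ContDiffOn ℝ ∞ κ₂.symm (Metric.ball z₀ r) :=
    OpenPartialHomeomorph.contDiffOn_univBall_symm
  let κ := (OpenPartialHomeomorph.refl ℝ).prod (κ₁.symm.prod κ₂.symm)
  have hκs : Φ.target ⊆ κ.source := by
    rintro ⟨u, y, z⟩ h
    have h' := (hmem u y z).1 h
    rw [← hκ₁t, ← hκ₂t] at h'
    exact ⟨trivial, h'.2⟩
  have hsrc : (Φ.trans κ).source = Φ.source := by
    rw [OpenPartialHomeomorph.trans_source]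
    exact Set.inter_eq_left.2 fun x hx ↦ hκs (Φ.map_source hx)
  have htgt' : ∀ u y z, (u, y, z) ∈ (Φ.trans κ).target ↔ u ∈ Metric.ball u₀ r := by
    intro u y z
    rw [OpenPartialHomeomorph.trans_target]
    constructor
    · intro h
      exact ((hmem _ _ _).1 h.2).1
    · intro h
      refine ⟨⟨trivial, ?_, ?_⟩, (hmem u (κ₁ y) (κ₂ z)).2 ⟨h, hκ₁ y, hκ₂ z⟩⟩
      · simp [hκ₁s]
      · simp [hκ₂s]
  refine ⟨G₂ ∘ κ₁, G₃ ∘ κ₂, Φ.trans κ, ?_, ?_, hsrc, ?_, ?_, ?_, ?_⟩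
  · exact contDiffOn_univ.1 (hG₂.comp hκ₁d.contDiffOn fun y _ ↦ hκ₁ y)
  · exact contDiffOn_univ.1 (hG₃.comp hκ₂d.contDiffOn fun z _ ↦ hκ₂ z)
  · rw [hsrc]
    have hκd : ContDiffOn ℝ ∞ κ Φ.target := by
      have h1 : ContDiffOn ℝ ∞ (fun p : ℝ × Euc n₁ × Euc n₂ ↦ (p.1, κ₁.symm p.2.1, κ₂.symm p.2.2))
          Φ.target := by
        refine contDiff_fst.contDiffOn.prodMk ((hκ₁d'.comp
          (contDiff_fst.comp contDiff_snd).contDiffOn ?_).prodMk (hκ₂d'.comp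
          (contDiff_snd.comp contDiff_snd).contDiffOn ?_))
        · exact fun p hp ↦ ((hmem _ _ _).1 hp).2.1
        · exact fun p hp ↦ ((hmem _ _ _).1 hp).2.2
      exact h1
    exact hκd.comp hΦd fun x hx ↦ Φ.map_source hx
  · have hκd : ContDiff ℝ ∞ κ.symm := by
      have h1 : ContDiff ℝ ∞ (fun p : ℝ × Euc n₁ × Euc n₂ ↦ (p.1, κ₁ p.2.1, κ₂ p.2.2)) :=
        contDiff_fst.prodMk ((hκ₁d.comp (contDiff_fst.comp contDiff_snd)).prodMk
          (hκ₂d.comp (contDiff_snd.comp contDiff_snd)))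
      exact h1
    refine hsymm.comp hκd.contDiffOn ?_
    intro p hp
    rw [OpenPartialHomeomorph.trans_target] at hp
    exact hp.2
  -- Every pair `(y, z)` has to occur: the factors must be transversal and convex at all their
  -- points.
  · exact fun y z ↦ ⟨u₀, (htgt' _ _ _).2 (Metric.mem_ball_self hr)⟩
  · intro x hx
    rw [hsrc] at hx
    have hp := Φ.map_source hx
    obtain ⟨⟨u, y, z⟩, hpe⟩ : ∃ c, c = Φ x := ⟨_, rfl⟩
    rw [← hpe] at hp
    have hm := (hmem _ _ _).1 hp
    have h1 : κ₁ (κ₁.symm y) = y := κ₁.right_inv (by rw [hκ₁t]; exact hm.2.1)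
    have h2 : κ₂ (κ₂.symm z) = z := κ₂.right_inv (by rw [hκ₂t]; exact hm.2.2)
    have hκx : (Φ.trans κ) x = (u, κ₁.symm y, κ₂.symm z) := by
      change κ (Φ x) = _
      rw [← hpe]
      rfl
    rw [hf x hx, ← hpe, hκx]
    simp only [calabiProduct, Function.comp_apply, h1, h2]

/-! ### Transversality and convexity, and their inheritance by the factors. -/

section Convex

variable {E E' F F' : Type*} [NormedAddCommGroup E] [NormedSpace ℝ E]
    [NormedAddCommGroup E'] [NormedSpace ℝ E'] [NormedAddCommGroup F] [NormedSpace ℝ F]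
    [NormedAddCommGroup F'] [NormedSpace ℝ F']

/-- The centroaffine metric of `f` induced by `-ε f` is positive definite at `x`. -/
def ConvexAt (ε : ℝ) (f : E → F) (x : E) : Prop :=
  ∀ v, v ≠ 0 → ∃ w, ∃ c : ℝ, 0 < c ∧
    fderiv ℝ (fderiv ℝ f) x v v = fderiv ℝ f x w - (ε * c) • f x

lemma TransversalAt.comp {f : E → F} {g : E' → F} {k : E' → E} {y : E'} {e : E' ≃L[ℝ] E}
    (hf : TransversalAt f (k y)) (hfd : DifferentiableAt ℝ f (k y))
    (hk : HasFDerivAt k (e : E' →L[ℝ] E) y) (hg : g =ᶠ[𝓝 y] f ∘ k) : TransversalAt g y := by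
  intro v c hvc
  rw [hg.fderiv_eq, (hfd.hasFDerivAt.comp y hk).fderiv, hg.eq_of_nhds] at hvc
  obtain ⟨h1, h2⟩ := hf (e v) c hvc
  exact ⟨by simpa using h1, h2⟩

/-- A change of coordinates adds `df(D²k(v, v))` to the second derivative. This is tangential, so it
is absorbed in `w` and leaves the coefficient of the position vector alone. -/
lemma ConvexAt.comp {ε : ℝ} {f : E → F} {g : E' → F} {k : E' → E} {y : E'} {e : E' ≃L[ℝ] E}
    (hf : ConvexAt ε f (k y)) (hfd : ContDiffAt ℝ ∞ f (k y)) (hkd : ContDiffAt ℝ ∞ k y)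
    (hk : HasFDerivAt k (e : E' →L[ℝ] E) y) (hg : g =ᶠ[𝓝 y] f ∘ k) : ConvexAt ε g y := by
  intro v hv
  obtain ⟨w, c, hc, hw⟩ := hf (e v) (by simpa using hv)
  have dk : DifferentiableAt ℝ k y := hkd.differentiableAt (by simp)
  have dk2 : DifferentiableAt ℝ (fderiv ℝ k) y :=
    (hkd.fderiv_right (m := ∞) (by norm_cast)).differentiableAt (by simp)
  have df2 : DifferentiableAt ℝ (fderiv ℝ f) (k y) :=
    (hfd.fderiv_right (m := ∞) (by norm_cast)).differentiableAt (by simp)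
  have hev : ∀ᶠ z in 𝓝 y, fderiv ℝ g z v = fderiv ℝ f (k z) (fderiv ℝ k z v) := by
    have h1 : ∀ᶠ x in 𝓝 (k y), ContDiffAt ℝ 1 f x :=
      (hfd.of_le (by norm_cast)).eventually (by simp)
    have h2 : ∀ᶠ z in 𝓝 y, ContDiffAt ℝ 1 k z :=
      (hkd.of_le (by norm_cast)).eventually (by simp)
    filter_upwards [hg.eventually_nhds, dk.continuousAt.eventually h1, h2] with z hz h1z h2z
    rw [Filter.EventuallyEq.fderiv_eq hz, fderiv_comp z (h1z.differentiableAt (by simp))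
      (h2z.differentiableAt (by simp))]
    rfl
  have dg2 : DifferentiableAt ℝ (fderiv ℝ g) y :=
    (((hfd.comp y hkd).congr_of_eventuallyEq hg).fderiv_right (m := ∞)
      (by norm_cast)).differentiableAt (by simp)
  have dc : DifferentiableAt ℝ (fun z ↦ fderiv ℝ f (k z)) y := df2.comp y dk
  have hD : fderiv ℝ (fderiv ℝ g) y v v = fderiv ℝ (fderiv ℝ f) (k y) (e v) (e v) +
      fderiv ℝ f (k y) (fderiv ℝ (fderiv ℝ k) y v v) := by
    rw [← fderiv_apply_const dg2, Filter.EventuallyEq.fderiv_eq hev,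
      fderiv_apply_one dc (by fun_prop), fderiv_apply_const dk2,
      show fderiv ℝ (fun z ↦ fderiv ℝ f (k z)) y = _ from (df2.hasFDerivAt.comp y hk).fderiv,
      hk.fderiv]
    rfl
  refine ⟨e.symm (w + fderiv ℝ (fderiv ℝ k) y v v), c, hc, ?_⟩
  rw [hD, hw, hg.fderiv_eq, ((hfd.differentiableAt (by simp)).hasFDerivAt.comp y hk).fderiv,
    hg.eq_of_nhds]
  simp
  abel

lemma TransversalAt.clm_comp {f : E → F} {x : E} (hf : TransversalAt f x)
    (hfd : DifferentiableAt ℝ f x) (A : F ≃L[ℝ] F') : TransversalAt (fun y ↦ A (f y)) x := by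
  intro v c hvc
  have h1 : fderiv ℝ (fun y ↦ A (f y)) x = (A : F →L[ℝ] F') ∘L fderiv ℝ f x :=
    (A.hasFDerivAt.comp x hfd.hasFDerivAt).fderiv
  rw [h1] at hvc
  refine hf v c (A.injective ?_)
  simpa using hvc

lemma ConvexAt.clm_comp {ε : ℝ} {f : E → F} {x : E} (hf : ConvexAt ε f x)
    (hfd : ContDiffAt ℝ ∞ f x) (A : F ≃L[ℝ] F') : ConvexAt ε (fun y ↦ A (f y)) x := by
  intro v hv
  obtain ⟨w, c, hc, hw⟩ := hf v hv
  have h1 : ∀ᶠ y in 𝓝 x, fderiv ℝ (fun y ↦ A (f y)) y = (A : F →L[ℝ] F') ∘L fderiv ℝ f y := by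
    filter_upwards [(hfd.of_le (by norm_cast : (1 : ℕ∞ω) ≤ ∞)).eventually (by simp)] with y hy
    exact (A.hasFDerivAt.comp y (hy.differentiableAt (by simp)).hasFDerivAt).fderiv
  have df2 : DifferentiableAt ℝ (fderiv ℝ f) x :=
    (hfd.fderiv_right (m := ∞) (by norm_cast)).differentiableAt (by simp)
  refine ⟨w, c, hc, ?_⟩
  rw [Filter.EventuallyEq.fderiv_eq h1, h1.self_of_nhds]
  rw [((hasFDerivAt_const (A : F →L[ℝ] F') x).clm_comp df2.hasFDerivAt).fderiv]
  simp [hw]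

end Convex

section Factors

variable {n₁ n₂ : ℕ} {l : ℝ} {ψ₁ : Euc n₁ → Euc (n₁ + 1)} {ψ₂ : Euc n₂ → Euc (n₂ + 1)}

lemma fderiv_calabiProduct (p : ℝ × Euc n₁ × Euc n₂) (h₁ : DifferentiableAt ℝ ψ₁ p.2.1)
    (h₂ : DifferentiableAt ℝ ψ₂ p.2.2) (α : ℝ) (β : Euc n₁) (γ : Euc n₂) :
    fderiv ℝ (calabiProduct l ψ₁ ψ₂) p (α, β, γ) =
      (Real.exp p.1 • (α • ψ₁ p.2.1 + fderiv ℝ ψ₁ p.2.1 β),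
        Real.exp (-l * p.1) • ((-l * α) • ψ₂ p.2.2 + fderiv ℝ ψ₂ p.2.2 γ)) := by
  have d0 : HasFDerivAt (fun q : ℝ × Euc n₁ × Euc n₂ ↦ q.2)
    (ContinuousLinearMap.snd ℝ ℝ (Euc n₁ × Euc n₂)) p := hasFDerivAt_snd
  have d1 : HasFDerivAt (fun q : ℝ × Euc n₁ × Euc n₂ ↦ ψ₁ q.2.1) _ p :=
    HasFDerivAt.comp p h₁.hasFDerivAt d0.fst
  have d2 : HasFDerivAt (fun q : ℝ × Euc n₁ × Euc n₂ ↦ ψ₂ q.2.2) _ p :=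
    HasFDerivAt.comp p h₂.hasFDerivAt d0.snd
  have d3 : HasFDerivAt (fun q : ℝ × Euc n₁ × Euc n₂ ↦ q.1)
    (ContinuousLinearMap.fst ℝ ℝ (Euc n₁ × Euc n₂)) p := hasFDerivAt_fst
  have d : HasFDerivAt (calabiProduct l ψ₁ ψ₂) _ p :=
    (d3.exp.smul d1).prodMk ((d3.const_mul (-l)).exp.smul d2)
  rw [d.fderiv]
  simp
  constructor <;> module

lemma contDiff_calabiProduct (h₁ : ContDiff ℝ ∞ ψ₁) (h₂ : ContDiff ℝ ∞ ψ₂) :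
    ContDiff ℝ ∞ (calabiProduct l ψ₁ ψ₂) :=
  (contDiff_fst.exp.smul (h₁.comp (contDiff_fst.comp contDiff_snd))).prodMk
    ((contDiff_const.mul contDiff_fst).exp.smul (h₂.comp (contDiff_snd.comp contDiff_snd)))

/-- The derivative of a Calabi product in a fixed direction `(0, β, γ)` is again of Calabi form, so
the first-order formula applies twice. -/
lemma fderiv_fderiv_calabiProduct (h₁ : ContDiff ℝ ∞ ψ₁) (h₂ : ContDiff ℝ ∞ ψ₂)
    (p : ℝ × Euc n₁ × Euc n₂) (β : Euc n₁) (γ : Euc n₂) :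
    fderiv ℝ (fderiv ℝ (calabiProduct l ψ₁ ψ₂)) p (0, β, γ) (0, β, γ) =
      (Real.exp p.1 • fderiv ℝ (fderiv ℝ ψ₁) p.2.1 β β,
        Real.exp (-l * p.1) • fderiv ℝ (fderiv ℝ ψ₂) p.2.2 γ γ) := by
  have d : DifferentiableAt ℝ (fderiv ℝ (calabiProduct l ψ₁ ψ₂)) p :=
    ((contDiff_calabiProduct h₁ h₂).fderiv_right (m := ∞) (by norm_cast)).differentiable (by simp) p
  have d1 : DifferentiableAt ℝ (fderiv ℝ ψ₁) p.2.1 :=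
    (h₁.fderiv_right (m := ∞) (by norm_cast)).differentiable (by simp) _
  have d2 : DifferentiableAt ℝ (fderiv ℝ ψ₂) p.2.2 :=
    (h₂.fderiv_right (m := ∞) (by norm_cast)).differentiable (by simp) _
  have hfun : (fun q ↦ fderiv ℝ (calabiProduct l ψ₁ ψ₂) q (0, β, γ)) =
      calabiProduct l (fun y ↦ fderiv ℝ ψ₁ y β) (fun z ↦ fderiv ℝ ψ₂ z γ) := by
    funext q
    rw [fderiv_calabiProduct q (h₁.differentiable (by simp) _) (h₂.differentiable (by simp) _)]
    simp [calabiProduct]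
  rw [← fderiv_apply_const d, hfun, fderiv_calabiProduct p (by fun_prop) (by fun_prop),
    fderiv_apply_const d1, fderiv_apply_const d2]
  simp

lemma TransversalAt.fst_factor (h₁ : ContDiff ℝ ∞ ψ₁) (h₂ : ContDiff ℝ ∞ ψ₂) (hl : l ≠ -1)
    {p : ℝ × Euc n₁ × Euc n₂} (hp : TransversalAt (calabiProduct l ψ₁ ψ₂) p) :
    TransversalAt ψ₁ p.2.1 := by
  intro v c hvc
  have hl' : 1 + l ≠ 0 := fun h ↦ hl (by linarith)
  -- Lift the relation: with `α = c / (1 + l)` and `c' = l c / (1 + l)` one has `α + c' = c` and `-l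
  -- α + c' = 0`.
  obtain ⟨e1, e2⟩ := hp (c / (1 + l), v, 0) (l * (c / (1 + l))) (by
    rw [fderiv_calabiProduct p (h₁.differentiable (by simp) _) (h₂.differentiable (by simp) _)]
    have hc : c / (1 + l) + l * (c / (1 + l)) = c := by field_simp
    simp only [calabiProduct, Prod.smul_mk, Prod.mk_add_mk, Prod.mk_eq_zero, map_zero]
    constructor
    · rw [smul_comm _ (Real.exp _), ← smul_add, add_right_comm, ← add_smul, hc, add_comm (c • _), hvc,
        smul_zero]
    · module)
  rw [Prod.mk_eq_zero, Prod.mk_eq_zero] at e1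
  exact ⟨e1.2.1, by simpa [hl'] using e1.1⟩

lemma TransversalAt.snd_factor (h₁ : ContDiff ℝ ∞ ψ₁) (h₂ : ContDiff ℝ ∞ ψ₂) (hl : l ≠ -1)
    {p : ℝ × Euc n₁ × Euc n₂} (hp : TransversalAt (calabiProduct l ψ₁ ψ₂) p) :
    TransversalAt ψ₂ p.2.2 := by
  intro v c hvc
  have hl' : 1 + l ≠ 0 := fun h ↦ hl (by linarith)
  obtain ⟨e1, e2⟩ := hp (-(c / (1 + l)), 0, v) (c / (1 + l)) (by
    rw [fderiv_calabiProduct p (h₁.differentiable (by simp) _) (h₂.differentiable (by simp) _)]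
    have hc : -l * -(c / (1 + l)) + c / (1 + l) = c := by field_simp; ring
    simp only [calabiProduct, Prod.smul_mk, Prod.mk_add_mk, Prod.mk_eq_zero, map_zero]
    constructor
    · module
    · rw [smul_comm _ (Real.exp _), ← smul_add, add_right_comm, ← add_smul, hc, add_comm (c • _), hvc,
        smul_zero])
  rw [Prod.mk_eq_zero, Prod.mk_eq_zero] at e1
  exact ⟨e1.2.2, by simpa [hl'] using e1.1⟩

lemma exists_sign {s : ℝ} (hs : s ≠ 0) : ∃ ε : ℝ, (ε = 1 ∨ ε = -1) ∧ s = ε * |s| := by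
  rcases hs.lt_or_gt with h | h
  · exact ⟨-1, Or.inr rfl, by rw [abs_of_neg h]; ring⟩
  · exact ⟨1, Or.inl rfl, by rw [abs_of_pos h]; ring⟩

/-- In a direction tangent to the first factor, the second component of the Gauss formula forces `α
= -ε c / l`. The first component then has position coefficient `α - ε c = -ε (1 + 1 / l) c`, so `ε₁`
is the sign of `ε (1 + 1 / l)`. -/
lemma ConvexAt.fst_factor (h₁ : ContDiff ℝ ∞ ψ₁) (h₂ : ContDiff ℝ ∞ ψ₂) (hl : l ≠ -1)
    (hl0 : l ≠ 0) {ε ε₁ : ℝ} (hs : ε * (1 + l⁻¹) = ε₁ * |ε * (1 + l⁻¹)|)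
    (hs0 : ε * (1 + l⁻¹) ≠ 0) {p : ℝ × Euc n₁ × Euc n₂}
    (hp : TransversalAt (calabiProduct l ψ₁ ψ₂) p) (hc : ConvexAt ε (calabiProduct l ψ₁ ψ₂) p) :
    ConvexAt ε₁ ψ₁ p.2.1 := by
  intro v hv
  obtain ⟨⟨α, β, γ⟩, c, hc0, hw⟩ := hc (0, v, 0) (by simpa using hv)
  rw [fderiv_fderiv_calabiProduct h₁ h₂, fderiv_calabiProduct p (h₁.differentiable (by simp) _)
    (h₂.differentiable (by simp) _)] at hw
  simp only [calabiProduct, Prod.smul_mk, Prod.mk_sub_mk, Prod.mk.injEq, map_zero, smul_zero,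
    smul_comm (ε * c) (Real.exp _), ← smul_sub] at hw
  obtain ⟨hw1, hw2⟩ := hw
  have hw2' := (smul_eq_zero.1 hw2.symm).resolve_left (Real.exp_pos _).ne'
  have hα := (hp.snd_factor h₁ h₂ hl γ (-l * α - ε * c) (by rw [← hw2']; module)).2
  have hα' : α = -(ε * c * l⁻¹) := by field_simp; linarith
  refine ⟨β, |ε * (1 + l⁻¹)| * c, by positivity, ?_⟩
  rw [smul_right_injective _ (Real.exp_pos p.1).ne' hw1, ← mul_assoc, ← hs, hα']
  module

/-- Here the first component forces `α = ε c`, and the position coefficient becomes `-l α - ε c = -ε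
(1 + l) c`. -/
lemma ConvexAt.snd_factor (h₁ : ContDiff ℝ ∞ ψ₁) (h₂ : ContDiff ℝ ∞ ψ₂) (hl : l ≠ -1)
    {ε ε₂ : ℝ} (hs : ε * (1 + l) = ε₂ * |ε * (1 + l)|) (hs0 : ε * (1 + l) ≠ 0)
    {p : ℝ × Euc n₁ × Euc n₂}
    (hp : TransversalAt (calabiProduct l ψ₁ ψ₂) p) (hc : ConvexAt ε (calabiProduct l ψ₁ ψ₂) p) :
    ConvexAt ε₂ ψ₂ p.2.2 := by
  intro v hv
  obtain ⟨⟨α, β, γ⟩, c, hc0, hw⟩ := hc (0, 0, v) (by simpa using hv)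
  rw [fderiv_fderiv_calabiProduct h₁ h₂, fderiv_calabiProduct p (h₁.differentiable (by simp) _)
    (h₂.differentiable (by simp) _)] at hw
  simp only [calabiProduct, Prod.smul_mk, Prod.mk_sub_mk, Prod.mk.injEq, map_zero, smul_zero,
    smul_comm (ε * c) (Real.exp _), ← smul_sub] at hw
  obtain ⟨hw1, hw2⟩ := hw
  have hw1' := (smul_eq_zero.1 hw1.symm).resolve_left (Real.exp_pos _).ne'
  have hα := (hp.fst_factor h₁ h₂ hl β (α - ε * c) (by rw [← hw1']; module)).2
  have hα' : α = ε * c := by linarith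
  refine ⟨γ, |ε * (1 + l)| * c, by positivity, ?_⟩
  rw [smul_right_injective _ (Real.exp_pos _).ne' hw2, ← mul_assoc, ← hs, hα']
  module

end Factors

lemma mvfderiv_eq_fderiv {n : ℕ} {F : Type*} [NormedAddCommGroup F] [NormedSpace ℝ F]
    (f : Euc n → F) (x : Euc n) : mvfderiv (𝓡 n) f x = fderiv ℝ f x := by
  ext v
  simp [mvfderiv, mfderiv_eq_fderiv]
  rfl

lemma diffAt_const {n : ℕ} (v : Euc n) (x : Euc n) :
    VField.DiffAt (M := Euc n) (fun _ ↦ v) x := by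
  have h := (contMDiffAt_vectorSpace_iff_contDiffAt (𝕜 := ℝ) (n := 1) (x := x)
    (V := fun _ : Euc n ↦ v)).2 contDiffAt_const
  exact h.mdifferentiableAt one_ne_zero

lemma isLocallyStronglyConvex_of_flat {n : ℕ} {ψ : Euc n → Euc (n + 1)} (hψ : ContDiff ℝ ∞ ψ)
    {ε : ℝ} (hε : ε = 1 ∨ ε = -1) (ht : ∀ x, TransversalAt ψ x) (hc : ∀ x, ConvexAt ε ψ x) :
    IsLocallyStronglyConvex ψ := by
  have hca : IsCentroaffine ψ := by
    refine ⟨hψ.contMDiff, fun x ↦ ?_, fun x ↦ ?_⟩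
    · rw [injective_iff_map_eq_zero]
      intro v hv
      rw [mvfderiv_eq_fderiv] at hv
      exact (ht x v 0 (by rw [zero_smul, add_zero]; exact hv)).1
    · rintro ⟨v, hv⟩
      rw [mvfderiv_eq_fderiv] at hv
      have := (ht x v (-1) (by rw [neg_one_smul, ← sub_eq_add_neg, sub_eq_zero]; exact hv)).2
      norm_num at this
  refine ⟨hca, ε, hε, fun x v hv ↦ ?_⟩
  obtain ⟨w, c, hc0, hw⟩ := hc x v hv
  have hg := gauss_formula hca hε (diffAt_const v x) v
  have hfl : flatDeriv ψ (fun _ ↦ v) x v = fderiv ℝ (fderiv ℝ ψ) x v v := by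
    simp only [flatDeriv, mvfderiv_eq_fderiv]
    exact fderiv_apply_const ((hψ.fderiv_right (m := ∞) (by norm_cast)).differentiable
      (by simp) x) v v
  rw [hfl, hw, mvfderiv_eq_fderiv, smul_smul] at hg
  have hεε : ε * ε = 1 := by rcases hε with rfl | rfl <;> norm_num
  set w' : Euc n := inducedConnection hca (fun _ ↦ v) x v with hw'
  -- Two decompositions of the same second derivative; transversality identifies the coefficients of
  -- the position vector.
  have h1 := (ht x (w - w') (ε * metric ε ψ x v v - ε * c) (by
    have hg' : fderiv ℝ ψ x w - (ε * c) • ψ x =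
      fderiv ℝ ψ x w' + (metric ε ψ x v v * -ε) • ψ x := hg
    rw [map_sub]
    linear_combination (norm := module) hg')).2
  have h2 : metric ε ψ x v v = c := by
    linear_combination ε * h1 + (c - metric ε ψ x v v) * hεε
  rw [h2]
  exact hc0

/-! ### Vector fields and immersions in a smooth chart. -/

section Chart

variable {n : ℕ} {M : Type*} [TopologicalSpace M] [ChartedSpace (Euc n) M]

/-- The derivative of a chart. -/
def chartDeriv (φ : OpenPartialHomeomorph M (Euc n)) (q : M) :
    TangentSpace (𝓡 n) q →L[ℝ] Euc n := mvfderiv (𝓡 n) φ q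

/-- The coordinate vector field of the chart `φ` in the direction `a`. -/
def coordField (φ : OpenPartialHomeomorph M (Euc n)) (a : Euc n) : VField n M :=
  VectorField.mpullback (𝓡 n) (𝓡 n) φ (fun _ ↦ a)

/-- A smooth chart. -/
structure IsSmoothChart [IsManifold (𝓡 n) ∞ M] (φ : OpenPartialHomeomorph M (Euc n)) : Prop where
  smooth : ContMDiffOn (𝓡 n) (𝓡 n) ∞ φ φ.source
  smooth_symm : ContMDiffOn (𝓡 n) (𝓡 n) ∞ φ.symm φ.target

variable [IsManifold (𝓡 n) ∞ M]

lemma isSmoothChart_chartAt (p : M) : IsSmoothChart (chartAt (Euc n) p) :=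
  ⟨contMDiffOn_chart, contMDiffOn_chart_symm⟩

namespace IsSmoothChart

variable {φ : OpenPartialHomeomorph M (Euc n)} (hφ : IsSmoothChart φ) {q : M} (hq : q ∈ φ.source)
include hφ

lemma contMDiffAt {q : M} (hq : q ∈ φ.source) : ContMDiffAt (𝓡 n) (𝓡 n) ∞ φ q :=
  hφ.smooth.contMDiffAt (φ.open_source.mem_nhds hq)

lemma contMDiffAt_symm {x : Euc n} (hx : x ∈ φ.target) : ContMDiffAt (𝓡 n) (𝓡 n) ∞ φ.symm x :=
  hφ.smooth_symm.contMDiffAt (φ.open_target.mem_nhds hx)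

lemma isInvertible_mfderiv {q : M} (hq : q ∈ φ.source) :
    (mfderiv (𝓡 n) (𝓡 n) φ q).IsInvertible := by
  have h : φ.MDifferentiable (𝓡 n) (𝓡 n) :=
    ⟨hφ.smooth.mdifferentiableOn (by simp), hφ.smooth_symm.mdifferentiableOn (by simp)⟩
  exact ⟨h.mfderiv hq, rfl⟩

include hq

lemma chartDeriv_coordField (a : Euc n) : chartDeriv φ q (coordField φ a q) = a :=
  (hφ.isInvertible_mfderiv hq).self_apply_inverse a

lemma coordField_chartDeriv (v : TangentSpace (𝓡 n) q) :
    coordField φ (chartDeriv φ q v) q = v :=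
  (hφ.isInvertible_mfderiv hq).inverse_apply_self v

lemma chartDeriv_injective : Function.Injective (chartDeriv φ q) := fun v w h ↦ by
  rw [← hφ.coordField_chartDeriv hq v, h, hφ.coordField_chartDeriv hq]

lemma diffAt_coordField (a : Euc n) : VField.DiffAt (coordField φ a) q :=
  MDifferentiableAt.mpullback_vectorField (V := fun _ ↦ a) (n := ∞) (diffAt_const a (φ q))
    (hφ.contMDiffAt hq) (hφ.isInvertible_mfderiv hq) (WithTop.coe_le_coe.2 le_top)

/-- The bracket is natural under pullback, and constant fields commute. -/
lemma mlieBracket_coordField (a b : Euc n) :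
    VectorField.mlieBracket (𝓡 n) (coordField φ a) (coordField φ b) q = 0 := by
  have : IsManifold (𝓡 n) (minSmoothness ℝ 2) M :=
    IsManifold.of_le (n := ∞) (by simp; exact WithTop.coe_le_coe.2 (le_top : (2 : ℕ∞) ≤ ⊤))
  let A : VField n (Euc n) := fun _ ↦ a
  let B : VField n (Euc n) := fun _ ↦ b
  have h := VectorField.mpullback_mlieBracket (I := 𝓡 n) (I' := 𝓡 n) (f := φ) (x₀ := q)
    (V := A) (W := B) (n := ∞) (diffAt_const a (φ q)) (diffAt_const b (φ q))
    (hφ.contMDiffAt hq) (by simp; exact WithTop.coe_le_coe.2 (le_top : (2 : ℕ∞) ≤ ⊤))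
  have h0 : VectorField.mlieBracket (𝓡 n) A B (φ q) = 0 := by
    rw [← VectorField.mlieBracketWithin_univ, VectorField.mlieBracketWithin_eq_lieBracketWithin]
    simp [VectorField.lieBracketWithin, A, B]
    rfl
  rw [VectorField.mpullback_apply, h0, map_zero] at h
  exact h.symm

lemma mvfderiv_eq {G : Type*} [NormedAddCommGroup G] [NormedSpace ℝ G] {g : M → G}
    (hg : MDifferentiableAt (𝓡 n) 𝓘(ℝ, G) g q) :
    DifferentiableAt ℝ (g ∘ φ.symm) (φ q) ∧
    ∀ v, mvfderiv (𝓡 n) g q v = fderiv ℝ (g ∘ φ.symm) (φ q) (chartDeriv φ q v) := by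
  have hev : g =ᶠ[𝓝 q] (g ∘ φ.symm) ∘ φ := by
    filter_upwards [φ.open_source.mem_nhds hq] with y hy
    simp [φ.left_inv hy]
  have h1 : MDifferentiableAt (𝓡 n) 𝓘(ℝ, G) (g ∘ φ.symm) (φ q) := by
    refine MDifferentiableAt.comp (φ q) ?_
      ((hφ.contMDiffAt_symm (φ.map_source hq)).mdifferentiableAt (by simp))
    rwa [φ.left_inv hq]
  refine ⟨h1.differentiableAt, fun v ↦ ?_⟩
  have h2 : mfderiv (𝓡 n) 𝓘(ℝ, G) g q = _ := hev.mfderiv_eq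
  rw [mfderiv_comp q h1 ((hφ.contMDiffAt hq).mdifferentiableAt (by simp)), mfderiv_eq_fderiv] at h2
  change mfderiv (𝓡 n) 𝓘(ℝ, G) g q v = _
  rw [h2]
  rfl

end IsSmoothChart

variable {φ : OpenPartialHomeomorph M (Euc n)} (hφ : IsSmoothChart φ) {q : M}
  {ψ : M → Euc (n + 1)} (hψ : IsCentroaffine ψ)
include hφ hψ

lemma contDiffOn_chart_rep : ContDiffOn ℝ ∞ (ψ ∘ φ.symm) φ.target :=
  (hψ.smooth.comp_contMDiffOn hφ.smooth_symm).contDiffOn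

lemma mvfderiv_chart (hq : q ∈ φ.source) (v : TangentSpace (𝓡 n) q) :
    mvfderiv (𝓡 n) ψ q v = fderiv ℝ (ψ ∘ φ.symm) (φ q) (chartDeriv φ q v) :=
  (hφ.mvfderiv_eq hq (hψ.smooth.contMDiffAt.mdifferentiableAt (by simp))).2 v

lemma flatDeriv_coordField (hq : q ∈ φ.source) (b : Euc n) (v : TangentSpace (𝓡 n) q) :
    flatDeriv ψ (coordField φ b) q v =
      fderiv ℝ (fderiv ℝ (ψ ∘ φ.symm)) (φ q) (chartDeriv φ q v) b := by
  rw [flatDeriv, (hφ.mvfderiv_eq hq (hψ.mdifferentiableAt_push (hφ.diffAt_coordField hq b))).2]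
  have hev : (fun q ↦ mvfderiv (𝓡 n) ψ q (coordField φ b q)) ∘ φ.symm =ᶠ[𝓝 (φ q)]
      fun x ↦ fderiv ℝ (ψ ∘ φ.symm) x b := by
    filter_upwards [φ.open_target.mem_nhds (φ.map_source hq)] with x hx
    have hx' := φ.map_target hx
    rw [Function.comp_apply, mvfderiv_chart hφ hψ hx', hφ.chartDeriv_coordField hx',
      φ.right_inv hx]
  have hd : DifferentiableAt ℝ (fderiv ℝ (ψ ∘ φ.symm)) (φ q) :=
    (((contDiffOn_chart_rep hφ hψ).contDiffAt
      (φ.open_target.mem_nhds (φ.map_source hq))).fderiv_right (m := ∞)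
      (by norm_cast)).differentiableAt (by simp)
  rw [hev.fderiv_eq, fderiv_apply_const hd]

lemma transversalAt_chart {x : Euc n} (hx : x ∈ φ.target) : TransversalAt (ψ ∘ φ.symm) x := by
  intro v c hvc
  have hq := φ.map_target hx
  have h1 := mvfderiv_chart hφ hψ hq (coordField φ v (φ.symm x))
  rw [hφ.chartDeriv_coordField hq, φ.right_inv hx] at h1
  rw [← h1] at hvc
  have h2 : splitting ψ (φ.symm x) (coordField φ v (φ.symm x), c) = 0 := by
    rw [splitting, ContinuousLinearMap.coprod_apply, ContinuousLinearMap.toSpanSingleton_apply]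
    exact hvc
  have h3 := (hψ.splitting_isInvertible (φ.symm x)).inverse_apply_self
    (coordField φ v (φ.symm x), c)
  rw [h2, map_zero, eq_comm, Prod.mk_eq_zero] at h3
  refine ⟨?_, h3.2⟩
  rw [← hφ.chartDeriv_coordField hq v, h3.1, map_zero]

end Chart

/-! ### The induced connection, the metric and the difference tensor in a chart. -/

section Flat

variable {E F : Type*} [NormedAddCommGroup E] [NormedSpace ℝ E] [NormedAddCommGroup F]
  [NormedSpace ℝ F]

/-- The tangential part of the second derivative of an immersion `f` of a centroaffine
hypersurface. -/
def flatConn (f : E → F) (x : E) : E →L[ℝ] E →L[ℝ] E :=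
  ContinuousLinearMap.compL ℝ E F E
    (ContinuousLinearMap.fst ℝ E ℝ ∘L (flatSplitting f x).inverse) ∘L fderiv ℝ (fderiv ℝ f) x

/-- The centroaffine metric induced by `-ε f`. -/
def flatMetric (ε : ℝ) (f : E → F) (x : E) : E →L[ℝ] E →L[ℝ] ℝ :=
  ContinuousLinearMap.compL ℝ E F ℝ
    (-ε • (ContinuousLinearMap.snd ℝ E ℝ ∘L (flatSplitting f x).inverse)) ∘L
      fderiv ℝ (fderiv ℝ f) x

variable [FiniteDimensional ℝ E] [FiniteDimensional ℝ F] {f : E → F} {x : E} {ε : ℝ}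

lemma flat_gauss (hdim : Module.finrank ℝ F = Module.finrank ℝ E + 1) (hε : ε * ε = 1)
    (ht : TransversalAt f x) (u v : E) : fderiv ℝ (fderiv ℝ f) x u v =
      fderiv ℝ f x (flatConn f x u v) - (ε * flatMetric ε f x u v) • f x := by
  have h := (ht.isInvertible hdim).self_apply_inverse (fderiv ℝ (fderiv ℝ f) x u v)
  conv_lhs => rw [← h]
  rw [← Prod.mk.eta (p := (flatSplitting f x).inverse _), flatSplitting_apply]
  simp only [flatConn, flatMetric, ContinuousLinearMap.comp_apply, ContinuousLinearMap.compL_apply,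
    smul_apply, ContinuousLinearMap.coe_fst', ContinuousLinearMap.coe_snd', smul_eq_mul]
  rw [sub_eq_add_neg, ← neg_smul]
  congr 2
  linear_combination -((flatSplitting f x).inverse (fderiv ℝ (fderiv ℝ f) x u v)).2 * hε

lemma contDiffAt_flatConn (hdim : Module.finrank ℝ F = Module.finrank ℝ E + 1)
    (hf : ContDiffAt ℝ ∞ f x) (ht : TransversalAt f x) : ContDiffAt ℝ ∞ (flatConn f) x := by
  have h1 := contDiffAt_flatSplitting_inverse hdim hf ht
  have h2 : ContDiffAt ℝ ∞ (fderiv ℝ (fderiv ℝ f)) x :=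
    (hf.fderiv_right (m := ∞) (by norm_cast)).fderiv_right (by norm_cast)
  exact ((ContinuousLinearMap.compL ℝ E F E).contDiff.contDiffAt.comp x
    (contDiffAt_const.clm_comp h1)).clm_comp h2

lemma contDiffAt_flatMetric (hdim : Module.finrank ℝ F = Module.finrank ℝ E + 1)
    (hf : ContDiffAt ℝ ∞ f x) (ht : TransversalAt f x) : ContDiffAt ℝ ∞ (flatMetric ε f) x := by
  have h1 := contDiffAt_flatSplitting_inverse hdim hf ht
  have h2 : ContDiffAt ℝ ∞ (fderiv ℝ (fderiv ℝ f)) x :=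
    (hf.fderiv_right (m := ∞) (by norm_cast)).fderiv_right (by norm_cast)
  have h3 : ContDiffAt ℝ ∞ (fun y ↦ ContinuousLinearMap.snd ℝ E ℝ ∘L
      (flatSplitting f y).inverse) x := contDiffAt_const.clm_comp h1
  exact ((ContinuousLinearMap.compL ℝ E F ℝ).contDiff.contDiffAt.comp x
    (h3.const_smul (-ε))).clm_comp h2

omit [FiniteDimensional ℝ E] [FiniteDimensional ℝ F] in
lemma flat_symm (hf : ContDiffAt ℝ ∞ f x) (u v : E) :
    flatConn f x u v = flatConn f x v u ∧ flatMetric ε f x u v = flatMetric ε f x v u := by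
  have h : fderiv ℝ (fderiv ℝ f) x u v = fderiv ℝ (fderiv ℝ f) x v u :=
    hf.isSymmSndFDerivAt (by simp; exact WithTop.coe_le_coe.2 (le_top : (2 : ℕ∞) ≤ ⊤)) u v
  simp [flatConn, flatMetric, h]

end Flat

section Data

variable {n : ℕ} {M : Type*} [TopologicalSpace M] [ChartedSpace (Euc n) M]
  [IsManifold (𝓡 n) ∞ M]

lemma finrank_euc_succ : Module.finrank ℝ (Euc (n + 1)) = Module.finrank ℝ (Euc n) + 1 := by simp

/-- The difference tensor in a chart. -/
def chartDiff {ψ : M → Euc (n + 1)} (hψ : IsCentroaffine ψ)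
    (cov' : CovariantDerivative (𝓡 n) (Euc n) (TangentSpace (𝓡 n) : M → Type _))
    (φ : OpenPartialHomeomorph M (Euc n)) (x : Euc n) : Euc n →L[ℝ] Euc n →L[ℝ] Euc n :=
  let e : Euc n →L[ℝ] Euc n := chartDeriv φ (φ.symm x)
  let D : Euc n →L[ℝ] Euc n →L[ℝ] Euc n := (inducedConnection hψ).difference cov' (φ.symm x)
  -- The difference of connections takes the differentiated vector first and the direction second;
  -- `D.flip` puts the direction first.
  (ContinuousLinearMap.compL ℝ (Euc n) (Euc n) (Euc n) e) ∘L
    (ContinuousLinearMap.compL ℝ (Euc n) (Euc n) (Euc n)).flip e.inverse ∘L D.flip ∘L e.inverse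

variable {φ : OpenPartialHomeomorph M (Euc n)} (hφ : IsSmoothChart φ)
  {ψ : M → Euc (n + 1)} (hψ : IsCentroaffine ψ)

lemma chartDiff_apply
    (cov' : CovariantDerivative (𝓡 n) (Euc n) (TangentSpace (𝓡 n) : M → Type _))
    (x : Euc n) (u v : Euc n) : chartDiff hψ cov' φ x u v = chartDeriv φ (φ.symm x)
      (differenceTensor hψ cov' (φ.symm x) (coordField φ u (φ.symm x))
        (coordField φ v (φ.symm x))) := rfl

include hφ hψ

/-- The induced connection and the centroaffine metric in a chart. -/
lemma connection_metric_chart {ε : ℝ} (hε : ε = 1 ∨ ε = -1) {q : M} (hq : q ∈ φ.source)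
    (v : TangentSpace (𝓡 n) q) (b : Euc n) :
    chartDeriv φ q (inducedConnection hψ (coordField φ b) q v) =
      flatConn (ψ ∘ φ.symm) (φ q) (chartDeriv φ q v) b ∧
    metric ε ψ q v (coordField φ b q) =
      flatMetric ε (ψ ∘ φ.symm) (φ q) (chartDeriv φ q v) b := by
  have hεε : ε * ε = 1 := by rcases hε with rfl | rfl <;> norm_num
  have hg := gauss_formula hψ hε (hφ.diffAt_coordField hq b) v
  have ht := transversalAt_chart hφ hψ (φ.map_source hq)
  rw [flatDeriv_coordField hφ hψ hq, mvfderiv_chart hφ hψ hq,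
    flat_gauss finrank_euc_succ hεε ht] at hg
  have hψq : ψ q = (ψ ∘ φ.symm) (φ q) := by simp [φ.left_inv hq]
  rw [hψq] at hg
  have h0 := ht (chartDeriv φ q (inducedConnection hψ (coordField φ b) q v) -
      flatConn (ψ ∘ φ.symm) (φ q) (chartDeriv φ q v) b)
    (ε * (flatMetric ε (ψ ∘ φ.symm) (φ q) (chartDeriv φ q v) b -
      metric ε ψ q v (coordField φ b q))) (by
      rw [map_sub]
      linear_combination (norm := module) -(1 : ℝ) • hg)
  refine ⟨sub_eq_zero.1 h0.1, ?_⟩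
  have hε0 : ε ≠ 0 := by rintro rfl; norm_num at hεε
  exact (sub_eq_zero.1 ((mul_eq_zero.1 h0.2).resolve_left hε0)).symm

lemma metric_chart {ε : ℝ} (hε : ε = 1 ∨ ε = -1) {q : M} (hq : q ∈ φ.source)
    (v w : TangentSpace (𝓡 n) q) : metric ε ψ q v w =
      flatMetric ε (ψ ∘ φ.symm) (φ q) (chartDeriv φ q v) (chartDeriv φ q w) := by
  rw [← (connection_metric_chart hφ hψ hε hq v (chartDeriv φ q w)).2,
    hφ.coordField_chartDeriv hq]

variable {nablaHat : CovariantDerivative (𝓡 n) (Euc n) (TangentSpace (𝓡 n) : M → Type _)}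

lemma nablaHat_chart {q : M} (hq : q ∈ φ.source) (u v : Euc n) :
    chartDeriv φ q (nablaHat (coordField φ v) q (coordField φ u q)) =
      flatConn (ψ ∘ φ.symm) (φ q) u v - chartDiff hψ nablaHat φ (φ q) u v := by
  have h1 := differenceTensor_apply hψ nablaHat (coordField φ u) (coordField φ v)
    (hφ.diffAt_coordField hq v)
  have h2 := (connection_metric_chart hφ hψ (ε := 1) (Or.inl rfl) hq (coordField φ u q) v).1
  rw [hφ.chartDeriv_coordField hq] at h2
  rw [chartDiff_apply, φ.left_inv hq, h1, map_sub, h2, sub_sub_cancel]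

variable {ε : ℝ} (hLC : IsLeviCivita (metric ε ψ) nablaHat)
include hLC

/-- Both connections are torsion free: the induced one by symmetry of the second derivative, the
other by hypothesis, as coordinate fields commute. -/
lemma chartDiff_symm {x : Euc n} (hx : x ∈ φ.target) (u v : Euc n) :
    chartDiff hψ nablaHat φ x u v = chartDiff hψ nablaHat φ x v u := by
  have hq := φ.map_target hx
  have h1 := hLC.torsion_free _ _ _ (hφ.diffAt_coordField hq u) (hφ.diffAt_coordField hq v)
  rw [hφ.mlieBracket_coordField hq] at h1
  have h2 := congrArg (chartDeriv φ (φ.symm x)) h1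
  rw [map_sub, nablaHat_chart hφ hψ hq, nablaHat_chart hφ hψ hq, φ.right_inv hx, map_zero,
    (flat_symm (ε := ε) ((contDiffOn_chart_rep hφ hψ).contDiffAt (φ.open_target.mem_nhds hx)) u v).1]
    at h2
  have h3 : chartDiff hψ nablaHat φ x v u - chartDiff hψ nablaHat φ x u v = 0 := by
    rw [← h2]; abel
  exact (sub_eq_zero.1 h3).symm

variable (hε : ε = 1 ∨ ε = -1)
include hε

lemma flatMetric_compatible {x : Euc n} (hx : x ∈ φ.target) (u v w : Euc n) :
    fderiv ℝ (flatMetric ε (ψ ∘ φ.symm)) x u v w =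
      flatMetric ε (ψ ∘ φ.symm) x
        (flatConn (ψ ∘ φ.symm) x u v - chartDiff hψ nablaHat φ x u v) w +
      flatMetric ε (ψ ∘ φ.symm) x v
        (flatConn (ψ ∘ φ.symm) x u w - chartDiff hψ nablaHat φ x u w) := by
  have hq := φ.map_target hx
  have hf := (contDiffOn_chart_rep hφ hψ).contDiffAt (φ.open_target.mem_nhds hx)
  have ht := transversalAt_chart hφ hψ hx
  have dh : DifferentiableAt ℝ (flatMetric ε (ψ ∘ φ.symm)) x :=
    (contDiffAt_flatMetric finrank_euc_succ hf ht).differentiableAt (by simp)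
  have h1 := hLC.compatible _ _ _ (hφ.diffAt_coordField hq v) (hφ.diffAt_coordField hq w)
    (coordField φ u (φ.symm x))
  simp only [metric_chart hφ hψ hε hq, hφ.chartDeriv_coordField hq, nablaHat_chart hφ hψ hq,
    φ.right_inv hx] at h1
  rw [← h1]
  set g : M → ℝ := fun q ↦ metric ε ψ q (coordField φ v q) (coordField φ w q) with hg
  have hgφ : ∀ q ∈ φ.source, g q = flatMetric ε (ψ ∘ φ.symm) (φ q) v w := fun q hq ↦ by
    rw [hg]
    simp only [metric_chart hφ hψ hε hq, hφ.chartDeriv_coordField hq]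
  have dh' : DifferentiableAt ℝ (fun y ↦ flatMetric ε (ψ ∘ φ.symm) y v w) x := by fun_prop
  have hgd : MDifferentiableAt (𝓡 n) 𝓘(ℝ, ℝ) g (φ.symm x) := by
    have h2 : MDifferentiableAt (𝓡 n) 𝓘(ℝ, ℝ)
        ((fun y ↦ flatMetric ε (ψ ∘ φ.symm) y v w) ∘ φ) (φ.symm x) := by
      refine DifferentiableAt.comp_mdifferentiableAt (by rwa [φ.right_inv hx])
        ((hφ.contMDiffAt hq).mdifferentiableAt (by simp))
    refine h2.congr_of_eventuallyEq ?_
    filter_upwards [φ.open_source.mem_nhds hq] with y hy using hgφ y hy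
  rw [(hφ.mvfderiv_eq hq hgd).2, hφ.chartDeriv_coordField hq, φ.right_inv hx,
    ← fderiv_apply_const_const dh]
  have hev : (fun y ↦ flatMetric ε (ψ ∘ φ.symm) y v w) =ᶠ[𝓝 x] g ∘ φ.symm := by
    filter_upwards [φ.open_target.mem_nhds hx] with y hy
    rw [Function.comp_apply, hgφ _ (φ.map_target hy), φ.right_inv hy]
  rw [hev.fderiv_eq]

/-- Metric compatibility gives `(∇_u h)(v, w) = -h(K(u, v), w) - h(v, K(u, w))`, and Codazzi makes
`∇h` totally symmetric. With `K` symmetric, a Koszul-type permutation yields `h(K(u, v), w) = -(∇_u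
h)(v, w) / 2`. The second identity expresses `K` by smooth quantities. -/
lemma flatMetric_chartDiff {x : Euc n} (hx : x ∈ φ.target) (u v w : Euc n) :
    flatMetric ε (ψ ∘ φ.symm) x (chartDiff hψ nablaHat φ x u v) w =
      flatMetric ε (ψ ∘ φ.symm) x v (chartDiff hψ nablaHat φ x u w) ∧
    flatMetric ε (ψ ∘ φ.symm) x (chartDiff hψ nablaHat φ x u v) w =
      2⁻¹ * (flatMetric ε (ψ ∘ φ.symm) x (flatConn (ψ ∘ φ.symm) x u v) w +
        flatMetric ε (ψ ∘ φ.symm) x v (flatConn (ψ ∘ φ.symm) x u w) -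
        fderiv ℝ (flatMetric ε (ψ ∘ φ.symm)) x u v w) := by
  have hεε : ε * ε = 1 := by rcases hε with rfl | rfl <;> norm_num
  have hε0 : ε ≠ 0 := by rintro rfl; norm_num at hεε
  have hf := (contDiffOn_chart_rep hφ hψ).contDiffAt (φ.open_target.mem_nhds hx)
  have ht := transversalAt_chart hφ hψ hx
  have dG : DifferentiableAt ℝ (flatConn (ψ ∘ φ.symm)) x :=
    (contDiffAt_flatConn finrank_euc_succ hf ht).differentiableAt (by simp)
  have dh : DifferentiableAt ℝ (flatMetric ε (ψ ∘ φ.symm)) x :=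
    (contDiffAt_flatMetric finrank_euc_succ hf ht).differentiableAt (by simp)
  have hcod := fun u v w ↦ (integrability hε0 hf dG dh ht (by
    filter_upwards [φ.open_target.mem_nhds hx] with y hy u v
    exact flat_gauss finrank_euc_succ hεε (transversalAt_chart hφ hψ hy) u v) u v w).2
  have hcomp := flatMetric_compatible hφ hψ hLC hε hx
  have hsymm := chartDiff_symm hφ hψ hLC hx
  set K := chartDiff hψ nablaHat φ x
  set h := flatMetric ε (ψ ∘ φ.symm) x
  set G := flatConn (ψ ∘ φ.symm) x
  have hh : ∀ u v, h u v = h v u := fun u v ↦ (flat_symm hf u v).2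
  simp only [map_sub, sub_apply] at hcomp
  have e1 := hcomp u v w
  have e2 := hcomp v u w
  have e3 := hcomp w u v
  have e4 := hcomp u w v
  have c1 := hcod u v w
  have c2 := hcod u w v
  rw [hsymm v u, hh u (K v w)] at e2
  rw [hsymm w u, hsymm w v, hh u (K v w)] at e3
  rw [hh v (K u w)] at e1 ⊢
  rw [hh w (K u v)] at e4
  rw [(flat_symm (ε := ε) hf v u).1] at e2
  rw [(flat_symm (ε := ε) hf w u).1, (flat_symm (ε := ε) hf w v).1] at e3
  rw [(flat_symm (ε := ε) hf w v).1] at c2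
  have s1 := hh v (G u w)
  have s2 := hh w (G u v)
  constructor <;> linarith

end Data

section Flat

variable {E F : Type*} [NormedAddCommGroup E] [NormedSpace ℝ E] [FiniteDimensional ℝ E]

lemma isInvertible_of_pos {h : E →L[ℝ] E →L[ℝ] ℝ} (hpos : ∀ v, v ≠ 0 → 0 < h v v) :
    h.IsInvertible := by
  have hinj : Function.Injective h := by
    rw [injective_iff_map_eq_zero]
    intro v hv
    by_contra h0
    have := hpos v h0
    simp [hv] at this
  have hdim : Module.finrank ℝ E = Module.finrank ℝ (E →L[ℝ] ℝ) := by
    rw [← (LinearMap.toContinuousLinearMap (𝕜 := ℝ) (E := E) (F' := ℝ)).finrank_eq]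
    exact (Subspace.dual_finrank_eq (K := ℝ) (V := E)).symm
  exact ⟨(LinearEquiv.ofInjectiveOfFinrankEq h.toLinearMap hinj
    hdim).toContinuousLinearEquiv, rfl⟩

/-- Smoothness of `K` comes from this: the Levi-Civita connection is given without a smoothness
assumption, but the functions `h(K(u, v), w)` are smooth and `h` is invertible. -/
lemma contDiffOn_of_pos {O : Set E} {h : E → E →L[ℝ] E →L[ℝ] ℝ} {k : E → E →L[ℝ] E →L[ℝ] E}
    (hh : ContDiffOn ℝ ∞ h O) (hpos : ∀ x ∈ O, ∀ v, v ≠ 0 → 0 < h x v v)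
    (hk : ∀ u v w, ContDiffOn ℝ ∞ (fun x ↦ h x (k x u v) w) O) : ContDiffOn ℝ ∞ k O := by
  have : CompleteSpace E := FiniteDimensional.complete ℝ E
  have h1 : ContDiffOn ℝ ∞ (fun x ↦ (h x).inverse) O := fun x hx ↦
    ((isInvertible_of_pos (hpos x hx)).contDiffAt_map_inverse).comp_contDiffWithinAt x (hh x hx)
  refine contDiffOn_clm_apply.2 fun u ↦ contDiffOn_clm_apply.2 fun v ↦ ?_
  have h2 : ContDiffOn ℝ ∞ (fun x ↦ h x (k x u v)) O := contDiffOn_clm_apply.2 fun w ↦ hk u v w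
  refine (h1.clm_apply h2).congr fun x hx ↦ ?_
  exact ((isInvertible_of_pos (hpos x hx)).inverse_apply_self _).symm

lemma exists_decomposition {h : E →L[ℝ] E →L[ℝ] ℝ} (hpos : ∀ v, v ≠ 0 → 0 < h v v) {t : E}
    {V W : Submodule ℝ E}
    (hdim : Module.finrank ℝ E = 1 + Module.finrank ℝ V + Module.finrank ℝ W) (ht : h t t = 1)
    (htv : ∀ v ∈ V, h t v = 0) (htw : ∀ w ∈ W, h t w = 0)
    (hvw : ∀ v ∈ V, ∀ w ∈ W, h v w = 0) (x : E) :
    ∃ c : ℝ, ∃ v ∈ V, ∃ w ∈ W, x = c • t + v + w := by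
  let L : (ℝ × V × W) →ₗ[ℝ] E :=
    (LinearMap.toSpanSingleton ℝ E t).coprod (V.subtype.coprod W.subtype)
  have hL : ∀ c v w, L (c, v, w) = c • t + (v + w) := fun c v w ↦ by simp [L]
  have hinj : Function.Injective L := by
    rw [injective_iff_map_eq_zero]
    rintro ⟨c, ⟨v, hv⟩, ⟨w, hw⟩⟩ h0
    rw [hL] at h0
    have h1 := congrArg (h t) h0
    simp only [map_add, map_smul, ht, htv v hv, htw w hw, smul_eq_mul, mul_one, add_zero,
      map_zero] at h1
    subst h1
    rw [zero_smul, zero_add] at h0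
    have h2 := congrArg (h v) h0
    simp only [map_add, hvw v hv w hw, add_zero, map_zero] at h2
    have h3 : v = 0 := by
      by_contra h4
      exact (hpos v h4).ne' h2
    subst h3
    rw [zero_add] at h0
    simp only at h0
    subst h0
    rfl
  have hsurj : Function.Surjective L :=
    (LinearMap.injective_iff_surjective_of_finrank_eq_finrank (by
      simp [hdim, add_assoc])).1 hinj
  obtain ⟨⟨c, v, w⟩, rfl⟩ := hsurj x
  exact ⟨c, v, v.2, w, w.2, by rw [hL, add_assoc]⟩

end Flat

section Data

variable {n : ℕ} {M : Type*} [TopologicalSpace M] [ChartedSpace (Euc n) M]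
  [IsManifold (𝓡 n) ∞ M] {φ : OpenPartialHomeomorph M (Euc n)} (hφ : IsSmoothChart φ)
  {ψ : M → Euc (n + 1)} (hψ : IsCentroaffine ψ)
  {nablaHat : CovariantDerivative (𝓡 n) (Euc n) (TangentSpace (𝓡 n) : M → Type _)}
  {ε : ℝ} (hLC : IsLeviCivita (metric ε ψ) nablaHat) (hε : ε = 1 ∨ ε = -1)
  (hpos : MetricPosDef ε ψ)

include hφ hψ hLC hε hpos in
lemma structureEquations_chart {O : Set (Euc n)} (hO : IsOpen O) (hOφ : O ⊆ φ.target) :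
    StructureEquations ε O (ψ ∘ φ.symm)
      (fun x ↦ flatConn (ψ ∘ φ.symm) x - chartDiff hψ nablaHat φ x) (chartDiff hψ nablaHat φ)
      (flatMetric ε (ψ ∘ φ.symm)) := by
  have hεε : ε * ε = 1 := by rcases hε with rfl | rfl <;> norm_num
  have hε0 : ε ≠ 0 := by rintro rfl; norm_num at hεε
  have hf : ∀ x ∈ O, ContDiffAt ℝ ∞ (ψ ∘ φ.symm) x := fun x hx ↦
    (contDiffOn_chart_rep hφ hψ).contDiffAt (φ.open_target.mem_nhds (hOφ hx))
  have ht : ∀ x ∈ O, TransversalAt (ψ ∘ φ.symm) x := fun x hx ↦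
    transversalAt_chart hφ hψ (hOφ hx)
  have hG : ContDiffOn ℝ ∞ (flatConn (ψ ∘ φ.symm)) O := fun x hx ↦
    (contDiffAt_flatConn finrank_euc_succ (hf x hx) (ht x hx)).contDiffWithinAt
  have hh : ContDiffOn ℝ ∞ (flatMetric ε (ψ ∘ φ.symm)) O := fun x hx ↦
    (contDiffAt_flatMetric finrank_euc_succ (hf x hx) (ht x hx)).contDiffWithinAt
  have hp : ∀ x ∈ O, ∀ v, v ≠ 0 → 0 < flatMetric ε (ψ ∘ φ.symm) x v v := by
    intro x hx v hv
    have hq := φ.map_target (hOφ hx)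
    have h1 := metric_chart hφ hψ hε hq (coordField φ v (φ.symm x)) (coordField φ v (φ.symm x))
    rw [hφ.chartDeriv_coordField hq, φ.right_inv (hOφ hx)] at h1
    rw [← h1]
    refine hpos _ _ fun h0 ↦ hv ?_
    rw [← hφ.chartDeriv_coordField hq v, h0, map_zero]
  have hdh : ContDiffOn ℝ ∞ (fderiv ℝ (flatMetric ε (ψ ∘ φ.symm))) O :=
    hh.fderiv_of_isOpen hO (by norm_cast)
  have hK : ContDiffOn ℝ ∞ (chartDiff hψ nablaHat φ) O := by
    refine contDiffOn_of_pos hh hp fun u v w ↦ ?_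
    refine ContDiffOn.congr ?_ fun x hx ↦
      (flatMetric_chartDiff hφ hψ hLC hε (hOφ hx) u v w).2
    refine contDiffOn_const.mul ((((hh.clm_apply ((hG.clm_apply contDiffOn_const).clm_apply
      contDiffOn_const)).clm_apply contDiffOn_const).add ((hh.clm_apply
      contDiffOn_const).clm_apply ((hG.clm_apply contDiffOn_const).clm_apply
      contDiffOn_const))).sub (((hdh.clm_apply contDiffOn_const).clm_apply
      contDiffOn_const).clm_apply contDiffOn_const))
  exact
    { isOpen := hO
      ne_zero := hε0
      smooth := (contDiffOn_chart_rep hφ hψ).mono hOφ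
      smooth_conn := hG.sub hK
      smooth_diff := hK
      smooth_metric := hh
      transversal := ht
      gauss := fun x hx u v ↦ by
        simpa using flat_gauss finrank_euc_succ hεε (ht x hx) u v
      conn_symm := fun x hx u v ↦ by
        simp [(flat_symm (ε := ε) (hf x hx) u v).1, chartDiff_symm hφ hψ hLC (hOφ hx) u v]
      diff_symm := fun x hx u v ↦ chartDiff_symm hφ hψ hLC (hOφ hx) u v
      cubic_symm := fun x hx u v w ↦ (flatMetric_chartDiff hφ hψ hLC hε (hOφ hx) u v w).1
      metric_symm := fun x hx u v ↦ (flat_symm (hf x hx) u v).2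
      metric_pos := hp
      compatible := fun x hx u v w ↦ flatMetric_compatible hφ hψ hLC hε (hOφ hx) u v w }

include hφ hψ in
/-- A smooth vector field is smooth in a smooth chart. -/
lemma contDiffOn_field_chart {T : VField n M} (hT : T.SmoothOn Set.univ) {O : Set (Euc n)}
    (hOφ : O ⊆ φ.target) :
    ContDiffOn ℝ ∞ (fun x ↦ chartDeriv φ (φ.symm x) (T (φ.symm x))) O := by
  have h1 : ContMDiff (𝓡 n).tangent 𝓘(ℝ, Euc (n + 1)).tangent ∞
      (tangentMap (𝓡 n) 𝓘(ℝ, Euc (n + 1)) ψ) := hψ.smooth.contMDiff_tangentMap (by norm_cast)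
  have h2 := contMDiff_snd_tangentBundle_modelSpace (n := ∞) (Euc (n + 1)) 𝓘(ℝ, Euc (n + 1))
  -- The field is pushed into the ambient space and its coordinates are recovered with the inverse
  -- of the splitting.
  have h3 : ContMDiff (𝓡 n) 𝓘(ℝ, Euc (n + 1)) ∞ (fun q ↦ mvfderiv (𝓡 n) ψ q (T q)) :=
    (h2.comp h1).comp (contMDiffOn_univ.1 hT)
  have h4 : ContDiffOn ℝ ∞ ((fun q ↦ mvfderiv (𝓡 n) ψ q (T q)) ∘ φ.symm) O :=
    ((h3.comp_contMDiffOn hφ.smooth_symm).contDiffOn).mono hOφ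
  have h5 : ContDiffOn ℝ ∞ (fun x ↦ (flatSplitting (ψ ∘ φ.symm) x).inverse) O := fun x hx ↦
    (contDiffAt_flatSplitting_inverse finrank_euc_succ
      ((contDiffOn_chart_rep hφ hψ).contDiffAt (φ.open_target.mem_nhds (hOφ hx)))
      (transversalAt_chart hφ hψ (hOφ hx))).contDiffWithinAt
  refine (h5.clm_apply h4).fst.congr fun x hx ↦ ?_
  have hq := φ.map_target (hOφ hx)
  have h6 := ((transversalAt_chart hφ hψ (hOφ hx)).isInvertible
    finrank_euc_succ).inverse_apply_self (chartDeriv φ (φ.symm x) (T (φ.symm x)), 0)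
  rw [flatSplitting_apply, zero_smul, add_zero] at h6
  rw [Function.comp_apply, mvfderiv_chart hφ hψ hq, φ.right_inv (hOφ hx), h6]

/-- The distribution `D` in a chart. -/
def chartDistribution (φ : OpenPartialHomeomorph M (Euc n))
    (D : Π p : M, Submodule ℝ (TangentSpace (𝓡 n) p)) (x : Euc n) : Submodule ℝ (Euc n) :=
  (D (φ.symm x)).map (chartDeriv φ (φ.symm x)).toLinearMap

include hφ in
lemma finrank_chartDistribution {k : ℕ} {D : Π p : M, Submodule ℝ (TangentSpace (𝓡 n) p)}
    (hD : IsDistribution k D) {x : Euc n} (hx : x ∈ φ.target) :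
    Module.finrank ℝ (chartDistribution φ D x) = k := by
  rw [← hD.finrank_eq (φ.symm x)]
  exact (LinearEquiv.finrank_eq (Submodule.equivMapOfInjective _
    (hφ.chartDeriv_injective (φ.map_target hx)) (D (φ.symm x)))).symm

include hφ in
lemma chartDiff_chartDeriv {x : Euc n} (hx : x ∈ φ.target)
    (v w : TangentSpace (𝓡 n) (φ.symm x)) :
    chartDiff hψ nablaHat φ x (chartDeriv φ (φ.symm x) v) (chartDeriv φ (φ.symm x) w) =
      chartDeriv φ (φ.symm x) (differenceTensor hψ nablaHat (φ.symm x) v w) := by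
  rw [chartDiff_apply, hφ.coordField_chartDeriv (φ.map_target hx),
    hφ.coordField_chartDeriv (φ.map_target hx)]

include hφ hψ hLC hε hpos in
lemma isEigenField_chart {n₁ n₂ : ℕ} (hn : 1 + n₁ + n₂ = n) {T : VField n M}
    (hT : T.SmoothOn Set.univ) (hunit : ∀ p, metric ε ψ p (T p) (T p) = 1)
    {D₂ D₃ : Π p : M, Submodule ℝ (TangentSpace (𝓡 n) p)}
    (hD₂ : IsDistribution n₁ D₂) (hD₃ : IsDistribution n₂ D₃)
    (horth₁₂ : ∀ p, ∀ v ∈ D₂ p, metric ε ψ p (T p) v = 0)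
    (horth₁₃ : ∀ p, ∀ w ∈ D₃ p, metric ε ψ p (T p) w = 0)
    (horth₂₃ : ∀ p, ∀ v ∈ D₂ p, ∀ w ∈ D₃ p, metric ε ψ p v w = 0) {a b : ℝ}
    (hKTT : ∀ p, differenceTensor hψ nablaHat p (T p) (T p) = (a + b) • T p)
    (hKTV : ∀ p, ∀ v ∈ D₂ p, differenceTensor hψ nablaHat p (T p) v = a • v)
    (hKTW : ∀ p, ∀ w ∈ D₃ p, differenceTensor hψ nablaHat p (T p) w = b • w)
    (hab : a * b = ε) (hne : a ≠ b) {O : Set (Euc n)} (hO : IsOpen O) (hOφ : O ⊆ φ.target) :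
    IsEigenField ε O (ψ ∘ φ.symm)
      (fun x ↦ flatConn (ψ ∘ φ.symm) x - chartDiff hψ nablaHat φ x) (chartDiff hψ nablaHat φ)
      (flatMetric ε (ψ ∘ φ.symm)) a b (fun x ↦ chartDeriv φ (φ.symm x) (T (φ.symm x))) ∧
    ∀ x ∈ O, (∀ v ∈ chartDistribution φ D₂ x,
        chartDiff hψ nablaHat φ x (chartDeriv φ (φ.symm x) (T (φ.symm x))) v = a • v) ∧
      (∀ w ∈ chartDistribution φ D₃ x,
        chartDiff hψ nablaHat φ x (chartDeriv φ (φ.symm x) (T (φ.symm x))) w = b • w) ∧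
      (∀ v ∈ chartDistribution φ D₂ x, flatMetric ε (ψ ∘ φ.symm) x
        (chartDeriv φ (φ.symm x) (T (φ.symm x))) v = 0) ∧
      (∀ w ∈ chartDistribution φ D₃ x, flatMetric ε (ψ ∘ φ.symm) x
        (chartDeriv φ (φ.symm x) (T (φ.symm x))) w = 0) := by
  have H := structureEquations_chart hφ hψ hLC hε hpos hO hOφ
  have hm : ∀ x ∈ O, ∀ v w : TangentSpace (𝓡 n) (φ.symm x), flatMetric ε (ψ ∘ φ.symm) x
      (chartDeriv φ (φ.symm x) v) (chartDeriv φ (φ.symm x) w) = metric ε ψ (φ.symm x) v w := by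
    intro x hx v w
    have h1 := metric_chart hφ hψ hε (φ.map_target (hOφ hx)) v w
    rw [φ.right_inv (hOφ hx)] at h1
    exact h1.symm
  have hV : ∀ x ∈ O, ∀ v ∈ chartDistribution φ D₂ x,
      chartDiff hψ nablaHat φ x (chartDeriv φ (φ.symm x) (T (φ.symm x))) v = a • v := by
    rintro x hx _ ⟨v, hv, rfl⟩
    refine (chartDiff_chartDeriv hφ hψ (hOφ hx) _ _).trans ?_
    rw [hKTV _ v hv, map_smul]
    rfl
  have hW : ∀ x ∈ O, ∀ v ∈ chartDistribution φ D₃ x,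
      chartDiff hψ nablaHat φ x (chartDeriv φ (φ.symm x) (T (φ.symm x))) v = b • v := by
    rintro x hx _ ⟨v, hv, rfl⟩
    refine (chartDiff_chartDeriv hφ hψ (hOφ hx) _ _).trans ?_
    rw [hKTW _ v hv, map_smul]
    rfl
  have hTT : ∀ x ∈ O, chartDiff hψ nablaHat φ x (chartDeriv φ (φ.symm x) (T (φ.symm x)))
      (chartDeriv φ (φ.symm x) (T (φ.symm x))) =
        (a + b) • chartDeriv φ (φ.symm x) (T (φ.symm x)) := by
    intro x hx
    rw [chartDiff_chartDeriv hφ hψ (hOφ hx), hKTT, map_smul]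
  have hTV : ∀ x ∈ O, ∀ v ∈ chartDistribution φ D₂ x, flatMetric ε (ψ ∘ φ.symm) x
      (chartDeriv φ (φ.symm x) (T (φ.symm x))) v = 0 := by
    rintro x hx _ ⟨v, hv, rfl⟩
    exact (hm x hx _ _).trans (horth₁₂ _ v hv)
  have hTW : ∀ x ∈ O, ∀ v ∈ chartDistribution φ D₃ x, flatMetric ε (ψ ∘ φ.symm) x
      (chartDeriv φ (φ.symm x) (T (φ.symm x))) v = 0 := by
    rintro x hx _ ⟨v, hv, rfl⟩
    exact (hm x hx _ _).trans (horth₁₃ _ v hv)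
  have hun : ∀ x ∈ O, flatMetric ε (ψ ∘ φ.symm) x (chartDeriv φ (φ.symm x) (T (φ.symm x)))
      (chartDeriv φ (φ.symm x) (T (φ.symm x))) = 1 := fun x hx ↦ (hm x hx _ _).trans (hunit _)
  refine ⟨
    { toStructureEquations := H
      smooth_field := contDiffOn_field_chart hφ hψ hT hOφ
      unit := hun
      eigen := hTT
      quadratic := fun x hx y ↦ ?_
      mul_eq := hab
      ne := hne }, fun x hx ↦ ⟨hV x hx, hW x hx, hTV x hx, hTW x hx⟩⟩
  -- The quadratic relation is linear in the vector, so it is checked on `T` and on the two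
  -- eigendistributions.
  obtain ⟨c, v, hv, w, hw, rfl⟩ := exists_decomposition (H.metric_pos x hx) (by
    rw [finrank_chartDistribution hφ hD₂ (hOφ hx), finrank_chartDistribution hφ hD₃ (hOφ hx)]
    simp [← hn]) (hun x hx) (hTV x hx) (hTW x hx) (by
      rintro _ ⟨v, hv, rfl⟩ _ ⟨w, hw, rfl⟩
      exact (hm x hx _ _).trans (horth₂₃ _ v hv w hw)) y
  simp only [map_add, map_smul, hTT x hx, hV x hx v hv, hW x hx w hw, hun x hx, hTV x hx v hv,
    hTW x hx w hw]
  simp only [smul_eq_mul, ← hab]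
  module

end Data

/-! ### Assembling the local Calabi product in a chart. -/

section Flat

variable {E F : Type*} [NormedAddCommGroup E] [NormedSpace ℝ E] [NormedAddCommGroup F]
  [NormedSpace ℝ F]

lemma exists_hasFDerivAt_equiv {Φ : OpenPartialHomeomorph E F}
    (hΦ : ContDiffOn ℝ ∞ Φ Φ.source) (hΦ' : ContDiffOn ℝ ∞ Φ.symm Φ.target) {y : F}
    (hy : y ∈ Φ.target) : ∃ e : F ≃L[ℝ] E, HasFDerivAt Φ.symm (e : F →L[ℝ] E) y := by
  have hx := Φ.map_target hy
  have h1 : HasFDerivAt Φ.symm (fderiv ℝ Φ.symm y) y :=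
    ((hΦ'.contDiffAt (Φ.open_target.mem_nhds hy)).differentiableAt (by simp)).hasFDerivAt
  have h2 : HasFDerivAt Φ (fderiv ℝ Φ (Φ.symm y)) (Φ.symm y) :=
    ((hΦ.contDiffAt (Φ.open_source.mem_nhds hx)).differentiableAt (by simp)).hasFDerivAt
  have h3 : fderiv ℝ Φ (Φ.symm y) ∘L fderiv ℝ Φ.symm y = ContinuousLinearMap.id ℝ F := by
    refine (h2.comp y h1).unique ((hasFDerivAt_id y).congr_of_eventuallyEq ?_)
    filter_upwards [Φ.open_target.mem_nhds hy] with z hz using Φ.right_inv hz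
  have h4 : fderiv ℝ Φ.symm y ∘L fderiv ℝ Φ (Φ.symm y) = ContinuousLinearMap.id ℝ E := by
    have h1' : HasFDerivAt Φ.symm (fderiv ℝ Φ.symm y) (Φ (Φ.symm y)) := by
      rwa [Φ.right_inv hy]
    refine (h1'.comp _ h2).unique ((hasFDerivAt_id _).congr_of_eventuallyEq ?_)
    filter_upwards [Φ.open_source.mem_nhds hx] with z hz using Φ.left_inv hz
  exact ⟨ContinuousLinearEquiv.equivOfInverse (fderiv ℝ Φ.symm y) (fderiv ℝ Φ (Φ.symm y))
    (fun v ↦ congrArg (fun L : F →L[ℝ] F ↦ L v) h3)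
    (fun v ↦ congrArg (fun L : E →L[ℝ] E ↦ L v) h4), h1⟩

variable {ε : ℝ} {O : Set E} {f : E → F}
    {Γ K : E → E →L[ℝ] E →L[ℝ] E} {h : E → E →L[ℝ] E →L[ℝ] ℝ} {a b : ℝ} {T : E → E}

/-- The injection of `V × ℝ` into the eigenspace of the endomorphism with `f ↦ df(t)`. -/
lemma exists_eigenspace (f : E → F) {x t : E} (hx : TransversalAt f x) {B : F →L[ℝ] F}
    (hBf : B (f x) = fderiv ℝ f x t)
    (hBt : B (fderiv ℝ f x t) = fderiv ℝ f x ((a + b) • t) - (a * b) • f x)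
    (hb : b ≠ 0) {V : Submodule ℝ E}
    (hBV : ∀ v ∈ V, B (fderiv ℝ f x v) = a • fderiv ℝ f x v) :
    ∃ i : (V × ℝ) →ₗ[ℝ] F, Function.Injective i ∧ ∀ v, B (i v) = a • i v := by
  -- On the span of `f` and `df(t)` the map `B` has characteristic polynomial `(X - a)(X - b)`; the
  -- vector `df(t) - b f` is its eigenvector for `a`.
  let i : (V × ℝ) →ₗ[ℝ] F := ((fderiv ℝ f x).toLinearMap ∘ₗ V.subtype).coprod
    (LinearMap.toSpanSingleton ℝ F (fderiv ℝ f x t - b • f x))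
  have hi : ∀ v r, i (v, r) = fderiv ℝ f x v + r • (fderiv ℝ f x t - b • f x) := fun v r ↦ by
    simp [i]
  refine ⟨i, ?_, ?_⟩
  · rw [injective_iff_map_eq_zero]
    rintro ⟨v, r⟩ h0
    rw [hi] at h0
    obtain ⟨h1, h2⟩ := hx (v + r • t) (-(r * b)) (by
      rw [← h0, map_add, map_smul]
      module)
    have hr : r = 0 := by simpa [hb] using h2
    subst hr
    simpa using h1
  · rintro ⟨v, r⟩
    rw [hi]
    simp only [map_add, map_smul, map_sub, hBf, hBt, hBV v v.2]
    module

lemma IsEigenField.convexAt (H : IsEigenField ε O f Γ K h a b T) {x : E} (hx : x ∈ O) :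
    ConvexAt ε f x := fun v hv ↦
  ⟨Γ x v v + K x v v, h x v v, H.metric_pos x hx v hv, H.gauss x hx v v⟩

variable [FiniteDimensional ℝ E] [FiniteDimensional ℝ F]

/-- As `B` is constant, its eigenspaces can be read off at the single point `x₀`: `df(V)` with
`df(T) - b f`, and `df(W)` with `df(T) - a f`. The resulting splitting serves all of `O`. -/
lemma IsEigenField.exists_splitImmersion (H : IsEigenField ε O f Γ K h a b T)
    (hO : Convex ℝ O) {n₁ n₂ : ℕ} (hE : Module.finrank ℝ E = 1 + n₁ + n₂)
    (hF : Module.finrank ℝ F = Module.finrank ℝ E + 1) {x₀ : E} (hx₀ : x₀ ∈ O)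
    {V W : Submodule ℝ E} (hV : Module.finrank ℝ V = n₁) (hW : Module.finrank ℝ W = n₂)
    (hKV : ∀ v ∈ V, K x₀ (T x₀) v = a • v) (hKW : ∀ w ∈ W, K x₀ (T x₀) w = b • w)
    (hTV : ∀ v ∈ V, h x₀ (T x₀) v = 0) (hTW : ∀ w ∈ W, h x₀ (T x₀) w = 0) :
    ∃ A : (Euc (n₁ + 1) × Euc (n₂ + 1)) ≃L[ℝ] F,
      SplitImmersion O a b (fun x ↦ (A.symm (f x)).1) (fun x ↦ (A.symm (f x)).2)
        (fun x v ↦ K x (T x) v) T (fun x ↦ h x (T x)) := by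
  obtain ⟨B, hBf, hBd⟩ := H.exists_endomorphism hO.isPreconnected hF hx₀
  have hab : a * b ≠ 0 := by rw [H.mul_eq]; exact H.ne_zero
  have hBt : B (fderiv ℝ f x₀ (T x₀)) =
      fderiv ℝ f x₀ ((a + b) • T x₀) - (a * b) • f x₀ := by
    rw [hBd x₀ hx₀, H.eigen x₀ hx₀, H.unit x₀ hx₀, mul_one, H.mul_eq]
  obtain ⟨i, hi, hia⟩ := exists_eigenspace f (H.transversal x₀ hx₀) (hBf x₀ hx₀) hBt
    (right_ne_zero_of_mul hab) (V := V) (fun v hv ↦ by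
      rw [hBd x₀ hx₀, hKV v hv, hTV v hv, mul_zero, zero_smul, sub_zero, map_smul])
  obtain ⟨j, hj, hjb⟩ := exists_eigenspace (a := b) (b := a) f (H.transversal x₀ hx₀)
    (hBf x₀ hx₀) (by rw [hBt, add_comm a b, mul_comm a b]) (left_ne_zero_of_mul hab) (V := W)
    (fun w hw ↦ by
      rw [hBd x₀ hx₀, hKW w hw, hTW w hw, mul_zero, zero_smul, sub_zero, map_smul])
  obtain ⟨A, hA⟩ := exists_diagonalization H.ne (B := B) (n₁ := n₁) (n₂ := n₂)
    (by rw [hF, hE]; ring) (by simp [hV]) (by simp [hW]) i j hi hj hia hjb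
  have hA' : ∀ y, A.symm (B y) = (a • (A.symm y).1, b • (A.symm y).2) := fun y ↦ by
    rw [ContinuousLinearEquiv.symm_apply_eq, ← hA, A.apply_symm_apply]
  have hfd : ∀ x ∈ O, HasFDerivAt f (fderiv ℝ f x) x := fun x hx ↦
    ((H.contDiffAt hx).differentiableAt (by simp)).hasFDerivAt
  have h₂ : ∀ x ∈ O, ∀ v, fderiv ℝ (fun x ↦ (A.symm (f x)).1) x v =
      (A.symm (fderiv ℝ f x v)).1 := fun x hx v ↦ by
    rw [show fderiv ℝ (fun x ↦ (A.symm (f x)).1) x = _ from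
      ((A.symm.hasFDerivAt.comp x (hfd x hx)).fst).fderiv]
    rfl
  have h₃ : ∀ x ∈ O, ∀ v, fderiv ℝ (fun x ↦ (A.symm (f x)).2) x v =
      (A.symm (fderiv ℝ f x v)).2 := fun x hx v ↦ by
    rw [show fderiv ℝ (fun x ↦ (A.symm (f x)).2) x = _ from
      ((A.symm.hasFDerivAt.comp x (hfd x hx)).snd).fderiv]
    rfl
  have hθ : ContDiffOn ℝ ∞ (fun x ↦ h x (T x)) O := H.smooth_metric.clm_apply H.smooth_field
  have hθd : ∀ x ∈ O, ∀ u v, fderiv ℝ (fun x ↦ h x (T x)) x u v =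
      h x (T x) (Γ x u v) := fun x hx u v ↦ by
    rw [← H.fderiv_dual_field hx, fderiv_apply_const
      ((hθ.contDiffAt (H.isOpen.mem_nhds hx)).differentiableAt (by simp))]
  have hpush : ∀ x ∈ O, ∀ v, A.symm (fderiv ℝ f x (K x (T x) v)) =
      (a • (A.symm (fderiv ℝ f x v)).1, b • (A.symm (fderiv ℝ f x v)).2) +
        (a * b * h x (T x) v) • A.symm (f x) := fun x hx v ↦ by
    rw [← hA', hBd x hx, map_sub, map_smul, H.mul_eq, sub_add_cancel]
  refine ⟨A,
    { isOpen := H.isOpen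
      convex := hO
      smooth₂ := (A.symm.contDiff.comp_contDiffOn H.smooth).fst
      smooth₃ := (A.symm.contDiff.comp_contDiffOn H.smooth).snd
      smooth_form := hθ
      closed := fun x hx u v ↦ by rw [hθd x hx, hθd x hx, H.conn_symm x hx]
      unit := H.unit
      form_endo := fun x hx v ↦ by
        rw [← H.cubic_symm x hx, H.eigen x hx, map_smul]
        rfl
      field₂ := fun x hx ↦ by rw [h₂ x hx, ← hBf x hx, hA']
      field₃ := fun x hx ↦ by rw [h₃ x hx, ← hBf x hx, hA']
      push₂ := fun x hx v ↦ by
        rw [h₂ x hx, h₂ x hx, hpush x hx]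
        rfl
      push₃ := fun x hx v ↦ by
        rw [h₃ x hx, h₃ x hx, hpush x hx]
        rfl
      transversal := fun x hx v c e₂ e₃ ↦ by
        rw [h₂ x hx] at e₂
        rw [h₃ x hx] at e₃
        refine H.transversal x hx v c (A.symm.injective ?_)
        rw [map_add, map_smul, map_zero]
        exact Prod.ext e₂ e₃
      ne := H.ne
      ne_zero₂ := left_ne_zero_of_mul hab
      ne_zero₃ := right_ne_zero_of_mul hab }⟩

lemma isLocallyStronglyConvex_factors {n₁ n₂ : ℕ} {l : ℝ} (hl0 : l ≠ 0) (hl : l ≠ -1)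
    (hε : ε = 1 ∨ ε = -1) {ψ₁ : Euc n₁ → Euc (n₁ + 1)} {ψ₂ : Euc n₂ → Euc (n₂ + 1)}
    (h₁ : ContDiff ℝ ∞ ψ₁) (h₂ : ContDiff ℝ ∞ ψ₂)
    (hc : ∀ y z, ∃ u : ℝ, TransversalAt (calabiProduct l ψ₁ ψ₂) (u, y, z) ∧
      ConvexAt ε (calabiProduct l ψ₁ ψ₂) (u, y, z)) :
    IsLocallyStronglyConvex ψ₁ ∧ IsLocallyStronglyConvex ψ₂ := by
  have hε0 : ε ≠ 0 := by rcases hε with rfl | rfl <;> norm_num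
  have hl' : 1 + l ≠ 0 := fun h0 ↦ hl (by linarith)
  have hs₁ : ε * (1 + l⁻¹) ≠ 0 := by
    refine mul_ne_zero hε0 ?_
    rw [show 1 + l⁻¹ = (1 + l) * l⁻¹ by field_simp; ring]
    exact mul_ne_zero hl' (inv_ne_zero hl0)
  have hs₂ : ε * (1 + l) ≠ 0 := mul_ne_zero hε0 hl'
  -- The two factors may need different signs, but each sign depends only on `ε` and `l`, so it is
  -- the same at all points of a factor.
  obtain ⟨ε₁, hε₁, e₁⟩ := exists_sign hs₁
  obtain ⟨ε₂, hε₂, e₂⟩ := exists_sign hs₂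
  constructor
  · refine isLocallyStronglyConvex_of_flat h₁ hε₁ (fun y ↦ ?_) fun y ↦ ?_ <;>
      obtain ⟨u, ht, hcv⟩ := hc y 0
    · exact ht.fst_factor h₁ h₂ hl
    · exact hcv.fst_factor h₁ h₂ hl hl0 e₁ hs₁ ht
  · refine isLocallyStronglyConvex_of_flat h₂ hε₂ (fun z ↦ ?_) fun z ↦ ?_ <;>
      obtain ⟨u, ht, hcv⟩ := hc 0 z
    · exact ht.snd_factor h₁ h₂ hl
    · exact hcv.snd_factor h₁ h₂ hl e₂ hs₂ ht

lemma IsEigenField.exists_calabi (H : IsEigenField ε O f Γ K h a b T) (hε : ε = 1 ∨ ε = -1)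
    (hO : Convex ℝ O) {n₁ n₂ : ℕ} (hE : Module.finrank ℝ E = 1 + n₁ + n₂)
    (hF : Module.finrank ℝ F = Module.finrank ℝ E + 1) {x₀ : E} (hx₀ : x₀ ∈ O)
    {V W : Submodule ℝ E} (hV : Module.finrank ℝ V = n₁) (hW : Module.finrank ℝ W = n₂)
    (hKV : ∀ v ∈ V, K x₀ (T x₀) v = a • v) (hKW : ∀ w ∈ W, K x₀ (T x₀) w = b • w)
    (hTV : ∀ v ∈ V, h x₀ (T x₀) v = 0) (hTW : ∀ w ∈ W, h x₀ (T x₀) w = 0) :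
    ∃ (l : ℝ) (ψ₁ : Euc n₁ → Euc (n₁ + 1)) (ψ₂ : Euc n₂ → Euc (n₂ + 1))
      (Φ : OpenPartialHomeomorph E (ℝ × Euc n₁ × Euc n₂))
      (A : (Euc (n₁ + 1) × Euc (n₂ + 1)) ≃L[ℝ] F), l ≠ 0 ∧ l ≠ -1 ∧
      IsLocallyStronglyConvex ψ₁ ∧ IsLocallyStronglyConvex ψ₂ ∧ x₀ ∈ Φ.source ∧ Φ.source ⊆ O ∧
      ContDiffOn ℝ ∞ Φ Φ.source ∧ ContDiffOn ℝ ∞ Φ.symm Φ.target ∧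
      ∀ x ∈ Φ.source, f x = A (calabiProduct l ψ₁ ψ₂ (Φ x)) := by
  obtain ⟨A, S⟩ := H.exists_splitImmersion hO hE hF hx₀ hV hW hKV hKW hTV hTW
  obtain ⟨G₂, G₃, Φ₀, u₀, y₀, z₀, r, hr, htgt, hG₂, hG₃, hx₀s, hsO, hΦ₀, hΦ₀', hf₀⟩ :=
    S.exists_calabi_ball hE hx₀
  obtain ⟨ψ₁, ψ₂, Φ, h₁, h₂, hsrc, hΦ, hΦ', hproj, hf⟩ :=
    exists_calabi_univ (f := fun x ↦ A.symm (f x)) Φ₀ hr htgt hG₂ hG₃ hΦ₀ hΦ₀' hf₀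
  have hl0 : -b / a ≠ 0 := div_ne_zero (neg_ne_zero.2 S.ne_zero₃) S.ne_zero₂
  have hl : -b / a ≠ -1 := by
    intro h0
    rw [div_eq_iff S.ne_zero₂] at h0
    exact H.ne (by linarith)
  have hsO' : Φ.source ⊆ O := hsrc ▸ hsO
  obtain ⟨c₁, c₂⟩ := isLocallyStronglyConvex_factors hl0 hl hε h₁ h₂ fun y z ↦ by
    obtain ⟨u, hu⟩ := hproj y z
    have hx := hsO' (Φ.map_target hu)
    obtain ⟨e, he⟩ := exists_hasFDerivAt_equiv hΦ hΦ' hu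
    have hfx := H.contDiffAt hx
    have hg : calabiProduct (-b / a) ψ₁ ψ₂ =ᶠ[𝓝 (u, y, z)] (fun x ↦ A.symm (f x)) ∘ Φ.symm := by
      filter_upwards [Φ.open_target.mem_nhds hu] with p hp
      rw [Function.comp_apply, hf _ (Φ.map_target hp), Φ.right_inv hp]
    have hAf : ContDiffAt ℝ ∞ (fun x ↦ A.symm (f x)) (Φ.symm (u, y, z)) :=
      A.symm.contDiff.contDiffAt.comp _ hfx
    have ht : TransversalAt f (Φ.symm (u, y, z)) := H.transversal _ hx
    exact ⟨u, (ht.clm_comp (hfx.differentiableAt (by simp)) A.symm).comp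
        (hAf.differentiableAt (by simp)) he hg,
      ((H.convexAt hx).clm_comp hfx A.symm).comp hAf
        (hΦ'.contDiffAt (Φ.open_target.mem_nhds hu)) he hg⟩
  refine ⟨-b / a, ψ₁, ψ₂, Φ, A, hl0, hl, c₁, c₂, hsrc ▸ hx₀s, hsO', hΦ, hΦ', fun x hx ↦ ?_⟩
  rw [← hf x hx, A.apply_symm_apply]

end Flat

end Centroaffine

end

/-! ### The theorem on the manifold. -/

open Centroaffine in
theorem theorem3p1 {n n₁ n₂ : ℕ} (hn : 1 + n₁ + n₂ = n)
    {M : Type*} [TopologicalSpace M] [ChartedSpace (Euc n) M] [IsManifold (𝓡 n) ∞ M]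
    (ψ : M → Euc (n + 1)) (hψ : IsCentroaffine ψ)
    (ε : ℝ) (hε : ε = 1 ∨ ε = -1) (hpos : MetricPosDef ε ψ)
    (nablaHat : CovariantDerivative (𝓡 n) (Euc n) (TangentSpace (𝓡 n) : M → Type _))
    (hLC : IsLeviCivita (metric ε ψ) nablaHat)
    (T : VField n M) (hT : T.SmoothOn Set.univ) (hunit : ∀ p, metric ε ψ p (T p) (T p) = 1)
    (D₂ D₃ : Π p : M, Submodule ℝ (TangentSpace (𝓡 n) p))
    (hD₂ : IsDistribution n₁ D₂) (hD₃ : IsDistribution n₂ D₃)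
    (horth₁₂ : ∀ p, ∀ v ∈ D₂ p, metric ε ψ p (T p) v = 0)
    (horth₁₃ : ∀ p, ∀ w ∈ D₃ p, metric ε ψ p (T p) w = 0)
    (horth₂₃ : ∀ p, ∀ v ∈ D₂ p, ∀ w ∈ D₃ p, metric ε ψ p v w = 0)
    (l₁ l₂ l₃ : ℝ)
    (hKTT : ∀ p, differenceTensor hψ nablaHat p (T p) (T p) = l₁ • T p)
    (hKTV : ∀ p, ∀ v ∈ D₂ p, differenceTensor hψ nablaHat p (T p) v = l₂ • v)
    (hKTW : ∀ p, ∀ w ∈ D₃ p, differenceTensor hψ nablaHat p (T p) w = l₃ • w)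
    (hKVW : ∀ p, ∀ v ∈ D₂ p, ∀ w ∈ D₃ p, differenceTensor hψ nablaHat p v w = 0)
    (hl₁ : l₁ = l₂ + l₃) (hl₂₃ : l₂ * l₃ = ε) (hne : l₂ ≠ l₃) :
    IsLocallyCalabiProduct n₁ n₂ ψ := by
  intro p
  set φ := chartAt (Euc n) p with hφdef
  have hφ : IsSmoothChart φ := isSmoothChart_chartAt p
  have hp : p ∈ φ.source := mem_chart_source (Euc n) p
  -- A ball in the chart is convex: this gives the primitive `t` and the constancy of `B`.
  obtain ⟨r, hr, hball⟩ := Metric.isOpen_iff.1 φ.open_target (φ p) (φ.map_source hp)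
  have hx₀ : φ p ∈ Metric.ball (φ p) r := Metric.mem_ball_self hr
  subst hl₁
  obtain ⟨H, hD⟩ := isEigenField_chart hφ hψ hLC hε hpos hn hT hunit hD₂ hD₃ horth₁₂ horth₁₃
    horth₂₃ hKTT hKTV hKTW hl₂₃ hne Metric.isOpen_ball hball
  obtain ⟨hKV, hKW, hTV, hTW⟩ := hD _ hx₀
  obtain ⟨l, ψ₁, ψ₂, Φ, A, hl0, hl, c₁, c₂, hxΦ, hΦO, hΦ, hΦ', hf⟩ :=
    H.exists_calabi hε (convex_ball _ _) (by simp [hn]) (by simp) hx₀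
      (finrank_chartDistribution hφ hD₂ (hball hx₀))
      (finrank_chartDistribution hφ hD₃ (hball hx₀)) hKV hKW hTV hTW
  have hsrc : ∀ x ∈ (φ.trans Φ).source, x ∈ φ.source ∧ φ x ∈ Φ.source := fun x hx ↦ by
    rwa [OpenPartialHomeomorph.trans_source] at hx
  have htgt : ∀ y ∈ (φ.trans Φ).target, y ∈ Φ.target ∧ Φ.symm y ∈ φ.target := fun y hy ↦ by
    rwa [OpenPartialHomeomorph.trans_target] at hy
  refine ⟨l, hl0, hl, Euc n₁, inferInstance, inferInstance, inferInstance, inferInstance,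
    inferInstance, Euc n₂, inferInstance, inferInstance, inferInstance, inferInstance,
    inferInstance, ψ₁, ψ₂,
    { toPartialEquiv := (φ.trans Φ).toPartialEquiv
      open_source := (φ.trans Φ).open_source
      open_target := (φ.trans Φ).open_target
      contMDiffOn_toFun := ?_
      contMDiffOn_invFun := ?_ }, A, c₁, c₂, ?_, ?_⟩
  · have h1 : ContMDiffOn (𝓡 n) 𝓘(ℝ, ℝ × Euc n₁ × Euc n₂) ∞ (φ.trans Φ) (φ.trans Φ).source :=
      hΦ.contMDiffOn.comp (hφ.smooth.mono fun x hx ↦ (hsrc x hx).1) fun x hx ↦ (hsrc x hx).2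
    -- Identifies the self-model of the product space with the product of the models.
    rw [modelWithCornersSelf_prod, modelWithCornersSelf_prod, ← chartedSpaceSelf_prod,
      ← chartedSpaceSelf_prod] at h1
    exact h1
  · have h1 : ContMDiffOn 𝓘(ℝ, ℝ × Euc n₁ × Euc n₂) (𝓡 n) ∞ (φ.trans Φ).symm
        (φ.trans Φ).target :=
      hφ.smooth_symm.comp (hΦ'.contMDiffOn.mono fun x hx ↦ (htgt x hx).1)
        fun x hx ↦ (htgt x hx).2
    rw [modelWithCornersSelf_prod, modelWithCornersSelf_prod, ← chartedSpaceSelf_prod,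
      ← chartedSpaceSelf_prod] at h1
    exact h1
  · change p ∈ (φ.trans Φ).source
    rw [OpenPartialHomeomorph.trans_source]
    exact ⟨hp, hxΦ⟩
  · intro x hx
    obtain ⟨h1, h2⟩ := hsrc x hx
    have h3 := hf _ h2
    rw [Function.comp_apply, φ.left_inv h1] at h3
    exact h3
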